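/- Work in ZFC; in forcing, larger conditions are stronger. $\mathcal H(\chi)$ is the family of sets hereditarily of cardinality $<\chi$. $\mathcal H_{<\lambda}(\lambda^*)$ is the least family that contains all ordinals below $\lambda^*$ and contains each of its subsets of cardinality $<\lambda$. **Setting.** Let $\lambda$ be an (uncountable) strongly inaccessible cardinal, $\lambda^*>\lambda$ a regular cardinal, $A=\mathcal H_{<\lambda}(\lambda^*)$, $\chi>2^{\lambda^*}$ a regular cardinal, and $<^*_\chi$ a well-ordering of $\mathcal H(\chi)$. Call $N$ a *model* if $N\prec(\mathcal H(\chi),\in,<^*_\chi)$, $|N|=\lambda$ and ${}^{<\lambda}N\subseteq N$. Let $W\subseteq[A]^\lambda$ be such that for each $a\in W$: $\lambda\subseteq a$, and $f\in a$ whenever $f:w\to a$ with $w\in[a]^{<\lambda}$; and such that for every $x\in\mathcal H(\chi)$ there is a model $N$ with $x\in N$ and $N\cap A\in W$. **The forcing.** Let $\xi^*<\lambda$, $S^*\subseteq\{\beta<\lambda^+:\operatorname{cf}(\beta)=\lambda\}$, and for $\beta\in S^*$ let $B_\beta$ be a club of $\beta$ of order type $\lambda$ and $h_\beta:B_\beta\to\xi^*$.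 A condition of $\mathbb Q^*=\mathbb Q^*(S^*,\bar B,\bar h)$ is a tuple $p=(u,v,\bar e,h)$ such that - $u\in[\lambda^+]^{<\lambda}$, $v\in[S^*]^{<\lambda}$, $\bar e=\langle e_\beta:\beta\in v\rangle$, each $e_\beta$ is a closed bounded subset of $B_\beta$ and $e_\beta\subseteq u$; - $\sup(e_\beta)=\sup(u\cap\beta)$ for $\beta\in v$; and $\sup(e_{\beta_2})>\beta_1$, $\sup(e_{\beta_1})>\sup(B_{\beta_2}\cap\beta_1)$ for $\beta_1<\beta_2$ in $v$ (where $\sup\emptyset=0$); - $h:u\to\xi^*$ and $h(\alpha)=h_\beta(\alpha)$ for $\beta\in v$, $\alpha\in e_\beta$. The order: $p\le q$ iff $u^p\subseteq u^q$, $h^p\subseteq h^q$, $v^p\subseteq v^q$ and $e^q_\beta$ is an end-extension of $e^p_\beta$ for each $\beta\in v^p$. **Diamonds.** Let $D$ be a normal filter on $\lambda$ (proper, containing the end segments, closed under diagonal intersections); $D^+$ is the family of $D$-positive sets. A *$D$-pre-diamond* is $\bar F=\langle F_\delta:\delta\in S\rangle$ with $S\in D^+$, $S\subseteq\lambda$,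 $S$ containing all successor ordinals below $\lambda$, $0\notin S$, $\lambda\setminus S$ unbounded in $\lambda$, and $F_\delta:\delta\to\delta$. *$D$ has diamonds* if some $D$-pre-diamond satisfies $\{\delta\in S:F_\delta\subseteq f\}\in D^+$ for all $f:\lambda\to\lambda$. Let $\mathbb P$ be a forcing notion, $N$ a model, and $h:\lambda\to N$ with $\mathbb P\cap N\subseteq\operatorname{Rng}(h)$. For a list $\bar I=\langle I_\alpha:\alpha<\lambda\rangle$ of all open dense subsets of $\mathbb P$ that belong to $N$, a sequence $\langle p_\alpha:\alpha<\delta\rangle$ is *$\bar I$-exact* if $(\forall\xi<\delta)(\exists\alpha<\delta)\,p_\alpha\in I_\xi$. A $D$-pre-diamond $\bar F$ is a *quasi $D$-diamond for $(N,h,\mathbb P)$* if for some such list $\bar I$ and every increasing $\langle p_\alpha:\alpha<\lambda\rangle\subseteq\mathbb P\cap N$ with $E=\{\delta<\lambda:\langle p_\alpha:\alpha<\delta\rangle\text{ is }\bar I\text{-exact}\}\in D$, the set $\{\delta\in E\cap S:(\forall\alpha<\delta)\ h(F_\delta(\alpha))=p_\alpha\}$ is in $D^+$. **Bases.** A *$\lambda$-base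 for $\mathbb P$ over $W$* is a pair $(R,\bar Y)$ where $R\subseteq\mathbb P\times\lambda\times A$ is such that $(p,\delta,x)\in R$ and $p\le p'$ imply $(p',\delta,x)\in R$; $\bar Y=\langle Y_a:a\in W\rangle$ with $Y_a:\lambda\to[a]^{<\lambda}$; and for all $q\in\mathbb P$, $a\in W$ and limit $\delta<\lambda$ there are $p\ge q$ and $x\in Y_a(\delta)$ with $(p,\delta,x)\in R$. Given also $N,h,\bar F$ with $a=N\cap A\in W$, for limit $\delta\in S$ let $\mathcal Y(\delta)$ be the set of $x\in Y_a(\delta)$ such that, if $\langle h(F_\delta(\alpha)):\alpha<\delta\rangle$ is an increasing sequence of conditions, then it has an upper bound $p$ with $(p,\delta,x)\in R$. A *fuzzy candidate* (with respect to $\bar I$) is $\bar q=\langle q_{\delta,x}:\delta\in S\text{ limit},\,x\in\mathcal Y(\delta)\rangle\subseteq N\cap\mathbb P$, where all these $\mathcal Y(\delta)$ are non-empty, such that - for each $\alpha<\lambda$ there is $C\in D$ with $q_{\delta,x}\in I_\alpha$ for all limit $\delta\in S\cap C$ and $x\in\mathcal Y(\delta)$; - if $\langle h(F_\delta(\alpha)):\alpha<\delta\rangle$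 is an increasing $\bar I$-exact sequence of conditions, then $h(F_\delta(\alpha))\le q_{\delta,x}$ for all $\alpha<\delta$ and $(q_{\delta,x},\delta,x)\in R$. **The game.** A condition $r$ is *fuzzy generic for $\bar q$* if Generic has a winning strategy in the following game of length $\lambda$. At stage $i$ a condition $r_i$ above $r$ and above all $r_j$ ($j<i$), and a set $C_i\in D$, are chosen, by Generic if $i\in S$ and by Antigeneric if $i\notin S$. Generic wins if - for each $\alpha<\lambda$ there are $i<\lambda$ and $p\in I_\alpha\cap N$ with $p\le r_i$; and - whenever $\delta\in S\cap\bigcap_{i<\delta}C_i$ is a limit ordinal, $\langle h(F_\delta(\alpha)):\alpha<\delta\rangle$ is an increasing $\bar I$-exact sequence of conditions and $(\forall\alpha<\delta)(\exists i<\delta)\,h(F_\delta(\alpha))\le r_i$, then $q_{\delta,x}\le r_\delta$ for some $x\in\mathcal Y(\delta)$. **Fuzzy properness.** A $\lambda$-complete forcing notion $\mathbb P\in\mathcal H(\chi)$ is *fuzzy proper for $W$* if for every normal filter $D$ on $\lambda$ which has diamonds there are a $\lambda$-base $(R,\bar Y)$ for $\mathbb P$ over $W$ with $R\in\mathcal H(\chi)$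 and a $c\in\mathcal H(\chi)$ such that: for every model $N$ with $\lambda,\mathbb P,c,R\in N$ and $N\cap A\in W$, every $p\in\mathbb P\cap N$, every $h:\lambda\to N$ with $\mathbb P\cap N\subseteq\operatorname{Rng}(h)$, every quasi $D$-diamond $\bar F$ for $(N,h,\mathbb P)$, every list $\bar I$ as above and every fuzzy candidate $\bar q$ with respect to $\bar I$, there is a condition $r\ge p$ that is fuzzy generic for $\bar q$. **Claim.** $\mathbb Q^*(S^*,\bar B,\bar h)$ is a $\lambda$-complete forcing notion, it satisfies the $\lambda^+$-chain condition, and it is fuzzy proper for $W$. -/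

import Mathlib

universe u

/-! All objects live in the universe `ZFSet.{u}` of sets.  Ordinals `α` are identified with the von
Neumann ordinals `α.toZFSet` whenever they have to be elements of sets, ordered pairs are Kuratowski
pairs `ZFSet.pair`, set functions are given by `ZFSet.IsFunc`.  A sequence indexed by an ordinal
`j` is written as a Lean function on all ordinals of which only the values below `j` are used.
In forcing, the larger condition is the stronger one. -/

namespace Fuzzy

/-! ### The structures `(H(χ), ∈, <*)` and their elementary submodels -/

/-- `x ∈ H(χ)`: the set `x` is hereditarily of cardinality less than `χ`. -/
def InH (χ : Cardinal.{u}) (x : ZFSet.{u}) : Prop :=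
  x.Hereditarily (fun y => y.card < χ)

/-- The family `H(χ)`. -/
abbrev HType (χ : Cardinal.{u}) : Type (u + 1) := {x : ZFSet.{u} // InH χ x}

/-- `H_{<κ}(μ)`: the least family of sets that contains all ordinals below `μ` and contains each of
its subsets of cardinality less than `κ` (sets hereditarily of cardinality less than `κ` over the
ordinals below `μ`). -/
inductive HBelow (κ μ : Cardinal.{u}) : ZFSet.{u} → Prop
  | ord (α : Ordinal.{u}) : α < μ.ord → HBelow κ μ α.toZFSet
  | set (y : ZFSet.{u}) : (∀ z ∈ y, HBelow κ μ z) → y.card < κ → HBelow κ μ y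

/-- The two binary relation symbols: membership and the well-ordering. -/
inductive SetRel : ℕ → Type
  | mem : SetRel 2
  | lt : SetRel 2

/-- The first-order language with the symbols `∈` and `<*`. -/
def setLanguage : FirstOrder.Language.{0, 0} := ⟨fun _ => Empty, SetRel⟩

/-- The structure `(H(χ), ∈, <*)`, where `<*` is the relation `wo`. -/
@[reducible] def hStructure (χ : Cardinal.{u}) (wo : HType χ → HType χ → Prop) :
    setLanguage.Structure (HType χ) where
  funMap := fun f => nomatch f
  RelMap := fun {_} R =>
    match R with
    | SetRel.mem => fun v => (v 0).1 ∈ (v 1).1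
    | SetRel.lt => fun v => wo (v 0) (v 1)

/-- `N ≺ (H(χ), ∈, <*)`. -/
def IsElementary (χ : Cardinal.{u}) (wo : HType χ → HType χ → Prop) (N : ZFSet.{u}) : Prop :=
  (∀ x ∈ N, InH χ x) ∧
    ∃ M : @FirstOrder.Language.ElementarySubstructure setLanguage (HType χ) (hStructure χ wo),
      ∀ x : HType χ, x ∈ M ↔ x.1 ∈ N

/-- `N ≺ (H(χ), ∈, <*)`, `|N| = λ` and `N` is closed under sequences of length less than `λ`. -/
structure IsModel (lam χ : Cardinal.{u}) (wo : HType χ → HType χ → Prop) (N : ZFSet.{u}) :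
    Prop where
  elementary : IsElementary χ wo N
  card_eq : N.card = lam
  closed : ∀ α < lam.ord, ∀ f : ZFSet.{u}, ZFSet.IsFunc α.toZFSet N f → f ∈ N

/-- The intersection of the set `N` with the family `A`. -/
noncomputable def trace (N : ZFSet.{u}) (A : Set ZFSet.{u}) : ZFSet.{u} := N.sep (fun x => x ∈ A)

/-- The requirements on the family `W ⊆ [A]^λ`: its members are closed under functions defined on
their subsets of cardinality less than `λ`, and it is stationary. -/
structure IsAdmissible (lam χ : Cardinal.{u}) (wo : HType χ → HType χ → Prop)
    (A W : Set ZFSet.{u}) : Prop where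
  subset : ∀ a ∈ W, ∀ x ∈ a, x ∈ A
  card_eq : ∀ a ∈ W, a.card = lam
  closed : ∀ a ∈ W, ∀ w : ZFSet.{u}, w ⊆ a → w.card < lam →
    ∀ f : ZFSet.{u}, ZFSet.IsFunc w a f → f ∈ a
  stationary : ∀ x : ZFSet.{u}, InH χ x → ∃ N : ZFSet.{u},
    IsModel lam χ wo N ∧ x ∈ N ∧ trace N A ∈ W

/-! ### Normal filters and diamonds

A filter on `λ` is represented by a filter of sets of ordinals that contains the set of all
ordinals below `λ`.  Then `∀ᶠ δ in D` means "for all `δ` from a set in `D`", and `∃ᶠ δ in D`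
means "for all `δ` from a `D`-positive set". -/

/-- `D` is a (proper, containing all end segments) normal filter on `λ`. -/
structure IsNormalFilter (lam : Cardinal.{u}) (D : Filter Ordinal.{u}) : Prop where
  neBot : D.NeBot
  below : ∀ᶠ δ in D, δ < lam.ord
  endSegment : ∀ α < lam.ord, ∀ᶠ δ in D, α < δ
  diagonal : ∀ C : Ordinal.{u} → Set Ordinal.{u}, (∀ i < lam.ord, C i ∈ D) →
    ∀ᶠ δ in D, ∀ i < δ, δ ∈ C i

/-- `⟨F δ : δ ∈ S⟩` is a `D`-pre-diamond sequence. -/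
structure IsPreDiamond (lam : Cardinal.{u}) (D : Filter Ordinal.{u})
    (S : Set Ordinal.{u}) (F : Ordinal.{u} → Ordinal.{u} → Ordinal.{u}) : Prop where
  subset : ∀ δ ∈ S, δ < lam.ord
  positive : ∃ᶠ δ in D, δ ∈ S
  succ_mem : ∀ α < lam.ord, Order.succ α ∈ S
  unbounded_compl : ∀ α < lam.ord, ∃ β < lam.ord, α < β ∧ β ∉ S
  zero_notMem : (0 : Ordinal.{u}) ∉ S
  values : ∀ δ ∈ S, ∀ α < δ, F δ α < δ

/-- There is a convenient `D`-diamond. -/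
def HasDiamond (lam : Cardinal.{u}) (D : Filter Ordinal.{u}) : Prop :=
  ∃ (S : Set Ordinal.{u}) (F : Ordinal.{u} → Ordinal.{u} → Ordinal.{u}),
    IsPreDiamond lam D S F ∧
    ∀ f : Ordinal.{u} → Ordinal.{u}, (∀ α < lam.ord, f α < lam.ord) →
      ∃ᶠ δ in D, δ ∈ S ∧ ∀ α < δ, F δ α = f α

/-! ### Forcing notions -/

/-- The data of a forcing notion: a set of conditions and a set of pairs of conditions. -/
structure Forcing where
  carrier : ZFSet.{u}
  order : ZFSet.{u}

namespace Forcing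

/-- The forcing notion as one set. -/
def code (P : Forcing.{u}) : ZFSet.{u} := ZFSet.pair P.carrier P.order

/-- `p ≤ q`: the condition `q` is stronger than `p`. -/
def le (P : Forcing.{u}) (p q : ZFSet.{u}) : Prop := ZFSet.pair p q ∈ P.order

/-- `P` is a quasi-ordered set with a weakest element that is equivalent to no other element. -/
structure IsForcingNotion (P : Forcing.{u}) : Prop where
  order_subset : P.order ⊆ ZFSet.prod P.carrier P.carrier
  refl : ∀ p ∈ P.carrier, P.le p p
  trans : ∀ p q r : ZFSet.{u}, P.le p q → P.le q r → P.le p r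
  weakest : ∃ m ∈ P.carrier, ∀ p ∈ P.carrier, P.le m p ∧ (P.le p m → p = m)

/-- `⟨p i : i < j⟩` is an increasing sequence of conditions. -/
def Increasing (P : Forcing.{u}) (j : Ordinal.{u}) (p : Ordinal.{u} → ZFSet.{u}) : Prop :=
  (∀ i < j, p i ∈ P.carrier) ∧ ∀ i k : Ordinal.{u}, i < k → k < j → P.le (p i) (p k)

/-- Increasing chains of length less than `λ` have upper bounds. -/
def IsComplete (P : Forcing.{u}) (lam : Cardinal.{u}) : Prop :=
  ∀ j < lam.ord, ∀ p : Ordinal.{u} → ZFSet.{u}, P.Increasing j p →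
    ∃ q ∈ P.carrier, ∀ i < j, P.le (p i) q

/-- The `κ`-chain condition: antichains have cardinality less than `κ`. -/
def ChainCondition (P : Forcing.{u}) (κ : Cardinal.{u}) : Prop :=
  ∀ X : ZFSet.{u}, X ⊆ P.carrier →
    (∀ p ∈ X, ∀ q ∈ X, p ≠ q → ¬ ∃ r ∈ P.carrier, P.le p r ∧ P.le q r) → X.card < κ

/-- `I` is an open dense subset of `P`. -/
def IsOpenDense (P : Forcing.{u}) (I : ZFSet.{u}) : Prop :=
  I ⊆ P.carrier ∧ (∀ p ∈ P.carrier, ∃ q ∈ I, P.le p q) ∧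
    ∀ p ∈ I, ∀ q ∈ P.carrier, P.le p q → q ∈ I

/-- `⟨I α : α < λ⟩` lists all open dense subsets of `P` that belong to `N`. -/
def Lists (P : Forcing.{u}) (lam : Cardinal.{u}) (N : ZFSet.{u})
    (I : Ordinal.{u} → ZFSet.{u}) : Prop :=
  ∀ J : ZFSet.{u}, (J ∈ N ∧ P.IsOpenDense J) ↔ ∃ α < lam.ord, I α = J

end Forcing

/-- `⟨p α : α < δ⟩` is `I`-exact. -/
def Exact (I : Ordinal.{u} → ZFSet.{u}) (δ : Ordinal.{u}) (p : Ordinal.{u} → ZFSet.{u}) : Prop :=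
  ∀ ξ < δ, ∃ α < δ, p α ∈ I ξ

/-- `⟨F δ : δ ∈ S⟩` is a quasi `D`-diamond for `(N, h, P)`. -/
def IsQuasiDiamond (lam : Cardinal.{u}) (D : Filter Ordinal.{u}) (P : Forcing.{u})
    (N : ZFSet.{u}) (h : Ordinal.{u} → ZFSet.{u}) (S : Set Ordinal.{u})
    (F : Ordinal.{u} → Ordinal.{u} → Ordinal.{u}) : Prop :=
  IsPreDiamond lam D S F ∧
  ∃ I : Ordinal.{u} → ZFSet.{u}, P.Lists lam N I ∧
    ∀ p : Ordinal.{u} → ZFSet.{u}, P.Increasing lam.ord p → (∀ α < lam.ord, p α ∈ N) →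
      (∀ᶠ δ in D, Exact I δ p) →
      ∃ᶠ δ in D, δ ∈ S ∧ Exact I δ p ∧ ∀ α < δ, h (F δ α) = p α

/-! ### Bases, candidates, the game -/

/-- The triple `(p, δ, x)` as a set. -/
noncomputable def triple (p : ZFSet.{u}) (δ : Ordinal.{u}) (x : ZFSet.{u}) : ZFSet.{u} :=
  ZFSet.pair p (ZFSet.pair δ.toZFSet x)

/-- `(R, Y)` is a `λ`-base for `P` over `W`. -/
structure IsBase (lam : Cardinal.{u}) (A W : Set ZFSet.{u}) (P : Forcing.{u})
    (R : ZFSet.{u}) (Y : ZFSet.{u} → Ordinal.{u} → ZFSet.{u}) : Prop where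
  subset : ∀ t ∈ R, ∃ p ∈ P.carrier, ∃ δ < lam.ord, ∃ x ∈ A, t = triple p δ x
  mono : ∀ (p p' : ZFSet.{u}) (δ : Ordinal.{u}) (x : ZFSet.{u}),
    triple p δ x ∈ R → P.le p p' → triple p' δ x ∈ R
  small : ∀ a ∈ W, ∀ δ < lam.ord, Y a δ ⊆ a ∧ (Y a δ).card < lam
  obey : ∀ q ∈ P.carrier, ∀ a ∈ W, ∀ δ < lam.ord, Order.IsSuccLimit δ →
    ∃ p ∈ P.carrier, P.le q p ∧ ∃ x ∈ Y a δ, triple p δ x ∈ R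

/-- The set of those `x ∈ Y a δ` for which, if `⟨h (F δ α) : α < δ⟩` is an increasing sequence of
conditions, then some upper bound of it obeys `x` at `δ`. -/
def possible (P : Forcing.{u}) (R : ZFSet.{u}) (Y : ZFSet.{u} → Ordinal.{u} → ZFSet.{u})
    (a : ZFSet.{u}) (h : Ordinal.{u} → ZFSet.{u}) (F : Ordinal.{u} → Ordinal.{u} → Ordinal.{u})
    (δ : Ordinal.{u}) : Set ZFSet.{u} :=
  {x | x ∈ Y a δ ∧ (P.Increasing δ (fun α => h (F δ α)) →
    ∃ p ∈ P.carrier, (∀ α < δ, P.le (h (F δ α)) p) ∧ triple p δ x ∈ R)}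

/-- `⟨q δ x : δ ∈ S limit, x ∈ X δ⟩` is a fuzzy candidate, where `X δ` stands for the set of
all possible `x` at `δ`. -/
structure IsFuzzyCandidate (D : Filter Ordinal.{u}) (lam : Cardinal.{u}) (P : Forcing.{u})
    (R : ZFSet.{u}) (X : Ordinal.{u} → Set ZFSet.{u}) (N : ZFSet.{u})
    (h : Ordinal.{u} → ZFSet.{u}) (S : Set Ordinal.{u})
    (F : Ordinal.{u} → Ordinal.{u} → Ordinal.{u}) (I : Ordinal.{u} → ZFSet.{u})
    (q : Ordinal.{u} → ZFSet.{u} → ZFSet.{u}) : Prop where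
  nonempty : ∀ δ ∈ S, Order.IsSuccLimit δ → (X δ).Nonempty
  mem : ∀ δ ∈ S, Order.IsSuccLimit δ → ∀ x ∈ X δ, q δ x ∈ N ∧ q δ x ∈ P.carrier
  eventually_mem : ∀ α < lam.ord,
    ∀ᶠ δ in D, δ ∈ S → Order.IsSuccLimit δ → ∀ x ∈ X δ, q δ x ∈ I α
  obeys : ∀ δ ∈ S, Order.IsSuccLimit δ → ∀ x ∈ X δ,
    P.Increasing δ (fun α => h (F δ α)) → Exact I δ (fun α => h (F δ α)) →
    (∀ α < δ, P.le (h (F δ α)) (q δ x)) ∧ triple (q δ x) δ x ∈ R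

/-- A move `(r_i, C_i)` of the game. -/
abbrev Move := ZFSet.{u} × Set Ordinal.{u}

/-- The `i`-th move of the play `m` is legal: `C_i ∈ D`, and the condition `r_i` is stronger than
`r` and than all earlier conditions. -/
def Legal (D : Filter Ordinal.{u}) (P : Forcing.{u}) (r : ZFSet.{u})
    (m : Ordinal.{u} → Move.{u}) (i : Ordinal.{u}) : Prop :=
  (m i).1 ∈ P.carrier ∧ (m i).2 ∈ D ∧ P.le r (m i).1 ∧ ∀ j < i, P.le (m j).1 (m i).1

/-- Generic wins the play `m` of length `λ`. -/
def WinningPlay (lam : Cardinal.{u}) (P : Forcing.{u}) (X : Ordinal.{u} → Set ZFSet.{u})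
    (N : ZFSet.{u}) (h : Ordinal.{u} → ZFSet.{u}) (S : Set Ordinal.{u})
    (F : Ordinal.{u} → Ordinal.{u} → Ordinal.{u}) (I : Ordinal.{u} → ZFSet.{u})
    (q : Ordinal.{u} → ZFSet.{u} → ZFSet.{u}) (m : Ordinal.{u} → Move.{u}) : Prop :=
  (∀ α < lam.ord, ∃ i < lam.ord, ∃ p ∈ P.carrier, p ∈ N ∧ p ∈ I α ∧ P.le p (m i).1) ∧
  ∀ δ ∈ S, Order.IsSuccLimit δ → (∀ i < δ, δ ∈ (m i).2) →
    P.Increasing δ (fun α => h (F δ α)) → Exact I δ (fun α => h (F δ α)) →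
    (∀ α < δ, ∃ i < δ, P.le (h (F δ α)) (m i).1) →
    ∃ x ∈ X δ, P.le (q δ x) (m δ).1

/-- A strategy of Generic: her answer at each stage, given the earlier moves. -/
abbrev Strategy := (i : Ordinal.{u}) → (Set.Iio i → Move.{u}) → Move.{u}

/-- In the play `m`, the move at stage `i` is the one that the strategy gives. -/
def Follows (σ : Strategy.{u}) (m : Ordinal.{u} → Move.{u}) (i : Ordinal.{u}) : Prop :=
  m i = σ i (fun j => m j)

/-- The condition `r` is fuzzy generic for `q`: Generic, who moves at the stages `i ∈ S`, has a
winning strategy, that is, one that always gives her legal moves and wins every play. -/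
def IsFuzzyGeneric (D : Filter Ordinal.{u}) (lam : Cardinal.{u}) (P : Forcing.{u})
    (X : Ordinal.{u} → Set ZFSet.{u}) (N : ZFSet.{u})
    (h : Ordinal.{u} → ZFSet.{u}) (S : Set Ordinal.{u})
    (F : Ordinal.{u} → Ordinal.{u} → Ordinal.{u}) (I : Ordinal.{u} → ZFSet.{u})
    (q : Ordinal.{u} → ZFSet.{u} → ZFSet.{u}) (r : ZFSet.{u}) : Prop :=
  ∃ σ : Strategy.{u}, ∀ m : Ordinal.{u} → Move.{u},
    (∀ i ∈ S, (∀ j < i, Legal D P r m j) → (∀ j ∈ S, j ≤ i → Follows σ m j) →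
      Legal D P r m i) ∧
    ((∀ i < lam.ord, Legal D P r m i) → (∀ i ∈ S, Follows σ m i) →
      WinningPlay lam P X N h S F I q m)

/-! ### Fuzzy properness -/

/-- `P` is fuzzy proper over quasi `D`-diamonds for `W`. -/
def FuzzyProperOver (lam χ : Cardinal.{u}) (wo : HType χ → HType χ → Prop)
    (A W : Set ZFSet.{u}) (P : Forcing.{u}) (D : Filter Ordinal.{u}) : Prop :=
  ∃ (R : ZFSet.{u}) (Y : ZFSet.{u} → Ordinal.{u} → ZFSet.{u}) (c : ZFSet.{u}),
    IsBase lam A W P R Y ∧ InH χ R ∧ InH χ c ∧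
    ∀ (N : ZFSet.{u}) (p : ZFSet.{u}) (h : Ordinal.{u} → ZFSet.{u}) (S : Set Ordinal.{u})
      (F : Ordinal.{u} → Ordinal.{u} → Ordinal.{u}) (I : Ordinal.{u} → ZFSet.{u})
      (q : Ordinal.{u} → ZFSet.{u} → ZFSet.{u}),
      IsModel lam χ wo N → lam.ord.toZFSet ∈ N → P.code ∈ N → c ∈ N → R ∈ N →
      trace N A ∈ W → p ∈ P.carrier → p ∈ N →
      (∀ i < lam.ord, h i ∈ N) → (∀ s ∈ P.carrier, s ∈ N → ∃ i < lam.ord, h i = s) →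
      IsQuasiDiamond lam D P N h S F → P.Lists lam N I →
      IsFuzzyCandidate D lam P R (possible P R Y (trace N A) h F) N h S F I q →
      ∃ r ∈ P.carrier, P.le p r ∧
        IsFuzzyGeneric D lam P (possible P R Y (trace N A) h F) N h S F I q r

/-- `P` is fuzzy proper for `W`: it is a `λ`-complete forcing notion (and an element of `H(χ)`)
that is fuzzy proper over quasi `D`-diamonds for every normal filter `D` on `λ` which has
diamonds. -/
def FuzzyProper (lam χ : Cardinal.{u}) (wo : HType χ → HType χ → Prop)
    (A W : Set ZFSet.{u}) (P : Forcing.{u}) : Prop :=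
  P.IsForcingNotion ∧ InH χ P.code ∧ P.IsComplete lam ∧
  ∀ D : Filter Ordinal.{u}, IsNormalFilter lam D → HasDiamond lam D →
    FuzzyProperOver lam χ wo A W P D

/-! ### The uniformization forcing -/

/-- The set of ordinals whose von Neumann ordinals are elements of `x`. -/
def ords (x : ZFSet.{u}) : Set Ordinal.{u} := {α | α.toZFSet ∈ x}

/-- `t` is an end-extension of `s`. -/
def EndExtends (t s : Set Ordinal.{u}) : Prop :=
  s ⊆ t ∧ ∀ α ∈ t, α ∉ s → ∀ γ ∈ s, γ < α

/-- `S* ⊆ {β < λ⁺ : cf β = λ}`, each `B β` (for `β ∈ S*`) is a club of `β` of order type `λ`, and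
`g β` is a function from `B β` to the ordinal `ξ < λ`. -/
structure IsColouredLadderSystem (lam : Cardinal.{u}) (ξ : Ordinal.{u}) (Sstar : Set Ordinal.{u})
    (B : Ordinal.{u} → Set Ordinal.{u}) (g : Ordinal.{u} → Ordinal.{u} → Ordinal.{u}) : Prop where
  colours : ξ < lam.ord
  below : ∀ β ∈ Sstar, β < (Order.succ lam).ord
  cof_eq : ∀ β ∈ Sstar, β.cof = lam
  subset : ∀ β ∈ Sstar, ∀ α ∈ B β, α < β
  club : ∀ β ∈ Sstar, IsClub {x : Set.Iio β | (x : Ordinal.{u}) ∈ B β}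
  otp : ∀ β ∈ Sstar, Nonempty (Set.Iio lam.ord ≃o B β)
  values : ∀ β ∈ Sstar, ∀ α ∈ B β, g β α < ξ

/-- `(u, v, e, h)` is a condition; `e` is a set function with domain `v`, written through its
pairs `(β, E)`, that is, `E = e_β`. -/
structure IsCondition (lam : Cardinal.{u}) (ξ : Ordinal.{u}) (Sstar : Set Ordinal.{u})
    (B : Ordinal.{u} → Set Ordinal.{u}) (g : Ordinal.{u} → Ordinal.{u} → Ordinal.{u})
    (u v e h : ZFSet.{u}) : Prop where
  u_subset : u ⊆ (Order.succ lam).ord.toZFSet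
  u_card : u.card < lam
  v_subset : v ⊆ (Order.succ lam).ord.toZFSet
  v_subset_Sstar : ords v ⊆ Sstar
  v_card : v.card < lam
  e_func : ZFSet.IsFunc v u.powerset e
  e_subset : ∀ β E, ZFSet.pair (Ordinal.toZFSet β) E ∈ e → ords E ⊆ B β
  e_closed : ∀ β E, ZFSet.pair (Ordinal.toZFSet β) E ∈ e → IsClosed (ords E)
  e_bounded : ∀ β E, ZFSet.pair (Ordinal.toZFSet β) E ∈ e → ∃ γ < β, ∀ α ∈ ords E, α ≤ γ
  e_sup : ∀ β E, ZFSet.pair (Ordinal.toZFSet β) E ∈ e → sSup (ords E) = sSup (ords u ∩ Set.Iio β)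
  e_separated : ∀ β₁ β₂ E₁ E₂, β₁ < β₂ → ZFSet.pair (Ordinal.toZFSet β₁) E₁ ∈ e →
    ZFSet.pair (Ordinal.toZFSet β₂) E₂ ∈ e →
    β₁ < sSup (ords E₂) ∧ sSup (B β₂ ∩ Set.Iio β₁) < sSup (ords E₁)
  h_func : ZFSet.IsFunc u ξ.toZFSet h
  h_agrees : ∀ β E, ZFSet.pair (Ordinal.toZFSet β) E ∈ e → ∀ α ∈ ords E,
    ZFSet.pair α.toZFSet (g β α).toZFSet ∈ h

/-- The quadruple `(u, v, e, h)` as a set. -/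
def quadruple (u v e h : ZFSet.{u}) : ZFSet.{u} :=
  ZFSet.pair u (ZFSet.pair v (ZFSet.pair e h))

/-- A set in which all conditions lie. -/
noncomputable def ambient (lam : Cardinal.{u}) (ξ : Ordinal.{u}) : ZFSet.{u} :=
  let L : ZFSet.{u} := (Order.succ lam).ord.toZFSet
  ZFSet.prod L.powerset (ZFSet.prod L.powerset
    (ZFSet.prod (ZFSet.prod L L.powerset).powerset (ZFSet.prod L ξ.toZFSet).powerset))

/-- The set of conditions. -/
noncomputable def conditions (lam : Cardinal.{u}) (ξ : Ordinal.{u}) (Sstar : Set Ordinal.{u})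
    (B : Ordinal.{u} → Set Ordinal.{u}) (g : Ordinal.{u} → Ordinal.{u} → Ordinal.{u}) :
    ZFSet.{u} :=
  (ambient lam ξ).sep (fun p => ∃ u v e h, p = quadruple u v e h ∧
    IsCondition lam ξ Sstar B g u v e h)

/-- `(u, v, e, h) ≤ (u', v', e', h')`. -/
def condLE (p p' : ZFSet.{u}) : Prop :=
  ∃ u v e h u' v' e' h', p = quadruple u v e h ∧ p' = quadruple u' v' e' h' ∧
    u ⊆ u' ∧ h ⊆ h' ∧ v ⊆ v' ∧
    ∀ β E E', ZFSet.pair β E ∈ e → ZFSet.pair β E' ∈ e' → EndExtends (ords E') (ords E)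

/-- The forcing notion `Q*(S*, B, g)`. -/
noncomputable def uniformForcing (lam : Cardinal.{u}) (ξ : Ordinal.{u}) (Sstar : Set Ordinal.{u})
    (B : Ordinal.{u} → Set Ordinal.{u}) (g : Ordinal.{u} → Ordinal.{u} → Ordinal.{u}) :
    Forcing.{u} where
  carrier := conditions lam ξ Sstar B g
  order := (ZFSet.prod (conditions lam ξ Sstar B g) (conditions lam ξ Sstar B g)).sep
    (fun t => ∃ p p', t = ZFSet.pair p p' ∧ condLE p p')

/-- Restricting to the ambient set loses no condition. -/
theorem mem_conditions {lam : Cardinal.{u}} {ξ : Ordinal.{u}} {Sstar : Set Ordinal.{u}}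
    {B : Ordinal.{u} → Set Ordinal.{u}} {g : Ordinal.{u} → Ordinal.{u} → Ordinal.{u}}
    {p : ZFSet.{u}} :
    p ∈ conditions lam ξ Sstar B g ↔
      ∃ u v e h, p = quadruple u v e h ∧ IsCondition lam ξ Sstar B g u v e h := by
  rw [conditions, ZFSet.mem_sep]
  refine ⟨fun H => H.2, fun H => ⟨?_, H⟩⟩
  obtain ⟨u, v, e, h, rfl, H⟩ := H
  have he : e ⊆ ZFSet.prod (Order.succ lam).ord.toZFSet
      (ZFSet.powerset (Order.succ lam).ord.toZFSet) := by
    intro z hz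
    obtain ⟨a, ha, b, hb, rfl⟩ := ZFSet.mem_prod.1 (H.e_func.1 hz)
    rw [ZFSet.mem_powerset] at hb
    exact ZFSet.pair_mem_prod.2
      ⟨H.v_subset ha, ZFSet.mem_powerset.2 (fun x hx => H.u_subset (hb hx))⟩
  have hh : h ⊆ ZFSet.prod (Order.succ lam).ord.toZFSet ξ.toZFSet := by
    intro z hz
    obtain ⟨a, ha, b, hb, rfl⟩ := ZFSet.mem_prod.1 (H.h_func.1 hz)
    exact ZFSet.pair_mem_prod.2 ⟨H.u_subset ha, hb⟩
  simp only [ambient, quadruple, ZFSet.pair_mem_prod, ZFSet.mem_powerset]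
  exact ⟨H.u_subset, H.v_subset, he, hh⟩

theorem uniformForcing_le {lam : Cardinal.{u}} {ξ : Ordinal.{u}} {Sstar : Set Ordinal.{u}}
    {B : Ordinal.{u} → Set Ordinal.{u}} {g : Ordinal.{u} → Ordinal.{u} → Ordinal.{u}}
    {p p' : ZFSet.{u}} :
    (uniformForcing lam ξ Sstar B g).le p p' ↔
      p ∈ conditions lam ξ Sstar B g ∧ p' ∈ conditions lam ξ Sstar B g ∧ condLE p p' := by
  simp only [Forcing.le, uniformForcing, ZFSet.mem_sep, ZFSet.pair_mem_prod, and_assoc]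
  refine and_congr_right fun _ => and_congr_right fun _ => ⟨?_, fun H => ⟨p, p', rfl, H⟩⟩
  rintro ⟨a, b, hab, H⟩
  obtain ⟨rfl, rfl⟩ := ZFSet.pair_inj.1 hab
  exact H

end Fuzzy

namespace Fuzzy

open Cardinal Set

/-! ### The families `H(χ)` -/

theorem inH_iff {χ : Cardinal.{u}} {x : ZFSet.{u}} :
    InH χ x ↔ x.card < χ ∧ ∀ y ∈ x, InH χ y :=
  ZFSet.hereditarily_iff

theorem InH.subset {χ : Cardinal.{u}} {x y : ZFSet.{u}} (hx : InH χ x) (h : y ⊆ x) : InH χ y :=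
  inH_iff.2 ⟨(ZFSet.card_mono h).trans_lt (inH_iff.1 hx).1, fun z hz => (inH_iff.1 hx).2 z (h hz)⟩

theorem InH.mem {χ : Cardinal.{u}} {x y : ZFSet.{u}} (hx : InH χ x) (h : y ∈ x) : InH χ y :=
  (inH_iff.1 hx).2 y h

theorem InH.unorderedPair {χ : Cardinal.{u}} (hχ : ℵ₀ ≤ χ) {x y : ZFSet.{u}} (hx : InH χ x)
    (hy : InH χ y) : InH χ {x, y} := by
  refine inH_iff.2 ⟨?_, fun z hz => ?_⟩
  · refine lt_of_le_of_lt ?_ ((natCast_lt_aleph0 (n := 2)).trans_le hχ)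
    refine ZFSet.card_insert_le.trans ?_
    rw [ZFSet.card_singleton, one_add_one_eq_two]
    rfl
  · rcases ZFSet.mem_pair.1 hz with rfl | rfl <;> assumption

theorem InH.singleton {χ : Cardinal.{u}} (hχ : ℵ₀ ≤ χ) {x : ZFSet.{u}} (hx : InH χ x) :
    InH χ {x} := by
  simpa using hx.unorderedPair hχ hx

theorem InH.pair {χ : Cardinal.{u}} (hχ : ℵ₀ ≤ χ) {x y : ZFSet.{u}} (hx : InH χ x)
    (hy : InH χ y) : InH χ (ZFSet.pair x y) :=
  (hx.singleton hχ).unorderedPair hχ (hx.unorderedPair hχ hy)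

theorem inH_toZFSet {χ : Cardinal.{u}} {α : Ordinal.{u}} (h : α.card < χ) :
    InH χ α.toZFSet := by
  induction α using WellFoundedLT.induction with
  | ind α ih =>
    refine inH_iff.2 ⟨by simpa using h, fun y hy => ?_⟩
    obtain ⟨β, hβ, rfl⟩ := Ordinal.mem_toZFSet_iff.1 hy
    exact ih β hβ ((Ordinal.card_le_card hβ.le).trans_lt h)

/-! ### Cardinalities of sets -/

theorem card_le_of_injOn {x y : ZFSet.{u}} (f : ZFSet.{u} → ZFSet.{u}) (hf : ∀ z ∈ x, f z ∈ y)
    (hinj : ∀ z ∈ x, ∀ w ∈ x, f z = f w → z = w) : x.card ≤ y.card := by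
  rw [← Cardinal.lift_le.{u + 1}, ← ZFSet.cardinalMk_coe_sort, ← ZFSet.cardinalMk_coe_sort]
  refine Cardinal.mk_le_of_injective (f := fun z : x => (⟨f z.1, hf z.1 z.2⟩ : y)) ?_
  intro z w hzw
  exact Subtype.ext (hinj z.1 z.2 w.1 w.2 (congrArg Subtype.val hzw))

theorem card_le_of_surjOn {x y : ZFSet.{u}} (f : ZFSet.{u} → ZFSet.{u})
    (hf : ∀ z ∈ y, ∃ w ∈ x, f w = z) : y.card ≤ x.card := by
  choose! k hk using hf
  exact card_le_of_injOn k (fun z hz => (hk z hz).1) fun z hz w hw h => by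
    rw [← (hk z hz).2, ← (hk w hw).2, h]

theorem card_prod (x y : ZFSet.{u}) : (ZFSet.prod x y).card = x.card * y.card := by
  rw [← Cardinal.lift_inj.{u, u + 1}, Cardinal.lift_mul, ← ZFSet.cardinalMk_coe_sort,
    ← ZFSet.cardinalMk_coe_sort, ← ZFSet.cardinalMk_coe_sort, Cardinal.mul_def]
  refine (Cardinal.mk_congr (Equiv.ofBijective
    (fun z : x × y => (⟨ZFSet.pair z.1 z.2, ZFSet.pair_mem_prod.2 ⟨z.1.2, z.2.2⟩⟩ :
      ZFSet.prod x y)) ⟨?_, ?_⟩)).symm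
  · rintro ⟨⟨a, ha⟩, ⟨b, hb⟩⟩ ⟨⟨c, hc⟩, ⟨d, hd⟩⟩ h
    have := ZFSet.pair_inj.1 (congrArg Subtype.val h)
    simp only [Prod.mk.injEq, Subtype.mk.injEq]
    exact this
  · rintro ⟨z, hz⟩
    obtain ⟨a, ha, b, hb, rfl⟩ := ZFSet.mem_prod.1 hz
    exact ⟨(⟨a, ha⟩, ⟨b, hb⟩), rfl⟩

theorem card_prod_le {κ : Cardinal.{u}} (hκ : ℵ₀ ≤ κ) {x y : ZFSet.{u}} (hx : x.card ≤ κ)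
    (hy : y.card ≤ κ) : (ZFSet.prod x y).card ≤ κ := by
  rw [card_prod]
  exact (mul_le_mul' hx hy).trans (Cardinal.mul_eq_self hκ).le

theorem exists_enumeration {x T : ZFSet.{u}} (hx : x.card ≤ T.card) (hne : x.Nonempty) :
    ∃ n : ZFSet.{u} → ZFSet.{u}, (∀ t, n t ∈ x) ∧ ∀ y ∈ x, ∃ t ∈ T, n t = y := by
  obtain ⟨x₀, hx₀⟩ := hne
  have hx' : #x ≤ #T := by
    rw [ZFSet.cardinalMk_coe_sort, ZFSet.cardinalMk_coe_sort, Cardinal.lift_le]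
    exact hx
  obtain ⟨f⟩ := hx'
  -- Arguments outside the range of the injection are sent to `x₀`, so the enumeration is total with
  -- values in `x`.
  classical
  refine ⟨fun t => if h : ∃ y : x, (f y).1 = t then h.choose.1 else x₀, fun t => ?_,
    fun y hy => ⟨(f ⟨y, hy⟩).1, (f ⟨y, hy⟩).2, ?_⟩⟩
  · dsimp only
    split_ifs with h
    · exact h.choose.2
    · exact hx₀
  · have h : ∃ y' : x, (f y').1 = (f ⟨y, hy⟩).1 := ⟨⟨y, hy⟩, rfl⟩
    simp only [dif_pos h]
    exact congrArg Subtype.val (f.injective (Subtype.ext h.choose_spec))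

theorem card_range_le {x : ZFSet.{u}} (f : x → ZFSet.{u}) : (ZFSet.range f).card ≤ x.card := by
  rw [← Cardinal.lift_le.{u + 1}, ← ZFSet.cardinalMk_coe_sort, ← ZFSet.cardinalMk_coe_sort]
  refine (Cardinal.mk_congr (Equiv.setCongr (ZFSet.coe_range f))).trans_le ?_
  exact Cardinal.mk_range_le

/-- The set function with domain `x` that sends `z` to `f z`. -/
noncomputable def graph (x : ZFSet.{u}) (f : ZFSet.{u} → ZFSet.{u}) : ZFSet.{u} :=
  ZFSet.range fun z : x => ZFSet.pair z.1 (f z.1)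

theorem pair_mem_graph {x a b : ZFSet.{u}} {f : ZFSet.{u} → ZFSet.{u}} :
    ZFSet.pair a b ∈ graph x f ↔ a ∈ x ∧ b = f a := by
  rw [graph, ZFSet.mem_range]
  constructor
  · rintro ⟨z, hz⟩
    obtain ⟨rfl, rfl⟩ := ZFSet.pair_inj.1 hz
    exact ⟨z.2, rfl⟩
  · rintro ⟨ha, rfl⟩
    exact ⟨⟨a, ha⟩, rfl⟩

theorem InH.graph {χ : Cardinal.{u}} (hχ : ℵ₀ ≤ χ) {x : ZFSet.{u}} (hx : InH χ x)
    {f : ZFSet.{u} → ZFSet.{u}} (hf : ∀ z ∈ x, InH χ (f z)) : InH χ (graph x f) := by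
  refine inH_iff.2 ⟨(card_range_le _).trans_lt (inH_iff.1 hx).1, fun y hy => ?_⟩
  obtain ⟨z, rfl⟩ := ZFSet.mem_range.1 hy
  exact (hx.mem z.2).pair hχ (hf z.1 z.2)

theorem InH.prod {χ κ : Cardinal.{u}} (hχ : ℵ₀ ≤ χ) (hκ : ℵ₀ ≤ κ) (hκχ : κ < χ) {x y : ZFSet.{u}}
    (hx : InH χ x) (hy : InH χ y) (hx' : x.card ≤ κ) (hy' : y.card ≤ κ) :
    InH χ (ZFSet.prod x y) := by
  refine inH_iff.2 ⟨(card_prod_le hκ hx' hy').trans_lt hκχ, fun z hz => ?_⟩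
  obtain ⟨a, ha, b, hb, rfl⟩ := ZFSet.mem_prod.1 hz
  exact (hx.mem ha).pair hχ (hy.mem hb)

theorem InH.powerset {χ : Cardinal.{u}} {x : ZFSet.{u}} (hx : InH χ x)
    (h : 2 ^ x.card < χ) : InH χ x.powerset :=
  inH_iff.2 ⟨by simpa using h, fun _ hy => hx.subset (ZFSet.mem_powerset.1 hy)⟩

/-! ### Elementary submodels -/

section
open FirstOrder Language

/-- `H(χ)` is transitive and closed under unordered pairs, so quantifiers over it suffice to
recognise a Kuratowski pair. This makes being a pair first-order over `H(χ)`. -/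
theorem InH.eq_pair_iff {χ : Cardinal.{u}} (hχ : ℵ₀ ≤ χ) {x y z : HType χ} :
    z.1 = ZFSet.pair x.1 y.1 ↔ ∀ w : HType χ, w.1 ∈ z.1 ↔
      (∀ t : HType χ, t.1 ∈ w.1 ↔ t = x) ∨ ∀ t : HType χ, t.1 ∈ w.1 ↔ (t = x ∨ t = y) := by
  have key : ∀ (w : HType χ) (s : ZFSet.{u}), (InH χ s) →
      (w.1 = s ↔ ∀ t : HType χ, t.1 ∈ w.1 ↔ t.1 ∈ s) := by
    intro w s hs
    refine ⟨fun h t => by rw [h], fun h => ZFSet.ext fun t => ⟨fun ht => ?_, fun ht => ?_⟩⟩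
    · exact (h ⟨t, w.2.mem ht⟩).1 ht
    · exact (h ⟨t, hs.mem ht⟩).2 ht
  rw [key z _ (x.2.pair hχ y.2)]
  refine forall_congr' fun w => ?_
  rw [ZFSet.pair, ZFSet.mem_pair, key w _ (x.2.singleton hχ), key w _ (x.2.unorderedPair hχ y.2)]
  simp only [ZFSet.mem_singleton, ZFSet.mem_pair, Subtype.ext_iff]

/-- If `N ≺ H(χ)`, then a relation in `N` that has a value at some element of `N` has such a
value in `N`. -/
theorem IsElementary.exists_value {χ : Cardinal.{u}} (hχ : ℵ₀ ≤ χ)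
    {wo : HType χ → HType χ → Prop} {N : ZFSet.{u}} (hN : IsElementary χ wo N) {c x y : ZFSet.{u}}
    (hc : c ∈ N) (hx : x ∈ N) (hy : ZFSet.pair x y ∈ c) : ∃ y ∈ N, ZFSet.pair x y ∈ c := by
  obtain ⟨hNH, M, hM⟩ := hN
  let _ := hStructure χ wo
  let mem {n : ℕ} (a b : setLanguage.Term (Fin 2 ⊕ Fin n)) :
    setLanguage.BoundedFormula (Fin 2) n := Relations.boundedFormula₂ (SetRel.mem : setLanguage.Relations 2) a b
  -- The free variable `0` stands for `x` and the free variable `1` for `c`.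
  let X {n : ℕ} : setLanguage.Term (Fin 2 ⊕ Fin n) := Term.var (Sum.inl 0)
  let C {n : ℕ} : setLanguage.Term (Fin 2 ⊕ Fin n) := Term.var (Sum.inl 1)
  let V {n : ℕ} (k : Fin n) : setLanguage.Term (Fin 2 ⊕ Fin n) := Term.var (Sum.inr k)
  have hmem : ∀ {n : ℕ} (a b : setLanguage.Term (Fin 2 ⊕ Fin n)) (v : Fin 2 → HType χ)
      (w : Fin n → HType χ), (mem a b).Realize v w ↔
        (a.realize (Sum.elim v w)).1 ∈ (b.realize (Sum.elim v w)).1 := by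
    intro n a b v w
    exact BoundedFormula.realize_rel₂
  -- the bound variables are `y, z, w, t`
  let ψ : setLanguage.BoundedFormula (Fin 2) 1 :=
    (mem (V 1) C ⊓ ((mem (V 2) (V 1)).iff
      ((((mem (V 3) (V 2)).iff (Term.bdEqual (V 3) X)).all) ⊔
        (((mem (V 3) (V 2)).iff (Term.bdEqual (V 3) X ⊔ Term.bdEqual (V 3) (V 0))).all))).all).ex
  have hψ : ∀ (v : Fin 2 → HType χ) (b : Fin 1 → HType χ),
      ψ.Realize v b ↔ ZFSet.pair (v 0).1 (b 0).1 ∈ (v 1).1 := by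
    intro v b
    have : ψ.Realize v b ↔ ∃ z : HType χ, z.1 ∈ (v 1).1 ∧ ∀ w : HType χ, w.1 ∈ z.1 ↔
      (∀ t : HType χ, t.1 ∈ w.1 ↔ t = v 0) ∨ ∀ t : HType χ, t.1 ∈ w.1 ↔ (t = v 0 ∨ t = b 0) := by
      simp [ψ, hmem, X, C, V, Fin.snoc, -Subtype.forall, -Subtype.exists]
    rw [this]
    constructor
    · rintro ⟨z, hz, hzw⟩
      rw [← (InH.eq_pair_iff hχ (x := v 0) (y := b 0) (z := z)).2 hzw]
      exact hz
    · intro h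
      exact ⟨⟨_, (v 1).2.mem h⟩, h, (InH.eq_pair_iff hχ).1 rfl⟩
  have hxM : (⟨x, hNH x hx⟩ : HType χ) ∈ M := (hM _).2 hx
  have hcM : (⟨c, hNH c hc⟩ : HType χ) ∈ M := (hM _).2 hc
  let vM : Fin 2 → M := ![⟨_, hxM⟩, ⟨_, hcM⟩]
  have hyH : InH χ y := by
    have h1 : ({x, y} : ZFSet) ∈ ZFSet.pair x y := by simp [ZFSet.pair]
    exact (((hNH c hc).mem hy).mem h1).mem (by simp)
  have h1 : Formula.Realize (M := HType χ) ψ.ex (M.subtype ∘ vM) := by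
    rw [Formula.Realize, BoundedFormula.realize_ex]
    refine ⟨⟨y, hyH⟩, ?_⟩
    rw [hψ]
    simpa [vM, Fin.snoc] using hy
  -- Elementarity is used twice: to bring the existential statement down to `M`, and then to carry
  -- what the witness satisfies back up to `H(χ)`.
  rw [M.subtype.map_formula, Formula.Realize, BoundedFormula.realize_ex] at h1
  obtain ⟨y', hy'⟩ := h1
  rw [← M.subtype.map_boundedFormula, hψ] at hy'
  refine ⟨y'.1.1, (hM _).1 y'.2, ?_⟩
  simpa [vM, Fin.snoc] using hy'

end

/-! ### Conditions as data about ordinals -/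

/-- The data of a condition `(u, v, e, h)`, in terms of ordinals. -/
structure CondData where
  U : Set Ordinal.{u}
  V : Set Ordinal.{u}
  E : Ordinal.{u} → Set Ordinal.{u}
  H : Ordinal.{u} → Ordinal.{u}

/-- The clauses in the definition of a condition that do not mention suprema. -/
structure IsPrecond (lam : Cardinal.{u}) (ξ : Ordinal.{u}) (Sstar : Set Ordinal.{u})
    (B : Ordinal.{u} → Set Ordinal.{u}) (g : Ordinal.{u} → Ordinal.{u} → Ordinal.{u})
    (c : CondData.{u}) : Prop where
  U_lt : ∀ α ∈ c.U, α < (Order.succ lam).ord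
  U_card : #c.U < lift.{u + 1} lam
  V_mem : ∀ β ∈ c.V, β ∈ Sstar
  V_card : #c.V < lift.{u + 1} lam
  E_sub_U : ∀ β ∈ c.V, c.E β ⊆ c.U
  E_sub_B : ∀ β ∈ c.V, c.E β ⊆ B β
  E_closed : ∀ β ∈ c.V, IsClosed (c.E β)
  H_lt : ∀ α ∈ c.U, c.H α < ξ
  H_agrees : ∀ β ∈ c.V, ∀ α ∈ c.E β, c.H α = g β α

/-- All the clauses in the definition of a condition. -/
structure IsCond (lam : Cardinal.{u}) (ξ : Ordinal.{u}) (Sstar : Set Ordinal.{u})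
    (B : Ordinal.{u} → Set Ordinal.{u}) (g : Ordinal.{u} → Ordinal.{u} → Ordinal.{u})
    (c : CondData.{u}) : Prop extends IsPrecond lam ξ Sstar B g c where
  E_sup : ∀ β ∈ c.V, sSup (c.E β) = sSup (c.U ∩ Iio β)
  E_separated : ∀ β₁ ∈ c.V, ∀ β₂ ∈ c.V, β₁ < β₂ →
    β₁ < sSup (c.E β₂) ∧ sSup (B β₂ ∩ Iio β₁) < sSup (c.E β₁)

/-- The order of conditions, in terms of the data. -/
structure CondData.LE (c d : CondData.{u}) : Prop where
  U_sub : c.U ⊆ d.U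
  H_eq : ∀ α ∈ c.U, c.H α = d.H α
  V_sub : c.V ⊆ d.V
  E_ext : ∀ β ∈ c.V, EndExtends (d.E β) (c.E β)

theorem EndExtends.refl (s : Set Ordinal.{u}) : EndExtends s s :=
  ⟨subset_rfl, fun _ h h' => absurd h h'⟩

theorem EndExtends.trans {s t w : Set Ordinal.{u}} (h : EndExtends t s) (h' : EndExtends w t) :
    EndExtends w s := by
  refine ⟨h.1.trans h'.1, fun α hα hαs γ hγ => ?_⟩
  by_cases hαt : α ∈ t
  · exact h.2 α hαt hαs γ hγ
  · exact h'.2 α hα hαt γ (h.1 hγ)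

theorem CondData.LE.refl (c : CondData.{u}) : c.LE c :=
  ⟨subset_rfl, fun _ _ => rfl, subset_rfl, fun _ _ => EndExtends.refl _⟩

theorem CondData.LE.trans {c d e : CondData.{u}} (h : c.LE d) (h' : d.LE e) : c.LE e :=
  ⟨h.U_sub.trans h'.U_sub, fun α hα => (h.H_eq α hα).trans (h'.H_eq α (h.U_sub hα)),
    h.V_sub.trans h'.V_sub, fun β hβ => (h.E_ext β hβ).trans (h'.E_ext β (h.V_sub hβ))⟩

/-- The set of (von Neumann) ordinals below `λ⁺` in `U`. -/
noncomputable def ofOrds (lam : Cardinal.{u}) (U : Set Ordinal.{u}) : ZFSet.{u} :=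
  ((Order.succ lam).ord.toZFSet).sep (fun x => ∃ α ∈ U, α.toZFSet = x)

theorem mem_ofOrds {lam : Cardinal.{u}} {U : Set Ordinal.{u}}
    (hU : ∀ α ∈ U, α < (Order.succ lam).ord) {x : ZFSet.{u}} :
    x ∈ ofOrds lam U ↔ ∃ α ∈ U, α.toZFSet = x := by
  rw [ofOrds, ZFSet.mem_sep, and_iff_right_iff_imp]
  rintro ⟨α, hα, rfl⟩
  exact Ordinal.toZFSet_mem_toZFSet_iff.2 (hU α hα)

theorem ofOrds_subset (lam : Cardinal.{u}) (U : Set Ordinal.{u}) :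
    ofOrds lam U ⊆ (Order.succ lam).ord.toZFSet :=
  ZFSet.sep_subset

theorem toZFSet_mem_ofOrds {lam : Cardinal.{u}} {U : Set Ordinal.{u}}
    (hU : ∀ α ∈ U, α < (Order.succ lam).ord) {α : Ordinal.{u}} :
    α.toZFSet ∈ ofOrds lam U ↔ α ∈ U := by
  rw [mem_ofOrds hU]
  exact ⟨fun ⟨β, hβ, h⟩ => Ordinal.toZFSet_injective h ▸ hβ, fun h => ⟨α, h, rfl⟩⟩

theorem ords_ofOrds {lam : Cardinal.{u}} {U : Set Ordinal.{u}}
    (hU : ∀ α ∈ U, α < (Order.succ lam).ord) : ords (ofOrds lam U) = U :=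
  Set.ext fun _ => toZFSet_mem_ofOrds hU

theorem ords_lt {lam : Cardinal.{u}} {x : ZFSet.{u}} (hx : x ⊆ (Order.succ lam).ord.toZFSet) :
    ∀ α ∈ ords x, α < (Order.succ lam).ord :=
  fun _ hα => Ordinal.toZFSet_mem_toZFSet_iff.1 (hx hα)

theorem ofOrds_ords {lam : Cardinal.{u}} {x : ZFSet.{u}}
    (hx : x ⊆ (Order.succ lam).ord.toZFSet) : ofOrds lam (ords x) = x := by
  ext y
  rw [mem_ofOrds (ords_lt hx)]
  refine ⟨?_, fun hy => ?_⟩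
  · rintro ⟨α, hα, rfl⟩
    exact hα
  · obtain ⟨α, -, rfl⟩ := Ordinal.mem_toZFSet_iff.1 (hx hy)
    exact ⟨α, hy, rfl⟩

theorem lift_card_ofOrds {lam : Cardinal.{u}} {U : Set Ordinal.{u}}
    (hU : ∀ α ∈ U, α < (Order.succ lam).ord) : lift.{u + 1} (ofOrds lam U).card = #U := by
  rw [← ZFSet.cardinalMk_coe_sort]
  refine (Cardinal.mk_congr (Equiv.ofBijective (fun α : U =>
    (⟨α.1.toZFSet, (toZFSet_mem_ofOrds hU).2 α.2⟩ : ofOrds lam U)) ⟨?_, ?_⟩)).symm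
  · intro α β h
    exact Subtype.ext (Ordinal.toZFSet_injective (congrArg Subtype.val h))
  · rintro ⟨x, hx⟩
    obtain ⟨α, hα, rfl⟩ := (mem_ofOrds hU).1 hx
    exact ⟨⟨α, hα⟩, rfl⟩

theorem ofOrds_subset_ofOrds {lam : Cardinal.{u}} {U U' : Set Ordinal.{u}}
    (hU : ∀ α ∈ U, α < (Order.succ lam).ord) (hU' : ∀ α ∈ U', α < (Order.succ lam).ord) :
    ofOrds lam U ⊆ ofOrds lam U' ↔ U ⊆ U' := by
  refine ⟨fun h α hα => (toZFSet_mem_ofOrds hU').1 (h ((toZFSet_mem_ofOrds hU).2 hα)),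
    fun h x hx => ?_⟩
  obtain ⟨α, hα, rfl⟩ := (mem_ofOrds hU).1 hx
  exact (toZFSet_mem_ofOrds hU').2 (h hα)

/-- The set function `β ↦ e_β`. -/
noncomputable def CondData.eSet (lam : Cardinal.{u}) (c : CondData.{u}) : ZFSet.{u} :=
  (ZFSet.prod (Order.succ lam).ord.toZFSet (Order.succ lam).ord.toZFSet.powerset).sep
    (fun z => ∃ β ∈ c.V, z = ZFSet.pair β.toZFSet (ofOrds lam (c.E β)))

/-- The set function `h`. -/
noncomputable def CondData.hSet (lam : Cardinal.{u}) (c : CondData.{u}) : ZFSet.{u} :=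
  (ZFSet.prod (Order.succ lam).ord.toZFSet (Order.succ lam).ord.toZFSet).sep
    (fun z => ∃ α ∈ c.U, z = ZFSet.pair α.toZFSet (c.H α).toZFSet)

/-- The condition with the given data. -/
noncomputable def CondData.encode (lam : Cardinal.{u}) (c : CondData.{u}) : ZFSet.{u} :=
  quadruple (ofOrds lam c.U) (ofOrds lam c.V) (c.eSet lam) (c.hSet lam)

theorem quadruple_inj {u v e h u' v' e' h' : ZFSet.{u}} :
    quadruple u v e h = quadruple u' v' e' h' ↔ u = u' ∧ v = v' ∧ e = e' ∧ h = h' := by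
  simp [quadruple]

/-! ### The dictionary between set-coded conditions and their ordinal data -/

section
variable {lam : Cardinal.{u}} {ξ : Ordinal.{u}} {Sstar : Set Ordinal.{u}}
  {B : Ordinal.{u} → Set Ordinal.{u}} {g : Ordinal.{u} → Ordinal.{u} → Ordinal.{u}}

theorem IsColouredLadderSystem.colour_lt (hB : IsColouredLadderSystem lam ξ Sstar B g)
    {γ : Ordinal.{u}} (h : γ < ξ) : γ < (Order.succ lam).ord :=
  (h.trans hB.colours).trans (Cardinal.ord_lt_ord.2 (Order.lt_succ lam))

theorem IsPrecond.V_lt (hB : IsColouredLadderSystem lam ξ Sstar B g) {c : CondData.{u}}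
    (hc : IsPrecond lam ξ Sstar B g c) : ∀ β ∈ c.V, β < (Order.succ lam).ord :=
  fun β hβ => hB.below β (hc.V_mem β hβ)

theorem IsPrecond.E_lt {c : CondData.{u}} (hc : IsPrecond lam ξ Sstar B g c) {β : Ordinal.{u}}
    (hβ : β ∈ c.V) : ∀ α ∈ c.E β, α < (Order.succ lam).ord :=
  fun α hα => hc.U_lt α (hc.E_sub_U β hβ hα)

theorem pair_mem_eSet (hB : IsColouredLadderSystem lam ξ Sstar B g) {c : CondData.{u}}
    (hc : IsPrecond lam ξ Sstar B g c) {b E : ZFSet.{u}} :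
    ZFSet.pair b E ∈ c.eSet lam ↔ ∃ β ∈ c.V, b = β.toZFSet ∧ E = ofOrds lam (c.E β) := by
  simp only [CondData.eSet, ZFSet.mem_sep, ZFSet.pair_mem_prod, ZFSet.mem_powerset,
    ZFSet.pair_inj]
  rw [and_iff_right_iff_imp]
  rintro ⟨β, hβ, rfl, rfl⟩
  exact ⟨Ordinal.toZFSet_mem_toZFSet_iff.2 (hc.V_lt hB β hβ), ofOrds_subset _ _⟩

theorem toZFSet_pair_mem_eSet (hB : IsColouredLadderSystem lam ξ Sstar B g) {c : CondData.{u}}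
    (hc : IsPrecond lam ξ Sstar B g c) {β : Ordinal.{u}} {E : ZFSet.{u}} :
    ZFSet.pair β.toZFSet E ∈ c.eSet lam ↔ β ∈ c.V ∧ E = ofOrds lam (c.E β) := by
  rw [pair_mem_eSet hB hc]
  constructor
  · rintro ⟨γ, hγ, h, rfl⟩
    obtain rfl := Ordinal.toZFSet_injective h
    exact ⟨hγ, rfl⟩
  · exact fun h => ⟨β, h.1, rfl, h.2⟩

theorem pair_mem_hSet (hB : IsColouredLadderSystem lam ξ Sstar B g) {c : CondData.{u}}
    (hc : IsPrecond lam ξ Sstar B g c) {a y : ZFSet.{u}} :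
    ZFSet.pair a y ∈ c.hSet lam ↔ ∃ α ∈ c.U, a = α.toZFSet ∧ y = (c.H α).toZFSet := by
  simp only [CondData.hSet, ZFSet.mem_sep, ZFSet.pair_mem_prod, ZFSet.pair_inj]
  rw [and_iff_right_iff_imp]
  rintro ⟨α, hα, rfl, rfl⟩
  exact ⟨Ordinal.toZFSet_mem_toZFSet_iff.2 (hc.U_lt α hα),
    Ordinal.toZFSet_mem_toZFSet_iff.2 (hB.colour_lt (hc.H_lt α hα))⟩

theorem toZFSet_pair_mem_hSet (hB : IsColouredLadderSystem lam ξ Sstar B g) {c : CondData.{u}}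
    (hc : IsPrecond lam ξ Sstar B g c) {α γ : Ordinal.{u}} :
    ZFSet.pair α.toZFSet γ.toZFSet ∈ c.hSet lam ↔ α ∈ c.U ∧ c.H α = γ := by
  rw [pair_mem_hSet hB hc]
  constructor
  · rintro ⟨δ, hδ, h, h'⟩
    obtain rfl := Ordinal.toZFSet_injective h
    exact ⟨hδ, (Ordinal.toZFSet_injective h').symm⟩
  · rintro ⟨h, rfl⟩
    exact ⟨α, h, rfl, rfl⟩

/-- A set smaller than the cofinality of `β` is bounded in `β`. All the room for new points in the
construction comes from this. -/
theorem sSup_lt_of_card_lt {β : Ordinal.{u}} (hβ : β.cof = lam) {s : Set Ordinal.{u}}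
    (hs : #s < lift.{u + 1} lam) (hlt : ∀ α ∈ s, α < β) : sSup s < β := by
  refine Ordinal.sSup_lt_of_lt_cof ?_ hlt
  rwa [← Ordinal.lift_cof, hβ]

theorem bddAbove_of_forall_lt {β : Ordinal.{u}} {s : Set Ordinal.{u}} (hlt : ∀ α ∈ s, α < β) :
    BddAbove s :=
  ⟨β, fun α hα => (hlt α hα).le⟩

theorem IsPrecond.E_card {c : CondData.{u}} (hc : IsPrecond lam ξ Sstar B g c) {β : Ordinal.{u}}
    (hβ : β ∈ c.V) : #(c.E β) < lift.{u + 1} lam :=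
  (Cardinal.mk_le_mk_of_subset (hc.E_sub_U β hβ)).trans_lt hc.U_card

theorem IsPrecond.E_lt_self (hB : IsColouredLadderSystem lam ξ Sstar B g) {c : CondData.{u}}
    (hc : IsPrecond lam ξ Sstar B g c) {β : Ordinal.{u}} (hβ : β ∈ c.V) :
    ∀ α ∈ c.E β, α < β :=
  fun α hα => hB.subset β (hc.V_mem β hβ) α (hc.E_sub_B β hβ hα)

theorem encode_mem_conditions (hB : IsColouredLadderSystem lam ξ Sstar B g) {c : CondData.{u}}
    (hc : IsCond lam ξ Sstar B g c) : c.encode lam ∈ conditions lam ξ Sstar B g := by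
  have hp := hc.toIsPrecond
  have hVlt := hp.V_lt hB
  have hU := ords_ofOrds hp.U_lt
  have hV := ords_ofOrds hVlt
  have hE : ∀ β ∈ c.V, ords (ofOrds lam (c.E β)) = c.E β := fun β hβ => ords_ofOrds (hp.E_lt hβ)
  refine mem_conditions.2 ⟨_, _, _, _, rfl, ?_⟩
  refine ⟨ofOrds_subset _ _, ?_, ofOrds_subset _ _, ?_, ?_, ⟨?_, ?_⟩, ?_, ?_, ?_, ?_, ?_,
    ⟨?_, ?_⟩, ?_⟩
  · rw [← Cardinal.lift_lt.{u, u + 1}, lift_card_ofOrds hp.U_lt]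
    exact hp.U_card
  · rw [hV]
    exact hp.V_mem
  · rw [← Cardinal.lift_lt.{u, u + 1}, lift_card_ofOrds hVlt]
    exact hp.V_card
  · intro z hz
    obtain ⟨β, hβ, rfl⟩ := (ZFSet.mem_sep.1 hz).2
    rw [ZFSet.pair_mem_prod, ZFSet.mem_powerset, toZFSet_mem_ofOrds hVlt,
      ofOrds_subset_ofOrds (hp.E_lt hβ) hp.U_lt]
    exact ⟨hβ, hp.E_sub_U β hβ⟩
  · intro z hz
    obtain ⟨β, hβ, rfl⟩ := (mem_ofOrds hVlt).1 hz
    refine ⟨ofOrds lam (c.E β), (toZFSet_pair_mem_eSet hB hp).2 ⟨hβ, rfl⟩, fun E hE => ?_⟩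
    exact ((toZFSet_pair_mem_eSet hB hp).1 hE).2
  · intro β E h
    obtain ⟨hβ, rfl⟩ := (toZFSet_pair_mem_eSet hB hp).1 h
    rw [hE β hβ]
    exact hp.E_sub_B β hβ
  · intro β E h
    obtain ⟨hβ, rfl⟩ := (toZFSet_pair_mem_eSet hB hp).1 h
    rw [hE β hβ]
    exact hp.E_closed β hβ
  · intro β E h
    obtain ⟨hβ, rfl⟩ := (toZFSet_pair_mem_eSet hB hp).1 h
    rw [hE β hβ]
    -- Boundedness of `e_β` is not among the clauses of `IsCond`; it follows from `|e_β| < λ = cf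
    -- β`.
    have hlt := hp.E_lt_self hB hβ
    exact ⟨sSup (c.E β), sSup_lt_of_card_lt (hB.cof_eq β (hp.V_mem β hβ)) (hp.E_card hβ) hlt,
      fun α hα => le_csSup (bddAbove_of_forall_lt hlt) hα⟩
  · intro β E h
    obtain ⟨hβ, rfl⟩ := (toZFSet_pair_mem_eSet hB hp).1 h
    rw [hE β hβ, hU]
    exact hc.E_sup β hβ
  · intro β₁ β₂ E₁ E₂ hlt h₁ h₂
    obtain ⟨hβ₁, rfl⟩ := (toZFSet_pair_mem_eSet hB hp).1 h₁
    obtain ⟨hβ₂, rfl⟩ := (toZFSet_pair_mem_eSet hB hp).1 h₂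
    rw [hE β₁ hβ₁, hE β₂ hβ₂]
    exact hc.E_separated β₁ hβ₁ β₂ hβ₂ hlt
  · intro z hz
    obtain ⟨α, hα, rfl⟩ := (ZFSet.mem_sep.1 hz).2
    rw [ZFSet.pair_mem_prod, toZFSet_mem_ofOrds hp.U_lt, Ordinal.toZFSet_mem_toZFSet_iff]
    exact ⟨hα, hp.H_lt α hα⟩
  · intro z hz
    obtain ⟨α, hα, rfl⟩ := (mem_ofOrds hp.U_lt).1 hz
    refine ⟨(c.H α).toZFSet, (toZFSet_pair_mem_hSet hB hp).2 ⟨hα, rfl⟩, fun y hy => ?_⟩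
    obtain ⟨α', -, h, rfl⟩ := (pair_mem_hSet hB hp).1 hy
    rw [Ordinal.toZFSet_injective h]
  · intro β E h α hα
    obtain ⟨hβ, rfl⟩ := (toZFSet_pair_mem_eSet hB hp).1 h
    rw [hE β hβ] at hα
    exact (toZFSet_pair_mem_hSet hB hp).2 ⟨hp.E_sub_U β hβ hα, hp.H_agrees β hβ α hα⟩

theorem exists_encode_eq (hB : IsColouredLadderSystem lam ξ Sstar B g) {p : ZFSet.{u}}
    (hp : p ∈ conditions lam ξ Sstar B g) :
    ∃ c : CondData.{u}, IsCond lam ξ Sstar B g c ∧ c.encode lam = p := by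
  obtain ⟨u, v, e, h, rfl, hc⟩ := mem_conditions.1 hp
  have hE : ∀ β ∈ ords v, ∃ E, ZFSet.pair β.toZFSet E ∈ e := fun β hβ => (hc.e_func.2 _ hβ).exists
  choose! E hE using hE
  have hE' : ∀ β ∈ ords v, ∀ E', ZFSet.pair β.toZFSet E' ∈ e → E' = E β := fun β hβ E' h' =>
    (hc.e_func.2 _ hβ).unique h' (hE β hβ)
  have hEv : ∀ β E', ZFSet.pair β E' ∈ e → β ∈ v ∧ E' ⊆ u := fun β E' h' => by
    simpa using! hc.e_func.1 h'
  have hH : ∀ α ∈ ords u, ∃ γ : Ordinal.{u}, ZFSet.pair α.toZFSet γ.toZFSet ∈ h := by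
    intro α hα
    obtain ⟨y, hy⟩ := (hc.h_func.2 α.toZFSet hα).exists
    obtain ⟨γ, -, rfl⟩ := Ordinal.mem_toZFSet_iff.1 (ZFSet.pair_mem_prod.1 (hc.h_func.1 hy)).2
    exact ⟨γ, hy⟩
  choose! H hH using hH
  have hH' : ∀ α ∈ ords u, ∀ y, ZFSet.pair α.toZFSet y ∈ h → y = (H α).toZFSet :=
    fun α hα y h' => (hc.h_func.2 α.toZFSet hα).unique h' (hH α hα)
  let c : CondData.{u} := ⟨ords u, ords v, fun β => ords (E β), H⟩
  have hcard : ∀ x : ZFSet.{u}, x ⊆ (Order.succ lam).ord.toZFSet → x.card < lam →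
      #(ords x) < lift.{u + 1} lam := by
    intro x hx hx'
    rw [← lift_card_ofOrds (ords_lt hx), ofOrds_ords hx]
    exact Cardinal.lift_lt.2 hx'
  have hcc : IsCond lam ξ Sstar B g c := by
    refine ⟨⟨ords_lt hc.u_subset, hcard u hc.u_subset hc.u_card, hc.v_subset_Sstar,
      hcard v hc.v_subset hc.v_card, ?_, ?_, ?_, ?_, ?_⟩, ?_, ?_⟩
    · exact fun β hβ α hα => (hEv _ _ (hE β hβ)).2 (show α.toZFSet ∈ E β from hα)
    · exact fun β hβ => hc.e_subset β _ (hE β hβ)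
    · exact fun β hβ => hc.e_closed β _ (hE β hβ)
    · intro α hα
      exact Ordinal.toZFSet_mem_toZFSet_iff.1
        (ZFSet.pair_mem_prod.1 (hc.h_func.1 (hH α hα))).2
    · intro β hβ α hα
      have hαu : α ∈ ords u := (hEv _ _ (hE β hβ)).2 (show α.toZFSet ∈ E β from hα)
      exact (Ordinal.toZFSet_injective (hH' α hαu _ (hc.h_agrees β _ (hE β hβ) α hα))).symm
    · exact fun β hβ => hc.e_sup β _ (hE β hβ)
    · exact fun β₁ h₁ β₂ h₂ hlt => hc.e_separated β₁ β₂ _ _ hlt (hE β₁ h₁) (hE β₂ h₂)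
  refine ⟨c, hcc, ?_⟩
  rw [CondData.encode, quadruple_inj]
  refine ⟨ofOrds_ords hc.u_subset, ofOrds_ords hc.v_subset, ?_, ?_⟩
  · have hEE : ∀ β ∈ ords v, ofOrds lam (c.E β) = E β := fun β hβ =>
      ofOrds_ords (fun x hx => hc.u_subset ((hEv _ _ (hE β hβ)).2 hx))
    ext z
    constructor
    · intro hz
      obtain ⟨β, hβ, rfl⟩ := (ZFSet.mem_sep.1 hz).2
      rw [hEE β hβ]
      exact hE β hβ
    · intro hz
      obtain ⟨b, hb, E', -, rfl⟩ := ZFSet.mem_prod.1 (hc.e_func.1 hz)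
      obtain ⟨β, -, rfl⟩ := Ordinal.mem_toZFSet_iff.1 (hc.v_subset hb)
      exact (toZFSet_pair_mem_eSet hB hcc.toIsPrecond).2
        ⟨hb, by rw [hEE β hb]; exact hE' β hb E' hz⟩
  · ext z
    constructor
    · intro hz
      obtain ⟨α, hα, rfl⟩ := (ZFSet.mem_sep.1 hz).2
      exact hH α hα
    · intro hz
      obtain ⟨a, ha, y, -, rfl⟩ := ZFSet.mem_prod.1 (hc.h_func.1 hz)
      obtain ⟨α, -, rfl⟩ := Ordinal.mem_toZFSet_iff.1 (hc.u_subset ha)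
      exact (pair_mem_hSet hB hcc.toIsPrecond).2 ⟨α, ha, rfl, hH' α ha y hz⟩

theorem condLE_encode (hB : IsColouredLadderSystem lam ξ Sstar B g) {c d : CondData.{u}}
    (hc : IsCond lam ξ Sstar B g c) (hd : IsCond lam ξ Sstar B g d) :
    condLE (c.encode lam) (d.encode lam) ↔ c.LE d := by
  have hc := hc.toIsPrecond
  have hd := hd.toIsPrecond
  have : condLE (c.encode lam) (d.encode lam) ↔ ofOrds lam c.U ⊆ ofOrds lam d.U ∧
      c.hSet lam ⊆ d.hSet lam ∧ ofOrds lam c.V ⊆ ofOrds lam d.V ∧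
      ∀ β E E', ZFSet.pair β E ∈ c.eSet lam → ZFSet.pair β E' ∈ d.eSet lam →
        EndExtends (ords E') (ords E) := by
    constructor
    · rintro ⟨u, v, e, h, u', v', e', h', h₁, h₂, H⟩
      obtain ⟨rfl, rfl, rfl, rfl⟩ := quadruple_inj.1 h₁
      obtain ⟨rfl, rfl, rfl, rfl⟩ := quadruple_inj.1 h₂
      exact H
    · exact fun H => ⟨_, _, _, _, _, _, _, _, rfl, rfl, H⟩
  rw [this, ofOrds_subset_ofOrds hc.U_lt hd.U_lt,
    ofOrds_subset_ofOrds (hc.V_lt hB) (hd.V_lt hB)]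
  constructor
  · rintro ⟨h₁, h₂, h₃, h₄⟩
    refine ⟨h₁, fun α hα => ?_, h₃, fun β hβ => ?_⟩
    · exact ((toZFSet_pair_mem_hSet hB hd).1
        (h₂ ((toZFSet_pair_mem_hSet hB hc).2 ⟨hα, rfl⟩))).2.symm
    · have := h₄ β.toZFSet _ _ ((toZFSet_pair_mem_eSet hB hc).2 ⟨hβ, rfl⟩)
        ((toZFSet_pair_mem_eSet hB hd).2 ⟨h₃ hβ, rfl⟩)
      rwa [ords_ofOrds (hc.E_lt hβ), ords_ofOrds (hd.E_lt (h₃ hβ))] at this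
  · intro h
    refine ⟨h.U_sub, fun z hz => ?_, h.V_sub, fun b E E' h₁ h₂ => ?_⟩
    · obtain ⟨α, hα, rfl⟩ := (ZFSet.mem_sep.1 hz).2
      exact (toZFSet_pair_mem_hSet hB hd).2 ⟨h.U_sub hα, (h.H_eq α hα).symm⟩
    · obtain ⟨β, hβ, rfl, rfl⟩ := (pair_mem_eSet hB hc).1 h₁
      obtain ⟨hβ', rfl⟩ := (toZFSet_pair_mem_eSet hB hd).1 h₂
      rw [ords_ofOrds (hc.E_lt hβ), ords_ofOrds (hd.E_lt hβ')]
      exact h.E_ext β hβ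

end

/-- The data of a condition. -/
noncomputable def decode (lam : Cardinal.{u}) (ξ : Ordinal.{u}) (Sstar : Set Ordinal.{u})
    (B : Ordinal.{u} → Set Ordinal.{u}) (g : Ordinal.{u} → Ordinal.{u} → Ordinal.{u})
    (p : ZFSet.{u}) : CondData.{u} :=
  open Classical in
  if h : ∃ c : CondData.{u}, IsCond lam ξ Sstar B g c ∧ c.encode lam = p then h.choose
  else ⟨∅, ∅, fun _ => ∅, fun _ => 0⟩

/-! ### The forcing order in terms of data -/

section
variable {lam : Cardinal.{u}} {ξ : Ordinal.{u}} {Sstar : Set Ordinal.{u}}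
  {B : Ordinal.{u} → Set Ordinal.{u}} {g : Ordinal.{u} → Ordinal.{u} → Ordinal.{u}}

theorem decode_spec (hB : IsColouredLadderSystem lam ξ Sstar B g) {p : ZFSet.{u}}
    (hp : p ∈ conditions lam ξ Sstar B g) :
    IsCond lam ξ Sstar B g (decode lam ξ Sstar B g p) ∧
      (decode lam ξ Sstar B g p).encode lam = p := by
  have h := exists_encode_eq hB hp
  rw [decode, dif_pos h]
  exact h.choose_spec

theorem le_iff_decode (hB : IsColouredLadderSystem lam ξ Sstar B g) {p q : ZFSet.{u}}
    (hp : p ∈ conditions lam ξ Sstar B g) (hq : q ∈ conditions lam ξ Sstar B g) :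
    (uniformForcing lam ξ Sstar B g).le p q ↔
      (decode lam ξ Sstar B g p).LE (decode lam ξ Sstar B g q) := by
  obtain ⟨hp₁, hp₂⟩ := decode_spec hB hp
  obtain ⟨hq₁, hq₂⟩ := decode_spec hB hq
  rw [← condLE_encode hB hp₁ hq₁, hp₂, hq₂, uniformForcing_le]
  simp [hp, hq]

/-- Data are not determined by the condition: `E` off `V` and `H` off `U` are arbitrary. So decoding
inverts encoding only up to equivalence in the order. -/
theorem decode_encode_LE (hB : IsColouredLadderSystem lam ξ Sstar B g) {c : CondData.{u}}
    (hc : IsCond lam ξ Sstar B g c) :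
    c.LE (decode lam ξ Sstar B g (c.encode lam)) ∧
      (decode lam ξ Sstar B g (c.encode lam)).LE c := by
  obtain ⟨h₁, h₂⟩ := decode_spec hB (encode_mem_conditions hB hc)
  rw [← condLE_encode hB hc h₁, ← condLE_encode hB h₁ hc, h₂, condLE_encode hB hc hc]
  exact ⟨CondData.LE.refl c, CondData.LE.refl c⟩

theorem le_encode_iff (hB : IsColouredLadderSystem lam ξ Sstar B g) {p : ZFSet.{u}}
    {c : CondData.{u}} (hp : p ∈ conditions lam ξ Sstar B g) (hc : IsCond lam ξ Sstar B g c) :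
    (uniformForcing lam ξ Sstar B g).le p (c.encode lam) ↔
      (decode lam ξ Sstar B g p).LE c := by
  rw [le_iff_decode hB hp (encode_mem_conditions hB hc)]
  have := decode_encode_LE hB hc
  exact ⟨fun h => h.trans this.2, fun h => h.trans this.1⟩

theorem encode_le_iff (hB : IsColouredLadderSystem lam ξ Sstar B g) {p : ZFSet.{u}}
    {c : CondData.{u}} (hp : p ∈ conditions lam ξ Sstar B g) (hc : IsCond lam ξ Sstar B g c) :
    (uniformForcing lam ξ Sstar B g).le (c.encode lam) p ↔
      c.LE (decode lam ξ Sstar B g p) := by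
  rw [le_iff_decode hB (encode_mem_conditions hB hc) hp]
  have := decode_encode_LE hB hc
  exact ⟨fun h => this.1.trans h, fun h => this.2.trans h⟩

end

section
variable {lam : Cardinal.{u}} {ξ : Ordinal.{u}} {Sstar : Set Ordinal.{u}}
  {B : Ordinal.{u} → Set Ordinal.{u}} {g : Ordinal.{u} → Ordinal.{u} → Ordinal.{u}}

/-! ### Ladders -/

theorem IsColouredLadderSystem.exists_gt (hlam : lam.IsRegular)
    (hB : IsColouredLadderSystem lam ξ Sstar B g) {β τ : Ordinal.{u}} (hβ : β ∈ Sstar)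
    (hτ : τ < β) : ∃ γ ∈ B β, τ < γ := by
  have hlim : Order.IsSuccLimit β := by
    rw [← Ordinal.one_lt_cof_iff, hB.cof_eq β hβ]
    exact Cardinal.one_lt_aleph0.trans_le hlam.aleph0_le
  obtain ⟨γ, hγ, h⟩ := (hB.club β hβ).isCofinal ⟨Order.succ τ, hlim.succ_lt hτ⟩
  exact ⟨γ, hγ, (Order.lt_succ τ).trans_le h⟩

theorem IsColouredLadderSystem.sSup_mem (hB : IsColouredLadderSystem lam ξ Sstar B g)
    {β : Ordinal.{u}} (hβ : β ∈ Sstar) {t : Set Ordinal.{u}} (ht : t ⊆ B β) (hne : t.Nonempty)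
    (hlt : sSup t < β) : sSup t ∈ B β := by
  have htβ : ∀ α ∈ t, α < β := fun α hα => hB.subset β hβ α (ht hα)
  have := (hB.club β hβ).isLUB_mem (t := {x : Set.Iio β | x.1 ∈ t}) (x := ⟨sSup t, hlt⟩)
    (fun x hx => ht hx) (by
      obtain ⟨α, hα⟩ := hne
      exact ⟨⟨α, htβ α hα⟩, hα⟩) (by
      constructor
      · intro x hx
        exact le_csSup (bddAbove_of_forall_lt htβ) hx
      · intro y hy
        exact csSup_le hne fun α hα => hy (show (⟨α, htβ α hα⟩ : Set.Iio β) ∈ _ from hα))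
  exact this

/-- Under the isomorphism of `B β` with `λ`, a part bounded in `β` goes into a proper initial
segment of `λ`. -/
theorem IsColouredLadderSystem.card_inter_Iio_lt (hlam : lam.IsRegular)
    (hB : IsColouredLadderSystem lam ξ Sstar B g) {β η : Ordinal.{u}} (hβ : β ∈ Sstar)
    (hη : η < β) : #(B β ∩ Iio η : Set Ordinal.{u}) < lift.{u + 1} lam := by
  obtain ⟨φ⟩ := hB.otp β hβ
  obtain ⟨b, hb, hηb⟩ := hB.exists_gt hlam hβ hη
  let i := φ.symm ⟨b, hb⟩
  have hlt : ∀ x : (B β ∩ Iio η : Set Ordinal.{u}), (φ.symm ⟨x.1, x.2.1⟩).1 < i.1 := by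
    intro x
    have : φ.symm ⟨x.1, x.2.1⟩ < i := φ.symm.lt_iff_lt.2 (lt_trans (b := η) x.2.2 hηb)
    exact this
  have hle : #(B β ∩ Iio η : Set Ordinal.{u}) ≤ #(Iio i.1) := by
    refine Cardinal.mk_le_of_injective (f := fun x => ⟨(φ.symm ⟨x.1, x.2.1⟩).1, hlt x⟩) ?_
    intro x y h
    have h' := Subtype.mk.inj h
    have := φ.symm.injective (Subtype.ext h')
    exact Subtype.ext (Subtype.mk.inj this)
  refine hle.trans_lt ?_
  rw [Cardinal.mk_Iio_ordinal, Cardinal.lift_lt]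
  exact Cardinal.lt_ord.1 i.2

/-- Fewer than `λ` points cannot be cofinal in an ordinal of cofinality `λ`. Hence two ladders can
be separated, as the last clause on `ē` requires. -/
theorem IsColouredLadderSystem.sSup_inter_Iio_lt (hlam : lam.IsRegular)
    (hB : IsColouredLadderSystem lam ξ Sstar B g) {β η : Ordinal.{u}} (hβ : β ∈ Sstar)
    (hη : η < β) (hcof : η.cof = lam) : sSup (B β ∩ Iio η) < η :=
  sSup_lt_of_card_lt hcof (hB.card_inter_Iio_lt hlam hβ hη) fun _ h => h.2

/-! ### Extending data to conditions -/

/-- Each `e_β` receives one new top point `γ β ∈ B β` above `τ β`, above all of `U` and `V` below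
`β`, and above the traces on `β` of the later ladders. Each bound is below `β` by cofinality. Then
`γ β` is the maximum both of the new `e_β` and of the new `u` below `β`, which yields the supremum
clauses. The parameter `τ` lets the caller push the clubs up. -/
theorem IsPrecond.exists_extension (hlam : lam.IsRegular)
    (hB : IsColouredLadderSystem lam ξ Sstar B g) {c : CondData.{u}}
    (hc : IsPrecond lam ξ Sstar B g c) (τ : Ordinal.{u} → Ordinal.{u})
    (hτ : ∀ β ∈ c.V, τ β < β) :
    ∃ d : CondData.{u}, IsCond lam ξ Sstar B g d ∧ c.LE d ∧
      ∀ β ∈ c.V, ∃ γ ∈ d.E β, τ β < γ := by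
  have hcof : ∀ β ∈ c.V, β.cof = lam := fun β hβ => hB.cof_eq β (hc.V_mem β hβ)
  have hγ : ∀ β ∈ c.V, ∃ γ ∈ B β, τ β < γ ∧ sSup (c.U ∩ Iio β) < γ ∧ sSup (c.V ∩ Iio β) < γ ∧
      ∀ β₂ ∈ c.V, β < β₂ → sSup (B β₂ ∩ Iio β) < γ := by
    intro β hβ
    have h₁ : sSup (c.U ∩ Iio β) < β := sSup_lt_of_card_lt (hcof β hβ)
      ((Cardinal.mk_le_mk_of_subset inter_subset_left).trans_lt hc.U_card) fun _ h => h.2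
    have h₂ : sSup (c.V ∩ Iio β) < β := sSup_lt_of_card_lt (hcof β hβ)
      ((Cardinal.mk_le_mk_of_subset inter_subset_left).trans_lt hc.V_card) fun _ h => h.2
    let t := (fun β₂ => sSup (B β₂ ∩ Iio β)) '' (c.V ∩ Ioi β)
    have ht : ∀ α ∈ t, α < β := by
      rintro _ ⟨β₂, ⟨h, hlt⟩, rfl⟩
      exact hB.sSup_inter_Iio_lt hlam (hc.V_mem β₂ h) hlt (hcof β hβ)
    have h₃ : sSup t < β := sSup_lt_of_card_lt (hcof β hβ)
      ((Cardinal.mk_image_le.trans (Cardinal.mk_le_mk_of_subset inter_subset_left)).trans_lt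
        hc.V_card) ht
    obtain ⟨γ, hγ, h⟩ := hB.exists_gt hlam (hc.V_mem β hβ)
      (max_lt (hτ β hβ) (max_lt h₁ (max_lt h₂ h₃)))
    simp only [max_lt_iff] at h
    refine ⟨γ, hγ, h.1, h.2.1, h.2.2.1, fun β₂ hβ₂ hlt => lt_of_le_of_lt ?_ h.2.2.2⟩
    exact le_csSup (bddAbove_of_forall_lt ht) ⟨β₂, ⟨hβ₂, hlt⟩, rfl⟩
  choose! γ hγB hγτ hγU hγV hγs using hγ
  have hγlt : ∀ β ∈ c.V, γ β < β := fun β hβ => hB.subset β (hc.V_mem β hβ) _ (hγB β hβ)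
  have hUγ : ∀ β ∈ c.V, ∀ α ∈ c.U, α < β → α < γ β := fun β hβ α hα hlt =>
    (le_csSup (bddAbove_of_forall_lt (β := β) fun _ h => h.2) (show α ∈ c.U ∩ Iio β from
      ⟨hα, hlt⟩)).trans_lt (hγU β hβ)
  have hVγ : ∀ β ∈ c.V, ∀ α ∈ c.V, α < β → α < γ β := fun β hβ α hα hlt =>
    (le_csSup (bddAbove_of_forall_lt (β := β) fun _ h => h.2) (show α ∈ c.V ∩ Iio β from
      ⟨hα, hlt⟩)).trans_lt (hγV β hβ)
  -- For `β₁ < β₂` one has `γ β₁ < β₁ < γ β₂`; hence no new point receives two colours.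
  have hinj : ∀ β₁ ∈ c.V, ∀ β₂ ∈ c.V, γ β₁ = γ β₂ → β₁ = β₂ := by
    have key : ∀ β₁ ∈ c.V, ∀ β₂ ∈ c.V, β₁ < β₂ → γ β₁ < γ β₂ := fun β₁ h₁ β₂ h₂ hlt =>
      (hγlt β₁ h₁).trans (hVγ β₂ h₂ β₁ h₁ hlt)
    intro β₁ h₁ β₂ h₂ h
    rcases lt_trichotomy β₁ β₂ with hlt | rfl | hlt
    · exact absurd h (key _ h₁ _ h₂ hlt).ne
    · rfl
    · exact absurd h (key _ h₂ _ h₁ hlt).ne'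
  -- Otherwise `γ β`, a member of `U` below `β`, would be smaller than itself.
  have hγU' : ∀ β ∈ c.V, γ β ∉ c.U := fun β hβ h => (hUγ β hβ _ h (hγlt β hβ)).false
  classical
  let H : Ordinal.{u} → Ordinal.{u} := fun α => if α ∈ c.U then c.H α else
    if h : ∃ β ∈ c.V, γ β = α then g h.choose α else 0
  have hHU : ∀ α ∈ c.U, H α = c.H α := fun α hα => if_pos hα
  have hHγ : ∀ β ∈ c.V, H (γ β) = g β (γ β) := by
    intro β hβ
    have h : ∃ β' ∈ c.V, γ β' = γ β := ⟨β, hβ, rfl⟩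
    simp only [H, if_neg (hγU' β hβ), dif_pos h]
    rw [hinj _ h.choose_spec.1 β hβ h.choose_spec.2]
  have hElt : ∀ β ∈ c.V, ∀ α ∈ c.E β, α < γ β := fun β hβ α hα =>
    hUγ β hβ α (hc.E_sub_U β hβ hα) (hc.E_lt_self hB hβ α hα)
  have hsE : ∀ β ∈ c.V, sSup (insert (γ β) (c.E β)) = γ β := by
    intro β hβ
    refine IsGreatest.csSup_eq ⟨mem_insert _ _, ?_⟩
    rintro α (rfl | hα)
    · exact le_rfl
    · exact (hElt β hβ α hα).le
  have hlam' := (IsRegular.lift.{u + 1} hlam).aleph0_le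
  refine ⟨⟨c.U ∪ γ '' c.V, c.V, fun β => insert (γ β) (c.E β), H⟩,
    ⟨⟨?_, ?_, hc.V_mem, hc.V_card, ?_, ?_, ?_, ?_, ?_⟩, ?_, ?_⟩, ⟨?_, ?_, ?_, ?_⟩, ?_⟩
  · rintro α (hα | ⟨β, hβ, rfl⟩)
    · exact hc.U_lt α hα
    · exact (hγlt β hβ).trans (hc.V_lt hB β hβ)
  · exact (Cardinal.mk_union_le _ _).trans_lt (Cardinal.add_lt_of_lt hlam' hc.U_card
      (Cardinal.mk_image_le.trans_lt hc.V_card))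
  · rintro β hβ α (rfl | hα)
    · exact Or.inr ⟨β, hβ, rfl⟩
    · exact Or.inl (hc.E_sub_U β hβ hα)
  · rintro β hβ α (rfl | hα)
    · exact hγB β hβ
    · exact hc.E_sub_B β hβ hα
  · intro β hβ
    exact isClosed_singleton.union (hc.E_closed β hβ)
  · rintro α (hα | ⟨β, hβ, rfl⟩)
    · exact (hHU α hα).trans_lt (hc.H_lt α hα)
    · exact (hHγ β hβ).trans_lt (hB.values β (hc.V_mem β hβ) _ (hγB β hβ))
  · rintro β hβ α (rfl | hα)
    · exact hHγ β hβ
    · exact (hHU α (hc.E_sub_U β hβ hα)).trans (hc.H_agrees β hβ α hα)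
  · intro β hβ
    dsimp only at hβ ⊢
    rw [hsE β hβ]
    -- New points belonging to ladders beyond `β` lie above `β`, so they do not affect the supremum
    -- below `β`.
    have : IsGreatest ((c.U ∪ γ '' c.V) ∩ Iio β) (γ β) := ?_
    · exact this.csSup_eq.symm
    refine ⟨⟨Or.inr ⟨β, hβ, rfl⟩, hγlt β hβ⟩, ?_⟩
    rintro α ⟨hα | ⟨β', hβ', rfl⟩, hlt⟩
    · exact (hUγ β hβ α hα hlt).le
    · rcases lt_trichotomy β' β with h | rfl | h
      · exact ((hγlt β' hβ').trans (hVγ β hβ β' hβ' h)).le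
      · exact le_rfl
      · exact absurd hlt (hVγ β' hβ' β hβ h).not_gt
  · intro β₁ h₁ β₂ h₂ hlt
    dsimp only at h₁ h₂ ⊢
    rw [hsE β₁ h₁, hsE β₂ h₂]
    exact ⟨hVγ β₂ h₂ β₁ h₁ hlt, hγs β₁ h₁ β₂ h₂ hlt⟩
  · exact subset_union_left
  · exact fun α hα => (hHU α hα).symm
  · exact subset_rfl
  · refine fun β hβ => ⟨subset_insert _ _, ?_⟩
    rintro α (rfl | hα) hα'
    · exact hElt β hβ
    · exact absurd hα hα'
  · exact fun β hβ => ⟨γ β, mem_insert _ _, hγτ β hβ⟩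

/-- Two conditions that agree are compatible. -/
theorem IsCond.exists_merge (hlam : lam.IsRegular)
    (hB : IsColouredLadderSystem lam ξ Sstar B g) {c d : CondData.{u}}
    (hc : IsCond lam ξ Sstar B g c) (hd : IsCond lam ξ Sstar B g d)
    (hH : ∀ α ∈ c.U, α ∈ d.U → c.H α = d.H α)
    (hE : ∀ β ∈ c.V, β ∈ d.V → EndExtends (d.E β) (c.E β))
    (τ : Ordinal.{u} → Ordinal.{u}) (hτ : ∀ β ∈ c.V ∪ d.V, τ β < β) :
    ∃ e : CondData.{u}, IsCond lam ξ Sstar B g e ∧ c.LE e ∧ d.LE e ∧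
      ∀ β ∈ c.V ∪ d.V, ∃ γ ∈ e.E β, τ β < γ := by
  classical
  -- At a common ladder the club of `d` is kept, since it end-extends that of `c`.
  let m : CondData.{u} := ⟨c.U ∪ d.U, c.V ∪ d.V, fun β => if β ∈ d.V then d.E β else c.E β,
    fun α => if α ∈ d.U then d.H α else c.H α⟩
  have hlam' := (IsRegular.lift.{u + 1} hlam).aleph0_le
  have hHc : ∀ α ∈ c.U, m.H α = c.H α := by
    intro α hα
    by_cases h : α ∈ d.U
    · exact (if_pos h).trans (hH α hα h).symm
    · exact if_neg h
  have hHd : ∀ α ∈ d.U, m.H α = d.H α := fun α hα => if_pos hα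
  have hEd : ∀ β ∈ d.V, m.E β = d.E β := fun β hβ => if_pos hβ
  have hEc : ∀ β, β ∉ d.V → m.E β = c.E β := fun β hβ => if_neg hβ
  have hm : IsPrecond lam ξ Sstar B g m := by
    have hcase : ∀ β ∈ m.V, (β ∈ d.V ∧ m.E β = d.E β) ∨ (β ∈ c.V ∧ m.E β = c.E β) := by
      intro β hβ
      by_cases h : β ∈ d.V
      · exact Or.inl ⟨h, hEd β h⟩
      · exact Or.inr ⟨hβ.resolve_right h, hEc β h⟩
    refine ⟨?_, ?_, ?_, ?_, ?_, ?_, ?_, ?_, ?_⟩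
    · rintro α (h | h)
      exacts [hc.U_lt α h, hd.U_lt α h]
    · exact (Cardinal.mk_union_le _ _).trans_lt (Cardinal.add_lt_of_lt hlam' hc.U_card hd.U_card)
    · rintro α (h | h)
      exacts [hc.V_mem α h, hd.V_mem α h]
    · exact (Cardinal.mk_union_le _ _).trans_lt (Cardinal.add_lt_of_lt hlam' hc.V_card hd.V_card)
    · intro β hβ
      rcases hcase β hβ with ⟨h, h'⟩ | ⟨h, h'⟩ <;> rw [h']
      exacts [(hd.E_sub_U β h).trans subset_union_right, (hc.E_sub_U β h).trans subset_union_left]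
    · intro β hβ
      rcases hcase β hβ with ⟨h, h'⟩ | ⟨h, h'⟩ <;> rw [h']
      exacts [hd.E_sub_B β h, hc.E_sub_B β h]
    · intro β hβ
      rcases hcase β hβ with ⟨h, h'⟩ | ⟨h, h'⟩ <;> rw [h']
      exacts [hd.E_closed β h, hc.E_closed β h]
    · intro α hα
      by_cases h : α ∈ d.U
      · exact (hHd α h).trans_lt (hd.H_lt α h)
      · have h' : α ∈ c.U := hα.resolve_right h
        exact (hHc α h').trans_lt (hc.H_lt α h')
    · intro β hβ α hα
      rcases hcase β hβ with ⟨h, h'⟩ | ⟨h, h'⟩ <;> rw [h'] at hα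
      · exact (hHd α (hd.E_sub_U β h hα)).trans (hd.H_agrees β h α hα)
      · exact (hHc α (hc.E_sub_U β h hα)).trans (hc.H_agrees β h α hα)
  obtain ⟨e, he, hme, hτe⟩ := hm.exists_extension hlam hB τ hτ
  refine ⟨e, he, CondData.LE.trans ⟨subset_union_left, fun α hα => (hHc α hα).symm,
    subset_union_left, fun β hβ => ?_⟩ hme, CondData.LE.trans ⟨subset_union_right,
    fun α hα => (hHd α hα).symm, subset_union_right, fun β hβ => ?_⟩ hme, hτe⟩
  · by_cases h : β ∈ d.V
    · rw [hEd β h]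
      exact hE β hβ h
    · rw [hEc β h]
      exact EndExtends.refl _
  · rw [hEd β hβ]
    exact EndExtends.refl _

/-! ### Restrictions -/

/-- The part of a condition below `δ`. -/
def CondData.restrict (c : CondData.{u}) (δ : Ordinal.{u}) : CondData.{u} :=
  ⟨c.U ∩ Iio δ, c.V ∩ Iio δ, c.E, c.H⟩

theorem CondData.restrict_LE (c : CondData.{u}) (δ : Ordinal.{u}) : (c.restrict δ).LE c :=
  ⟨inter_subset_left, fun _ _ => rfl, inter_subset_left, fun _ _ => EndExtends.refl _⟩

/-- For `β < δ` everything a clause says about `e_β` happens below `β`, so cutting `U` and `V` at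
`δ` harms nothing, and the clubs can be left as they are. -/
theorem IsCond.restrict (hB : IsColouredLadderSystem lam ξ Sstar B g) {c : CondData.{u}}
    (hc : IsCond lam ξ Sstar B g c) (δ : Ordinal.{u}) :
    IsCond lam ξ Sstar B g (c.restrict δ) where
  U_lt α hα := hc.U_lt α hα.1
  U_card := (Cardinal.mk_le_mk_of_subset inter_subset_left).trans_lt hc.U_card
  V_mem β hβ := hc.V_mem β hβ.1
  V_card := (Cardinal.mk_le_mk_of_subset inter_subset_left).trans_lt hc.V_card
  E_sub_U β hβ α hα := ⟨hc.E_sub_U β hβ.1 hα, (hc.E_lt_self hB hβ.1 α hα).trans hβ.2⟩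
  E_sub_B β hβ := hc.E_sub_B β hβ.1
  E_closed β hβ := hc.E_closed β hβ.1
  H_lt α hα := hc.H_lt α hα.1
  H_agrees β hβ := hc.H_agrees β hβ.1
  E_sup β hβ := by
    have : c.U ∩ Iio δ ∩ Iio β = c.U ∩ Iio β := by
      rw [inter_assoc, Iio_inter_Iio, min_eq_right (le_of_lt hβ.2)]
    simp only [CondData.restrict, this]
    exact hc.E_sup β hβ.1
  E_separated β₁ h₁ β₂ h₂ := hc.E_separated β₁ h₁.1 β₂ h₂.1

/-- A condition `d` below `δ` that extends the part below `δ` of a condition `c` is compatible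
with `c`. -/
theorem IsCond.exists_merge_of_restrict (hlam : lam.IsRegular)
    (hB : IsColouredLadderSystem lam ξ Sstar B g) {c d : CondData.{u}} {δ : Ordinal.{u}}
    (hc : IsCond lam ξ Sstar B g c) (hd : IsCond lam ξ Sstar B g d)
    (hdU : d.U ⊆ Iio δ) (hdV : d.V ⊆ Iio δ) (hle : (c.restrict δ).LE d)
    (τ : Ordinal.{u} → Ordinal.{u}) (hτ : ∀ β ∈ c.V ∪ d.V, τ β < β) :
    ∃ e : CondData.{u}, IsCond lam ξ Sstar B g e ∧ c.LE e ∧ d.LE e ∧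
      ∀ β ∈ c.V ∪ d.V, ∃ γ ∈ e.E β, τ β < γ :=
  hc.exists_merge hlam hB hd (fun α hα hα' => hle.H_eq α ⟨hα, hdU hα'⟩)
    (fun β hβ hβ' => hle.E_ext β ⟨hβ, hdV hβ'⟩) τ hτ

/-! ### Least upper bounds -/

/-- The bound is the union of the chain, with the supremum of each nonempty union of clubs added to
it; closedness of `B β` puts that point into the ladder. The last three conjuncts say that nothing
else is added: every new point of a club lies above all its earlier points and is a limit of them.
This minimality is what allows amalgamation with a candidate at limit stages of the game. -/
theorem exists_upperBound (hlam : lam.IsRegular) (hB : IsColouredLadderSystem lam ξ Sstar B g)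
    {j : Ordinal.{u}} (hjlam : j < lam.ord)
    {c : Ordinal.{u} → CondData.{u}} (hc : ∀ i < j, IsCond lam ξ Sstar B g (c i))
    (hmono : ∀ i k, i < k → k < j → (c i).LE (c k)) :
    ∃ q : CondData.{u}, IsCond lam ξ Sstar B g q ∧ (∀ i < j, (c i).LE q) ∧
      (∀ β ∈ q.V, ∃ i < j, β ∈ (c i).V) ∧
      (∀ α ∈ q.U, (∃ i < j, α ∈ (c i).U) ∨ ∃ β ∈ q.V, α ∈ q.E β) ∧
      ∀ β ∈ q.V, ∀ α ∈ q.E β, (∃ i < j, β ∈ (c i).V ∧ α ∈ (c i).E β) ∨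
        (∀ i < j, β ∈ (c i).V → ∀ ε ∈ (c i).E β, ε < α) ∧
        (∃ i < j, β ∈ (c i).V ∧ ((c i).E β).Nonempty) ∧
        ∀ γ < α, ∃ i < j, β ∈ (c i).V ∧ ∃ ε ∈ (c i).E β, γ < ε := by
  have hmono' : ∀ i k, i ≤ k → k < j → (c i).LE (c k) := by
    intro i k hik hk
    rcases hik.eq_or_lt with rfl | h
    · exact CondData.LE.refl _
    · exact hmono i k h hk
  let U₀ : Set Ordinal.{u} := ⋃ i : Iio j, (c i).U
  let V₀ : Set Ordinal.{u} := ⋃ i : Iio j, (c i).V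
  let E₀ : Ordinal.{u} → Set Ordinal.{u} := fun β => {α | ∃ i < j, β ∈ (c i).V ∧ α ∈ (c i).E β}
  let s : Ordinal.{u} → Ordinal.{u} := fun β => sSup (E₀ β)
  have hU₀ : ∀ α, α ∈ U₀ ↔ ∃ i < j, α ∈ (c i).U := by
    intro α
    simp [U₀]
  have hV₀ : ∀ β, β ∈ V₀ ↔ ∃ i < j, β ∈ (c i).V := by
    intro α
    simp [V₀]
  have hreg : (lift.{u + 1} lam).IsRegular := hlam.lift
  have hIio : #(Iio j) < lift.{u + 1} lam := by
    rw [Cardinal.mk_Iio_ordinal, Cardinal.lift_lt]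
    exact Cardinal.lt_ord.1 hjlam
  have hU₀card : #U₀ < lift.{u + 1} lam :=
    (Cardinal.card_iUnion_lt_iff_forall_of_isRegular hreg hIio).2 fun i => (hc i i.2).U_card
  have hV₀card : #V₀ < lift.{u + 1} lam :=
    (Cardinal.card_iUnion_lt_iff_forall_of_isRegular hreg hIio).2 fun i => (hc i i.2).V_card
  have hVS : ∀ β ∈ V₀, β ∈ Sstar := by
    intro β hβ
    obtain ⟨i, hi, h⟩ := (hV₀ β).1 hβ
    exact (hc i hi).V_mem β h
  have hE₀U : ∀ β, E₀ β ⊆ U₀ := by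
    rintro β α ⟨i, hi, hβ, hα⟩
    exact (hU₀ α).2 ⟨i, hi, (hc i hi).E_sub_U β hβ hα⟩
  have hE₀B : ∀ β, E₀ β ⊆ B β := by
    rintro β α ⟨i, hi, hβ, hα⟩
    exact (hc i hi).E_sub_B β hβ hα
  have hE₀lt : ∀ β, ∀ α ∈ E₀ β, α < β := by
    rintro β α ⟨i, hi, hβ, hα⟩
    exact (hc i hi).E_lt_self hB hβ α hα
  have hbdd : ∀ β, BddAbove (E₀ β) := fun β => bddAbove_of_forall_lt (hE₀lt β)
  have hslt : ∀ β ∈ V₀, s β < β := fun β hβ => sSup_lt_of_card_lt (hB.cof_eq β (hVS β hβ))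
    ((Cardinal.mk_le_mk_of_subset (hE₀U β)).trans_lt hU₀card) (hE₀lt β)
  have hle_s : ∀ β, ∀ α ∈ E₀ β, α ≤ s β := fun β α hα => le_csSup (hbdd β) hα
  have hs_i : ∀ i < j, ∀ β ∈ (c i).V, sSup ((c i).E β) ≤ s β := by
    intro i hi β hβ
    rcases eq_empty_or_nonempty ((c i).E β) with h | h
    · simp [h]
    · exact csSup_le_csSup (hbdd β) h fun α hα => ⟨i, hi, hβ, hα⟩
  have hVs : ∀ β₁ ∈ V₀, ∀ β₂ ∈ V₀, β₁ < β₂ → β₁ < s β₂ ∧ sSup (B β₂ ∩ Iio β₁) < s β₁ := by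
    intro β₁ h₁ β₂ h₂ hlt
    obtain ⟨i, hi, hi₁⟩ := (hV₀ _).1 h₁
    obtain ⟨k, hk, hk₂⟩ := (hV₀ _).1 h₂
    have hm := max_lt hi hk
    have h₁' := (hmono' i _ (le_max_left i k) hm).V_sub hi₁
    have h₂' := (hmono' k _ (le_max_right i k) hm).V_sub hk₂
    have := (hc _ hm).E_separated β₁ h₁' β₂ h₂' hlt
    exact ⟨this.1.trans_le (hs_i _ hm β₂ h₂'), this.2.trans_le (hs_i _ hm β₁ h₁')⟩
  have hUs : ∀ β ∈ V₀, ∀ α ∈ U₀, α < β → α ≤ s β := by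
    intro β hβ α hα hlt
    obtain ⟨i, hi, hiβ⟩ := (hV₀ _).1 hβ
    obtain ⟨k, hk, hkα⟩ := (hU₀ _).1 hα
    have hm := max_lt hi hk
    have hβ' := (hmono' i _ (le_max_left i k) hm).V_sub hiβ
    have hα' := (hmono' k _ (le_max_right i k) hm).U_sub hkα
    refine le_trans ?_ (hs_i _ hm β hβ')
    rw [(hc _ hm).E_sup β hβ']
    exact le_csSup (bddAbove_of_forall_lt (β := β) fun _ h => h.2) ⟨hα', hlt⟩
  -- If the supremum already occurs in some `u`, then at a common stage the clause `sup e_β = sup (u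
  -- ∩ β)` makes it the supremum of a closed nonempty `e_β`, so it is an old point of the club. Its
  -- colour is then already correct.
  have hsE₀ : ∀ β ∈ V₀, (E₀ β).Nonempty → s β ∈ U₀ → s β ∈ E₀ β := by
    rintro β hβ ⟨ε, i, hi, hiβ, hε⟩ hα
    obtain ⟨k, hk, hkα⟩ := (hU₀ _).1 hα
    have hm := max_lt hi hk
    have hle := hmono' i _ (le_max_left i k) hm
    have hβ' := hle.V_sub hiβ
    have hα' := (hmono' k _ (le_max_right i k) hm).U_sub hkα
    have hε' := (hle.E_ext β hiβ).1 hε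
    refine ⟨_, hm, hβ', ?_⟩
    have : s β = sSup ((c (max i k)).E β) := by
      refine le_antisymm ?_ (hs_i _ hm β hβ')
      rw [(hc _ hm).E_sup β hβ']
      exact le_csSup (bddAbove_of_forall_lt (β := β) fun _ h => h.2) ⟨hα', hslt β hβ⟩
    rw [this]
    exact ((hc _ hm).E_closed β hβ').csSup_mem ⟨ε, hε'⟩
      (bddAbove_of_forall_lt ((hc _ hm).E_lt_self hB hβ'))
  have hsinj : ∀ β₁ ∈ V₀, ∀ β₂ ∈ V₀, s β₁ = s β₂ → β₁ = β₂ := by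
    have key : ∀ β₁ ∈ V₀, ∀ β₂ ∈ V₀, β₁ < β₂ → s β₁ < s β₂ := fun β₁ h₁ β₂ h₂ hlt =>
      (hslt β₁ h₁).trans (hVs β₁ h₁ β₂ h₂ hlt).1
    intro β₁ h₁ β₂ h₂ h
    rcases lt_trichotomy β₁ β₂ with hlt | rfl | hlt
    · exact absurd h (key _ h₁ _ h₂ hlt).ne
    · rfl
    · exact absurd h (key _ h₂ _ h₁ hlt).ne'
  let V₁ : Set Ordinal.{u} := {β ∈ V₀ | (E₀ β).Nonempty}
  have hH₀ : ∀ α ∈ U₀, ∃ y, ∀ i < j, α ∈ (c i).U → (c i).H α = y := by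
    intro α hα
    obtain ⟨k, hk, hkα⟩ := (hU₀ _).1 hα
    refine ⟨(c k).H α, fun i hi hiα => ?_⟩
    rcases le_total i k with h | h
    · exact (hmono' i k h hk).H_eq α hiα
    · exact ((hmono' k i h hi).H_eq α hkα).symm
  choose! H₀ hH₀ using hH₀
  classical
  let H : Ordinal.{u} → Ordinal.{u} := fun α => if α ∈ U₀ then H₀ α else
    if h : ∃ β ∈ V₁, s β = α then g h.choose α else 0
  have hHi : ∀ i < j, ∀ α ∈ (c i).U, (c i).H α = H α := by
    intro i hi α hα
    have hα₀ : α ∈ U₀ := (hU₀ α).2 ⟨i, hi, hα⟩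
    exact (hH₀ α hα₀ i hi hα).trans (if_pos hα₀).symm
  have hHE : ∀ β, ∀ α ∈ E₀ β, H α = g β α := by
    rintro β α ⟨i, hi, hβ, hα⟩
    rw [← hHi i hi α ((hc i hi).E_sub_U β hβ hα)]
    exact (hc i hi).H_agrees β hβ α hα
  have hHs : ∀ β ∈ V₁, H (s β) = g β (s β) := by
    intro β hβ
    by_cases h : s β ∈ U₀
    · exact hHE β _ (hsE₀ β hβ.1 hβ.2 h)
    · have h' : ∃ β' ∈ V₁, s β' = s β := ⟨β, hβ, rfl⟩
      simp only [H, if_neg h, dif_pos h']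
      rw [hsinj _ h'.choose_spec.1.1 β hβ.1 h'.choose_spec.2]
  -- If all the clubs at `β` are empty, nothing is added: the default supremum `0` need not belong
  -- to `B β`.
  let E : Ordinal.{u} → Set Ordinal.{u} := fun β => E₀ β ∪ {α | (E₀ β).Nonempty ∧ α = s β}
  have hEs : ∀ β, sSup (E β) = s β := by
    intro β
    rcases eq_empty_or_nonempty (E₀ β) with h | h
    · simp [E, s, h]
    · refine IsGreatest.csSup_eq ⟨Or.inr ⟨h, rfl⟩, ?_⟩
      rintro α (hα | ⟨-, rfl⟩)
      · exact hle_s β α hα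
      · exact le_rfl
  have hE_le : ∀ β, ∀ α ∈ E β, α ≤ s β := by
    rintro β α (hα | ⟨-, rfl⟩)
    · exact hle_s β α hα
    · exact le_rfl
  have hlam' := (IsRegular.lift.{u + 1} hlam).aleph0_le
  have hend : ∀ i < j, ∀ β ∈ (c i).V, ∀ α ∈ E₀ β, α ∉ (c i).E β → ∀ γ ∈ (c i).E β, γ < α := by
    rintro i hi β hβ α ⟨k, hk, hkβ, hkα⟩ hα γ hγ
    rcases le_total i k with h | h
    · exact ((hmono' i k h hk).E_ext β hβ).2 α hkα hα γ hγ
    · exact absurd (((hmono' k i h hi).E_ext β hkβ).1 hkα) hα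
  refine ⟨⟨U₀ ∪ s '' V₁, V₀, E, H⟩, ⟨⟨?_, ?_, hVS, hV₀card, ?_, ?_, ?_, ?_, ?_⟩, ?_, ?_⟩,
    fun i hi => ⟨?_, hHi i hi, ?_, ?_⟩, fun β hβ => (hV₀ β).1 hβ, ?_, ?_⟩
  · rintro α (hα | ⟨β, hβ, rfl⟩)
    · obtain ⟨i, hi, h⟩ := (hU₀ α).1 hα
      exact (hc i hi).U_lt α h
    · exact (hslt β hβ.1).trans (hB.below β (hVS β hβ.1))
  · exact (Cardinal.mk_union_le _ _).trans_lt (Cardinal.add_lt_of_lt hlam' hU₀card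
      (Cardinal.mk_image_le.trans_lt
        ((Cardinal.mk_le_mk_of_subset fun _ h => h.1).trans_lt hV₀card)))
  · rintro β hβ α (hα | ⟨hne, rfl⟩)
    · exact Or.inl (hE₀U β hα)
    · exact Or.inr ⟨β, ⟨hβ, hne⟩, rfl⟩
  · rintro β hβ α (hα | ⟨hne, rfl⟩)
    · exact hE₀B β hα
    · exact hB.sSup_mem (hVS β hβ) (hE₀B β) hne (hslt β hβ)
  · intro β hβ
    rw [Ordinal.isClosed_iff_iSup]
    intro ι _ f hf
    -- A supremum of members of `E β` that is not `s β` lies below a point of the club of one stage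
    -- `k`. By end-extension all those members belong to that club, which is closed.
    by_cases hsf : ⨆ i, f i = s β
    · rw [hsf]
      obtain ⟨i₀⟩ := ‹Nonempty ι›
      refine Or.inr ⟨?_, rfl⟩
      rcases hf i₀ with h | h
      · exact ⟨_, h⟩
      · exact h.1
    · have hlt : ⨆ i, f i < s β := lt_of_le_of_ne (ciSup_le fun i => hE_le β _ (hf i)) hsf
      have hfE : ∀ i, f i ∈ E₀ β := by
        intro i
        refine (hf i).resolve_right fun h => ?_
        exact ((Ordinal.le_iSup f i).trans_lt hlt).ne h.2
      obtain ⟨ε, ⟨k, hk, hkβ, hε⟩, hltε⟩ := exists_lt_of_lt_csSup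
        (let ⟨i₀⟩ := ‹Nonempty ι›; ⟨_, hfE i₀⟩) hlt
      refine Or.inl ⟨k, hk, hkβ, ?_⟩
      refine Ordinal.isClosed_iff_iSup.1 ((hc k hk).E_closed β hkβ) inferInstance f fun i => ?_
      by_contra hi
      exact (((hend k hk β hkβ _ (hfE i) hi ε hε).trans_le (Ordinal.le_iSup f i)).trans
        hltε).false
  · rintro α (hα | ⟨β, hβ, rfl⟩)
    · obtain ⟨i, hi, h⟩ := (hU₀ α).1 hα
      exact (hHi i hi α h).symm.trans_lt ((hc i hi).H_lt α h)
    · exact (hHs β hβ).trans_lt (hB.values β (hVS β hβ.1) _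
        (hB.sSup_mem (hVS β hβ.1) (hE₀B β) hβ.2 (hslt β hβ.1)))
  · rintro β hβ α (hα | ⟨hne, rfl⟩)
    · exact hHE β α hα
    · exact hHs β ⟨hβ, hne⟩
  · intro β hβ
    dsimp only at hβ ⊢
    refine le_antisymm ?_ ?_
    · rcases eq_empty_or_nonempty (E₀ β) with h | h
      · simp [E, h]
      · rw [hEs]
        exact le_csSup (bddAbove_of_forall_lt (β := β) fun _ h => h.2)
          ⟨Or.inr ⟨β, ⟨hβ, h⟩, rfl⟩, hslt β hβ⟩
    · rw [hEs]
      refine csSup_le' ?_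
      rintro α ⟨hα | ⟨β', hβ', rfl⟩, hlt⟩
      · exact hUs β hβ α hα hlt
      · rcases lt_trichotomy β' β with h | rfl | h
        · exact ((hslt β' hβ'.1).trans (hVs β' hβ'.1 β hβ h).1).le
        · exact le_rfl
        · exact absurd hlt (hVs β hβ β' hβ'.1 h).1.not_gt
  · intro β₁ h₁ β₂ h₂ hlt
    dsimp only at h₁ h₂ ⊢
    rw [hEs, hEs]
    exact hVs β₁ h₁ β₂ h₂ hlt
  · exact fun α hα => Or.inl ((hU₀ α).2 ⟨i, hi, hα⟩)
  · exact fun β hβ => (hV₀ β).2 ⟨i, hi, hβ⟩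
  · intro β hβ
    refine ⟨fun α hα => Or.inl ⟨i, hi, hβ, hα⟩, ?_⟩
    rintro α (hα | ⟨hne, rfl⟩) hα' γ hγ
    · exact hend i hi β hβ α hα hα' γ hγ
    · exact lt_of_le_of_ne (hle_s β γ ⟨i, hi, hβ, hγ⟩) fun h => hα' (h ▸ hγ)
  · rintro α (hα | ⟨β, hβ, rfl⟩)
    · exact Or.inl ((hU₀ α).1 hα)
    · exact Or.inr ⟨β, hβ.1, Or.inr ⟨hβ.2, rfl⟩⟩
  · rintro β hβ α hα
    by_cases h : α ∈ E₀ β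
    · exact Or.inl h
    · obtain ⟨hne, rfl⟩ := hα.resolve_left h
      refine Or.inr ⟨fun i hi hiβ ε hε => ?_, ?_, fun γ hγ => ?_⟩
      · exact lt_of_le_of_ne (hle_s β ε ⟨i, hi, hiβ, hε⟩) fun h' => h (h' ▸ ⟨i, hi, hiβ, hε⟩)
      · obtain ⟨ε, i, hi, hiβ, hε⟩ := hne
        exact ⟨i, hi, hiβ, ε, hε⟩
      · obtain ⟨ε, ⟨i, hi, hiβ, hε⟩, hlt⟩ := exists_lt_of_lt_csSup hne hγ
        exact ⟨i, hi, hiβ, ε, hε, hlt⟩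

end

/-! ### Counting conditions -/

/-- The set of subsets of `x` of cardinality less than `lam`. -/
noncomputable def smallSubsets (lam : Cardinal.{u}) (x : ZFSet.{u}) : ZFSet.{u} :=
  x.powerset.sep fun y => y.card < lam

theorem mem_smallSubsets {lam : Cardinal.{u}} {x y : ZFSet.{u}} :
    y ∈ smallSubsets lam x ↔ y ⊆ x ∧ y.card < lam := by
  rw [smallSubsets, ZFSet.mem_sep, ZFSet.mem_powerset]

/-- This is `λ^{<λ} = λ` for inaccessible `λ`, transferred from a type of cardinality `λ` along an
injection. -/
theorem card_smallSubsets_le {lam : Cardinal.{u}} (hlam : lam.IsInaccessible) {x : ZFSet.{u}}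
    (hx : x.card ≤ lam) : (smallSubsets lam x).card ≤ lam := by
  induction lam using Cardinal.inductionOn with
  | mk α =>
  have hx' : Cardinal.lift.{u} #x ≤ Cardinal.lift.{u + 1} #α := by
    rw [ZFSet.cardinalMk_coe_sort, Cardinal.lift_id'.{u, u + 1}, Cardinal.lift_le]
    exact hx
  obtain ⟨f⟩ := Cardinal.lift_mk_le'.1 hx'
  have hcof : Ordinal.cof (#α).ord = #α := hlam.isRegular.cof_ord
  have hsmall := Cardinal.mk_subset_mk_lt_cof hlam.isStrongPrelimit
  have key : Cardinal.lift.{u} #(smallSubsets #α x) ≤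
      Cardinal.lift.{u + 1} #{s : Set α // #s < Ordinal.cof (#α).ord} := by
    refine Cardinal.lift_mk_le'.2 ⟨⟨fun y => ⟨f '' {t : x | t.1 ∈ y.1}, ?_⟩, ?_⟩⟩
    · rw [hcof]
      have hy := mem_smallSubsets.1 y.2
      rw [← Cardinal.lift_lt.{u, u + 1}]
      have h₁ := Cardinal.mk_image_le_lift (f := f) (s := {t : x | t.1 ∈ y.1})
      have h₂ : #{t : x | t.1 ∈ y.1} ≤ #y.1 :=
        Cardinal.mk_le_of_injective (f := fun t => (⟨t.1.1, t.2⟩ : y.1))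
          fun t t' h => Subtype.ext (Subtype.ext (Subtype.mk.inj h))
      rw [Cardinal.lift_id'.{u, u + 1}] at h₁
      refine (h₁.trans h₂).trans_lt ?_
      rw [ZFSet.cardinalMk_coe_sort, Cardinal.lift_lt]
      exact hy.2
    · intro y y' h
      have h' := f.injective.image_injective (Subtype.mk.inj h)
      have hy := (mem_smallSubsets.1 y.2).1
      have hy' := (mem_smallSubsets.1 y'.2).1
      refine Subtype.ext (ZFSet.ext fun z => ⟨fun hz => ?_, fun hz => ?_⟩)
      · exact (Set.ext_iff.1 h' ⟨z, hy hz⟩).1 hz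
      · exact (Set.ext_iff.1 h' ⟨z, hy' hz⟩).2 hz
  rw [hsmall, ZFSet.cardinalMk_coe_sort, Cardinal.lift_id'.{u, u + 1}, Cardinal.lift_le] at key
  exact key

section
variable {lam : Cardinal.{u}} {ξ : Ordinal.{u}} {Sstar : Set Ordinal.{u}}
  {B : Ordinal.{u} → Set Ordinal.{u}} {g : Ordinal.{u} → Ordinal.{u} → Ordinal.{u}}

/-- All the ordinals in `u ∪ v` are below `γ`. -/
def CondData.Below (c : CondData.{u}) (γ : Ordinal.{u}) : Prop :=
  c.U ⊆ Iio γ ∧ c.V ⊆ Iio γ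

theorem CondData.LE.below {c d : CondData.{u}} (h : c.LE d) {γ : Ordinal.{u}} (hd : d.Below γ) :
    c.Below γ :=
  ⟨h.U_sub.trans hd.1, h.V_sub.trans hd.2⟩

/-- The set of conditions below `γ`. -/
noncomputable def conditionsBelow (lam : Cardinal.{u}) (ξ : Ordinal.{u}) (Sstar : Set Ordinal.{u})
    (B : Ordinal.{u} → Set Ordinal.{u}) (g : Ordinal.{u} → Ordinal.{u} → Ordinal.{u})
    (γ : Ordinal.{u}) : ZFSet.{u} :=
  (conditions lam ξ Sstar B g).sep fun p => (decode lam ξ Sstar B g p).Below γ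

theorem card_ofOrds_lt {U : Set Ordinal.{u}} (hU : ∀ α ∈ U, α < (Order.succ lam).ord)
    (h : #U < lift.{u + 1} lam) : (ofOrds lam U).card < lam := by
  rwa [← Cardinal.lift_lt.{u, u + 1}, lift_card_ofOrds hU]

theorem IsPrecond.card_eSet_lt (hB : IsColouredLadderSystem lam ξ Sstar B g) {c : CondData.{u}}
    (hc : IsPrecond lam ξ Sstar B g c) : (c.eSet lam).card < lam := by
  refine (card_le_of_surjOn (x := ofOrds lam c.V)
    (fun z => ZFSet.pair z (ofOrds lam (c.E z.rank))) fun z hz => ?_).trans_lt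
    (card_ofOrds_lt (hc.V_lt hB) hc.V_card)
  obtain ⟨β, hβ, rfl⟩ := (ZFSet.mem_sep.1 hz).2
  exact ⟨β.toZFSet, (toZFSet_mem_ofOrds (hc.V_lt hB)).2 hβ, by simp⟩

theorem IsPrecond.card_hSet_lt {c : CondData.{u}} (hc : IsPrecond lam ξ Sstar B g c) :
    (c.hSet lam).card < lam := by
  refine (card_le_of_surjOn (x := ofOrds lam c.U)
    (fun z => ZFSet.pair z (c.H z.rank).toZFSet) fun z hz => ?_).trans_lt
    (card_ofOrds_lt hc.U_lt hc.U_card)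
  obtain ⟨α, hα, rfl⟩ := (ZFSet.mem_sep.1 hz).2
  exact ⟨α.toZFSet, (toZFSet_mem_ofOrds hc.U_lt).2 hα, by simp⟩

/-- Each component of a condition below `γ` is a subset, of size less than `λ`, of a set of size at
most `λ`. -/
theorem card_conditionsBelow_le (hlam : lam.IsInaccessible)
    (hB : IsColouredLadderSystem lam ξ Sstar B g) {γ : Ordinal.{u}}
    (hγ : γ < (Order.succ lam).ord) : (conditionsBelow lam ξ Sstar B g γ).card ≤ lam := by
  have hγ' : γ.toZFSet.card ≤ lam := by
    rw [Ordinal.card_toZFSet]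
    exact Order.lt_succ_iff.1 (Cardinal.lt_ord.1 hγ)
  have hξ' : ξ.toZFSet.card ≤ lam := by
    rw [Ordinal.card_toZFSet]
    exact (Cardinal.lt_ord.1 hB.colours).le
  have hω := hlam.aleph0_lt.le
  have hS := card_smallSubsets_le hlam hγ'
  have hT := card_smallSubsets_le hlam (card_prod_le hω hγ' hS)
  have hH := card_smallSubsets_le hlam (card_prod_le hω hγ' hξ')
  refine (ZFSet.card_mono fun p hp => ?_).trans
    (card_prod_le hω hS (card_prod_le hω hS (card_prod_le hω hT hH)))
  obtain ⟨hp, hpγ⟩ := ZFSet.mem_sep.1 hp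
  obtain ⟨hc, hcp⟩ := decode_spec hB hp
  set c := decode lam ξ Sstar B g p
  have hc := hc.toIsPrecond
  rw [← hcp, CondData.encode, quadruple]
  have hsub : ∀ X : Set Ordinal.{u}, (∀ α ∈ X, α < (Order.succ lam).ord) → X ⊆ Iio γ →
      #X < lift.{u + 1} lam → ofOrds lam X ∈ smallSubsets lam γ.toZFSet := by
    intro X hX hXγ hXc
    refine mem_smallSubsets.2 ⟨fun x hx => ?_, card_ofOrds_lt hX hXc⟩
    obtain ⟨α, hα, rfl⟩ := (mem_ofOrds hX).1 hx
    exact Ordinal.toZFSet_mem_toZFSet_iff.2 (hXγ hα)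
  refine ZFSet.pair_mem_prod.2 ⟨hsub _ hc.U_lt hpγ.1 hc.U_card, ZFSet.pair_mem_prod.2
    ⟨hsub _ (hc.V_lt hB) hpγ.2 hc.V_card, ZFSet.pair_mem_prod.2 ⟨mem_smallSubsets.2
    ⟨fun z hz => ?_, hc.card_eSet_lt hB⟩, mem_smallSubsets.2 ⟨fun z hz => ?_, hc.card_hSet_lt⟩⟩⟩⟩
  · obtain ⟨β, hβ, rfl⟩ := (ZFSet.mem_sep.1 hz).2
    exact ZFSet.pair_mem_prod.2 ⟨Ordinal.toZFSet_mem_toZFSet_iff.2 (hpγ.2 hβ),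
      hsub _ (hc.E_lt hβ) ((hc.E_sub_U β hβ).trans hpγ.1) (hc.E_card hβ)⟩
  · obtain ⟨α, hα, rfl⟩ := (ZFSet.mem_sep.1 hz).2
    exact ZFSet.pair_mem_prod.2 ⟨Ordinal.toZFSet_mem_toZFSet_iff.2 (hpγ.1 hα),
      Ordinal.toZFSet_mem_toZFSet_iff.2 (hc.H_lt α hα)⟩

theorem cof_succ_ord (hω : ℵ₀ ≤ lam) : (Order.succ lam).ord.cof = Order.succ lam :=
  (Cardinal.isRegular_succ hω).cof_ord

/-- By regularity of `λ⁺`, fewer than `λ` ordinals below `λ⁺` are bounded there. -/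
theorem IsPrecond.exists_below (hω : ℵ₀ ≤ lam) (hB : IsColouredLadderSystem lam ξ Sstar B g)
    {c : CondData.{u}} (hc : IsPrecond lam ξ Sstar B g c) :
    ∃ γ < (Order.succ lam).ord, c.Below γ := by
  have hlt : lift.{u + 1} lam < lift.{u + 1} (Order.succ lam) :=
    Cardinal.lift_lt.2 (Order.lt_succ lam)
  have h₁ := sSup_lt_of_card_lt (cof_succ_ord hω) (hc.U_card.trans hlt) hc.U_lt
  have h₂ := sSup_lt_of_card_lt (cof_succ_ord hω) (hc.V_card.trans hlt) (hc.V_lt hB)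
  have hlim : Order.IsSuccLimit (Order.succ lam).ord :=
    Cardinal.isSuccLimit_ord (hω.trans (Order.le_succ lam))
  refine ⟨_, hlim.succ_lt (max_lt h₁ h₂), fun α hα => ?_, fun α hα => ?_⟩
  · exact Order.lt_succ_iff.2 ((le_csSup (bddAbove_of_forall_lt hc.U_lt) hα).trans
      (le_max_left _ _))
  · exact Order.lt_succ_iff.2 ((le_csSup (bddAbove_of_forall_lt (hc.V_lt hB)) hα).trans
      (le_max_right _ _))

/-- Every condition is below some `γ < λ⁺`, so the forcing is a union of `λ⁺` sets of size at most
`λ`. -/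
theorem card_conditions_le (hlam : lam.IsInaccessible)
    (hB : IsColouredLadderSystem lam ξ Sstar B g) :
    (conditions lam ξ Sstar B g).card ≤ Order.succ lam := by
  have hsub : conditions lam ξ Sstar B g ⊆ ZFSet.iUnion
      fun γ : Shrink.{u} (Iio (Order.succ lam).ord) =>
        conditionsBelow lam ξ Sstar B g ((equivShrink _).symm γ).1 := by
    intro p hp
    obtain ⟨γ, hγ, h⟩ := (decode_spec hB hp).1.exists_below hlam.aleph0_lt.le hB
    refine ZFSet.mem_iUnion.2 ⟨equivShrink _ ⟨γ, hγ⟩, ZFSet.mem_sep.2 ⟨hp, ?_⟩⟩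
    simpa using h
  refine (ZFSet.card_mono hsub).trans ?_
  have h := ZFSet.lift_card_iUnion_le_sum_card
    (f := fun γ : Shrink.{u} (Iio (Order.succ lam).ord) =>
        conditionsBelow lam ξ Sstar B g ((equivShrink _).symm γ).1)
  rw [Cardinal.lift_id] at h
  refine h.trans ((Cardinal.sum_le_sum _ (fun _ => lam) fun γ => card_conditionsBelow_le hlam hB
    ((equivShrink _).symm γ).2).trans ?_)
  rw [Cardinal.sum_const, Cardinal.lift_id, Cardinal.lift_id]
  have hS : #(Shrink.{u} (Iio (Order.succ lam).ord)) = Order.succ lam := by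
    rw [← Cardinal.lift_inj.{u, u + 1}, Cardinal.lift_mk_shrink'', Cardinal.mk_Iio_ordinal,
      Cardinal.card_ord]
  rw [hS]
  exact (mul_le_mul' le_rfl (Order.le_succ lam)).trans (Cardinal.mul_eq_self
    (hlam.aleph0_lt.le.trans (Order.le_succ lam))).le

/-! ### Conditions belong to `H(χ)` -/

theorem inH_succ_ord {χ : Cardinal.{u}} (hχ : Order.succ lam < χ) :
    InH χ (Order.succ lam).ord.toZFSet :=
  inH_toZFSet (by rwa [Cardinal.card_ord])

theorem IsPrecond.inH_encode {χ : Cardinal.{u}} (hω : ℵ₀ ≤ χ) (hχ : Order.succ lam < χ)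
    (hB : IsColouredLadderSystem lam ξ Sstar B g) {c : CondData.{u}}
    (hc : IsPrecond lam ξ Sstar B g c) : InH χ (c.encode lam) := by
  have hL := inH_succ_ord hχ
  have hlt : lam < χ := (Order.lt_succ lam).trans hχ
  have hsub : ∀ U, InH χ (ofOrds lam U) := fun U => hL.subset (ofOrds_subset lam U)
  have hord : ∀ α < (Order.succ lam).ord, InH χ α.toZFSet := fun α hα =>
    hL.mem (Ordinal.toZFSet_mem_toZFSet_iff.2 hα)
  refine (hsub _).pair hω ((hsub _).pair hω (InH.pair hω (inH_iff.2
    ⟨(hc.card_eSet_lt hB).trans hlt, fun z hz => ?_⟩) (inH_iff.2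
    ⟨hc.card_hSet_lt.trans hlt, fun z hz => ?_⟩)))
  · obtain ⟨β, hβ, rfl⟩ := (ZFSet.mem_sep.1 hz).2
    exact (hord β (hc.V_lt hB β hβ)).pair hω (hsub _)
  · obtain ⟨α, hα, rfl⟩ := (ZFSet.mem_sep.1 hz).2
    exact (hord α (hc.U_lt α hα)).pair hω (hord _ (hB.colour_lt (hc.H_lt α hα)))

theorem inH_conditions {χ : Cardinal.{u}} (hlam : lam.IsInaccessible) (hχ : Order.succ lam < χ)
    (hB : IsColouredLadderSystem lam ξ Sstar B g) : InH χ (conditions lam ξ Sstar B g) := by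
  have hω : ℵ₀ ≤ χ := hlam.aleph0_lt.le.trans ((Order.le_succ lam).trans hχ.le)
  refine inH_iff.2 ⟨(card_conditions_le hlam hB).trans_lt hχ, fun p hp => ?_⟩
  obtain ⟨hc, hcp⟩ := decode_spec hB hp
  rw [← hcp]
  exact hc.inH_encode hω hχ hB

theorem uniformForcing_order_subset : (uniformForcing lam ξ Sstar B g).order ⊆
    ZFSet.prod (conditions lam ξ Sstar B g) (conditions lam ξ Sstar B g) := by
  simp only [uniformForcing]
  exact ZFSet.sep_subset

theorem inH_code {χ : Cardinal.{u}} (hlam : lam.IsInaccessible) (hχ : Order.succ lam < χ)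
    (hB : IsColouredLadderSystem lam ξ Sstar B g) :
    InH χ (uniformForcing lam ξ Sstar B g).code := by
  have hω' : ℵ₀ ≤ Order.succ lam := hlam.aleph0_lt.le.trans (Order.le_succ lam)
  have hω : ℵ₀ ≤ χ := hω'.trans hχ.le
  have h := inH_conditions hlam hχ hB
  have hcard := card_conditions_le hlam hB
  exact h.pair hω ((InH.prod hω hω' hχ h h hcard hcard).subset uniformForcing_order_subset)

/-! ### The forcing notion -/

theorem isCond_empty (hlam : lam.IsRegular) :
    IsCond lam ξ Sstar B g ⟨∅, ∅, fun _ => ∅, fun _ => 0⟩ := by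
  have h : #(∅ : Set Ordinal.{u}) < lift.{u + 1} lam := by
    rw [Cardinal.mk_eq_zero, ← Cardinal.lift_zero.{u, u + 1}, Cardinal.lift_lt]
    exact hlam.pos
  refine ⟨⟨?_, h, ?_, h, ?_, ?_, ?_, ?_, ?_⟩, ?_, ?_⟩ <;> simp

/-- Values of `E` off `V` and of `H` off `U` do not enter the set; this gives uniqueness of the
weakest condition. -/
theorem CondData.encode_congr {c d : CondData.{u}} (hU : c.U = d.U) (hV : c.V = d.V)
    (hE : ∀ β ∈ c.V, c.E β = d.E β) (hH : ∀ α ∈ c.U, c.H α = d.H α) :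
    c.encode lam = d.encode lam := by
  rw [CondData.encode, CondData.encode, quadruple_inj, hU, hV]
  refine ⟨rfl, rfl, ?_, ?_⟩
  · ext z
    simp only [CondData.eSet, ZFSet.mem_sep, ← hV]
    exact and_congr_right fun _ => exists_congr fun β => and_congr_right fun hβ => by rw [hE β hβ]
  · ext z
    simp only [CondData.hSet, ZFSet.mem_sep, ← hU]
    exact and_congr_right fun _ => exists_congr fun α => and_congr_right fun hα => by rw [hH α hα]

theorem uniformForcing_isForcingNotion (hlam : lam.IsRegular)
    (hB : IsColouredLadderSystem lam ξ Sstar B g) :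
    (uniformForcing lam ξ Sstar B g).IsForcingNotion where
  order_subset := uniformForcing_order_subset
  refl p hp := (le_iff_decode hB hp hp).2 (CondData.LE.refl _)
  trans p q r hpq hqr := by
    obtain ⟨hp, hq, -⟩ := uniformForcing_le.1 hpq
    obtain ⟨-, hr, -⟩ := uniformForcing_le.1 hqr
    rw [le_iff_decode hB hp hq] at hpq
    rw [le_iff_decode hB hq hr] at hqr
    exact (le_iff_decode hB hp hr).2 (hpq.trans hqr)
  weakest := by
    have h₀ := isCond_empty (ξ := ξ) (Sstar := Sstar) (B := B) (g := g) hlam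
    refine ⟨_, encode_mem_conditions hB h₀, fun p hp => ⟨?_, fun h => ?_⟩⟩
    · rw [encode_le_iff hB hp h₀]
      exact ⟨by simp, by simp, by simp, by simp⟩
    · rw [le_encode_iff hB hp h₀] at h
      obtain ⟨hc, hcp⟩ := decode_spec hB hp
      have hU := subset_empty_iff.1 h.U_sub
      have hV := subset_empty_iff.1 h.V_sub
      rw [← hcp]
      exact CondData.encode_congr hU hV (by simp [hV]) (by simp [hU])

theorem Forcing.Increasing.decode_LE (hB : IsColouredLadderSystem lam ξ Sstar B g)
    {j : Ordinal.{u}} {p : Ordinal.{u} → ZFSet.{u}}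
    (hp : (uniformForcing lam ξ Sstar B g).Increasing j p) (i k : Ordinal.{u}) (hik : i < k)
    (hk : k < j) : (decode lam ξ Sstar B g (p i)).LE (decode lam ξ Sstar B g (p k)) :=
  (le_iff_decode hB (hp.1 i (hik.trans hk)) (hp.1 k hk)).1 (hp.2 i k hik hk)

theorem uniformForcing_isComplete (hlam : lam.IsRegular)
    (hB : IsColouredLadderSystem lam ξ Sstar B g) :
    (uniformForcing lam ξ Sstar B g).IsComplete lam := by
  intro j hj p hp
  obtain ⟨q, hq, hle, -⟩ := exists_upperBound hlam hB hj
    (c := fun i => decode lam ξ Sstar B g (p i)) (fun i hi => (decode_spec hB (hp.1 i hi)).1)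
    (hp.decode_LE hB)
  exact ⟨_, encode_mem_conditions hB hq, fun i hi => (le_encode_iff hB (hp.1 i hi) hq).2 (hle i hi)⟩

end

/-! ### Closure properties of models -/

/-- The function with domain `x` and constant value `∅`. -/
noncomputable def tag (x : ZFSet.{u}) : ZFSet.{u} := ZFSet.prod x {∅}

theorem tag_injective : Function.Injective tag.{u} := by
  intro x y h
  ext z
  have := ZFSet.ext_iff.1 h (ZFSet.pair z ∅)
  simpa [tag] using this

/-- The set of all constant functions with value `∅` and domain an ordinal below `lam`. -/
noncomputable def tagSet (lam : Cardinal.{u}) : ZFSet.{u} :=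
  ZFSet.range fun x : lam.ord.toZFSet => tag x.1

/-- The sequence `⟨f k : k < n⟩` as a set function. -/
noncomputable def tuple {n : ℕ} (f : Fin n → ZFSet.{u}) : ZFSet.{u} :=
  ZFSet.range fun k : Fin n => ZFSet.pair (tag ((k : ℕ) : Ordinal.{u}).toZFSet) (f k)

theorem InH.tag {χ : Cardinal.{u}} (hχ : ℵ₀ ≤ χ) {x : ZFSet.{u}} (hx : InH χ x) :
    InH χ (tag x) := by
  have hω := (natCast_lt_aleph0 (n := 0)).trans_le hχ
  have h₀ : InH χ (∅ : ZFSet.{u}) :=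
    inH_iff.2 ⟨by simpa using hω, fun y hy => absurd hy (ZFSet.notMem_empty y)⟩
  refine inH_iff.2 ⟨?_, fun z hz => ?_⟩
  · rw [Fuzzy.tag, card_prod, ZFSet.card_singleton, mul_one]
    exact (inH_iff.1 hx).1
  · obtain ⟨a, ha, b, hb, rfl⟩ := ZFSet.mem_prod.1 hz
    rw [ZFSet.mem_singleton.1 hb]
    exact (hx.mem ha).pair hχ h₀

theorem card_tagSet (lam : Cardinal.{u}) : lam ≤ (tagSet lam).card := by
  have h := card_le_of_injOn (x := lam.ord.toZFSet) (y := tagSet lam) tag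
    (fun z hz => ZFSet.mem_range.2 ⟨⟨z, hz⟩, rfl⟩) (fun z _ w _ h => tag_injective h)
  simpa using h

theorem inH_tagSet {lam χ : Cardinal.{u}} (hχ : ℵ₀ ≤ χ) (h : lam < χ) : InH χ (tagSet lam) := by
  have hL : InH χ lam.ord.toZFSet := inH_toZFSet (by rwa [Cardinal.card_ord])
  refine inH_iff.2 ⟨(card_range_le _).trans_lt (inH_iff.1 hL).1, fun y hy => ?_⟩
  obtain ⟨x, rfl⟩ := ZFSet.mem_range.1 hy
  exact (hL.mem x.2).tag hχ

theorem inH_tuple {χ : Cardinal.{u}} (hχ : ℵ₀ < χ) {n : ℕ} {f : Fin n → ZFSet.{u}}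
    (hf : ∀ k, InH χ (f k)) : InH χ (tuple f) := by
  refine inH_iff.2 ⟨lt_of_le_of_lt ?_ hχ, fun y hy => ?_⟩
  · have h := ZFSet.lift_card_range_le
      (f := fun k : Fin n => ZFSet.pair (tag ((k : ℕ) : Ordinal.{u}).toZFSet) (f k))
    rw [Cardinal.mk_fin, Cardinal.lift_natCast, Cardinal.lift_id'.{0, u}] at h
    exact h.trans (natCast_lt_aleph0 (n := n)).le
  · obtain ⟨k, rfl⟩ := ZFSet.mem_range.1 hy
    refine InH.pair hχ.le (InH.tag hχ.le (inH_toZFSet ?_)) (hf k)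
    rw [Ordinal.card_nat]
    exact natCast_lt_aleph0.trans hχ

/-! ### Membership in a model -/

section
variable {lam χ : Cardinal.{u}} {wo : HType χ → HType χ → Prop} {N : ZFSet.{u}}

theorem IsModel.apply_mem (hχ : ℵ₀ ≤ χ) (hN : IsModel lam χ wo N) {x a : ZFSet.{u}}
    {f : ZFSet.{u} → ZFSet.{u}} (hf : graph x f ∈ N) (ha : a ∈ x) (haN : a ∈ N) : f a ∈ N := by
  obtain ⟨y, hy, h⟩ := hN.elementary.exists_value hχ hf haN (pair_mem_graph.2 ⟨ha, rfl⟩)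
  rw [← (pair_mem_graph.1 h).2]
  exact hy

/-- Closure under short sequences applies to any domain `i < λ`, without knowing that `i` itself
belongs to `N`. -/
theorem IsModel.graph_mem (hN : IsModel lam χ wo N) {i : Ordinal.{u}} (hi : i < lam.ord)
    {f : ZFSet.{u} → ZFSet.{u}} (hf : ∀ j < i, f j.toZFSet ∈ N) : graph i.toZFSet f ∈ N := by
  refine hN.closed i hi _ ⟨fun z hz => ?_, fun z hz => ⟨f z, pair_mem_graph.2 ⟨hz, rfl⟩,
    fun y hy => (pair_mem_graph.1 hy).2⟩⟩
  obtain ⟨t, rfl⟩ := ZFSet.mem_range.1 hz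
  obtain ⟨j, hj, h⟩ := Ordinal.mem_toZFSet_iff.1 t.2
  rw [← h]
  exact ZFSet.pair_mem_prod.2 ⟨Ordinal.toZFSet_mem_toZFSet_iff.2 hj, hf j hj⟩

theorem IsModel.empty_mem (hlam : 0 < lam) (hN : IsModel lam χ wo N) : ∅ ∈ N := by
  have h : graph (0 : Ordinal.{u}).toZFSet id ∈ N :=
    hN.graph_mem (by simpa using hlam) fun j hj => by simp at hj
  have h₀ : graph (0 : Ordinal.{u}).toZFSet id = ∅ := by
    rw [ZFSet.eq_empty]
    intro y hy
    obtain ⟨t, -⟩ := ZFSet.mem_range.1 hy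
    have := t.2
    simp at this
  rwa [h₀] at h

/-- As a function from `i` to `N` with constant value `∅`, `tag i` belongs to `N` by closure under
short sequences alone. Tags therefore serve as indices in place of ordinals, whose membership in `N`
would need a separate argument. -/
theorem IsModel.tag_mem (hlam : 0 < lam) (hN : IsModel lam χ wo N) {i : Ordinal.{u}}
    (hi : i < lam.ord) : tag i.toZFSet ∈ N := by
  have h : graph i.toZFSet (fun _ => ∅) ∈ N := hN.graph_mem hi fun _ _ => hN.empty_mem hlam
  have heq : graph i.toZFSet (fun _ => ∅) = tag i.toZFSet := by
    ext z
    simp only [graph, tag, ZFSet.mem_range, ZFSet.mem_prod, ZFSet.mem_singleton]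
    constructor
    · rintro ⟨t, rfl⟩
      exact ⟨t.1, t.2, ∅, rfl, rfl⟩
    · rintro ⟨a, ha, b, rfl, rfl⟩
      exact ⟨⟨a, ha⟩, rfl⟩
  rwa [heq] at h

theorem IsModel.tuple_mem (hχ : ℵ₀ ≤ χ) (hlam : ℵ₀ ≤ lam) (hN : IsModel lam χ wo N) {n : ℕ}
    {f : Fin n → ZFSet.{u}} (hf : tuple f ∈ N) (k : Fin n) : f k ∈ N := by
  have hk : ((k : ℕ) : Ordinal.{u}) < lam.ord := by
    rw [Cardinal.lt_ord, Ordinal.card_nat]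
    exact natCast_lt_aleph0.trans_le hlam
  obtain ⟨y, hy, h⟩ := hN.elementary.exists_value hχ hf
    (hN.tag_mem (Cardinal.aleph0_pos.trans_le hlam) hk) (ZFSet.mem_range.2 ⟨k, rfl⟩)
  obtain ⟨k', hk'⟩ := ZFSet.mem_range.1 h
  obtain ⟨h₁, rfl⟩ := ZFSet.pair_inj.1 hk'
  have h₂ := Ordinal.toZFSet_injective (tag_injective h₁)
  have h₃ : k' = k := Fin.ext (Nat.cast_injective h₂)
  rwa [h₃] at hy

end

/-! ### Closure properties related to the forcing notion -/

/-- The closure properties of models that are used. -/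
structure Reflects (lam : Cardinal.{u}) (ξ : Ordinal.{u}) (Sstar : Set Ordinal.{u})
    (B : Ordinal.{u} → Set Ordinal.{u}) (g : Ordinal.{u} → Ordinal.{u} → Ordinal.{u})
    (N : ZFSet.{u}) : Prop where
  mem_of_below : ∀ γ < (Order.succ lam).ord, γ.toZFSet ∈ N →
    conditionsBelow lam ξ Sstar B g γ ⊆ N
  exists_below : ∀ q ∈ conditions lam ξ Sstar B g, q ∈ N →
    ∃ γ < (Order.succ lam).ord, γ.toZFSet ∈ N ∧ (decode lam ξ Sstar B g q).Below γ
  decides_mem : ∀ s ∈ conditions lam ξ Sstar B g, s ∈ N →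
    (conditions lam ξ Sstar B g).sep (fun p => (uniformForcing lam ξ Sstar B g).le s p ∨
      ¬ ∃ r ∈ conditions lam ξ Sstar B g, (uniformForcing lam ξ Sstar B g).le s r ∧
        (uniformForcing lam ξ Sstar B g).le p r) ∈ N
  exists_le : ∀ s ∈ conditions lam ξ Sstar B g, s ∈ N → ∀ I ∈ N,
    I ⊆ conditions lam ξ Sstar B g → (∃ p ∈ I, (uniformForcing lam ξ Sstar B g).le s p) →
    ∃ p ∈ I, p ∈ N ∧ (uniformForcing lam ξ Sstar B g).le s p
  sSup_mem : ∀ (φ : Ordinal.{u} → Ordinal.{u}), ∀ i < lam.ord,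
    (∀ j < i, φ j < (Order.succ lam).ord ∧ (φ j).toZFSet ∈ N) →
    sSup ((fun j => Order.succ (φ j)) '' Iio i) < (Order.succ lam).ord ∧
      (sSup ((fun j => Order.succ (φ j)) '' Iio i)).toZFSet ∈ N

theorem sSup_succ_lt {lam : Cardinal.{u}} (hω : ℵ₀ ≤ lam) {φ : Ordinal.{u} → Ordinal.{u}}
    {i : Ordinal.{u}} (hi : i ≤ lam.ord) (hφ : ∀ j < i, φ j < (Order.succ lam).ord) :
    sSup ((fun j => Order.succ (φ j)) '' Iio i) < (Order.succ lam).ord := by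
  have hlim : Order.IsSuccLimit (Order.succ lam).ord :=
    Cardinal.isSuccLimit_ord (hω.trans (Order.le_succ lam))
  refine sSup_lt_of_card_lt (cof_succ_ord hω) (Cardinal.mk_image_le.trans_lt ?_) ?_
  · rw [Cardinal.mk_Iio_ordinal, Cardinal.lift_lt]
    exact Order.lt_succ_iff.2 (by simpa using Ordinal.card_le_card hi)
  · rintro _ ⟨j, hj, rfl⟩
    exact hlim.succ_lt (hφ j hj)

section
variable {lam lamStar χ : Cardinal.{u}} {ξ : Ordinal.{u}} {Sstar : Set Ordinal.{u}}
  {B : Ordinal.{u} → Set Ordinal.{u}} {g : Ordinal.{u} → Ordinal.{u} → Ordinal.{u}}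

/-- Five functions of `H(χ)` are packed into one parameter. A model containing it contains their
values at its own elements, and each function yields one closure property. -/
theorem exists_parameter (hlam : lam.IsInaccessible) (hχ : 2 ^ Order.succ lam < χ)
    (hB : IsColouredLadderSystem lam ξ Sstar B g) :
    ∃ c : ZFSet.{u}, InH χ c ∧ ∀ (wo : HType χ → HType χ → Prop) (N : ZFSet.{u}),
      IsModel lam χ wo N → c ∈ N → Reflects lam ξ Sstar B g N := by
  have hω := hlam.aleph0_lt.le
  have hω' : ℵ₀ ≤ Order.succ lam := hω.trans (Order.le_succ lam)
  have hsχ : Order.succ lam < χ := (Cardinal.cantor _).trans hχ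
  have hlχ : lam < χ := (Order.lt_succ lam).trans hsχ
  have hωχ : ℵ₀ ≤ χ := hω'.trans hsχ.le
  set C := conditions lam ξ Sstar B g with hC
  set L := (Order.succ lam).ord.toZFSet with hL
  have hLH : InH χ L := inH_succ_ord hsχ
  have hCH : InH χ C := inH_conditions hlam hsχ hB
  have hCcard : C.card ≤ Order.succ lam := card_conditions_le hlam hB
  have hCpow : InH χ C.powerset := hCH.powerset
    ((Cardinal.power_le_power_left two_ne_zero hCcard).trans_lt hχ)
  -- enumerations of the conditions below a given ordinal
  have hn : ∀ γ < (Order.succ lam).ord, ∃ n : ZFSet.{u} → ZFSet.{u},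
      (∀ t, n t ∈ conditionsBelow lam ξ Sstar B g γ) ∧
      ∀ y ∈ conditionsBelow lam ξ Sstar B g γ, ∃ t ∈ tagSet lam, n t = y := by
    intro γ hγ
    refine exists_enumeration ((card_conditionsBelow_le hlam hB hγ).trans (card_tagSet lam)) ?_
    have h₀ := isCond_empty (ξ := ξ) (Sstar := Sstar) (B := B) (g := g) hlam.isRegular
    refine ⟨_, ZFSet.mem_sep.2 ⟨encode_mem_conditions hB h₀, (decode_encode_LE hB h₀).2.below ?_⟩⟩
    exact ⟨empty_subset _, empty_subset _⟩
  choose! n hnC hn using hn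
  -- The enumerations are indexed by tags, all of which lie in `N`. So once `γ` is in `N`, every
  -- condition below `γ` is too.
  let c₁ := graph L fun γ => graph (tagSet lam) (n γ.rank)
  have hc₁ : InH χ c₁ := by
    refine hLH.graph hωχ fun γ hγ => (inH_tagSet hωχ hlχ).graph hωχ fun t _ => ?_
    obtain ⟨γ', hγ', rfl⟩ := Ordinal.mem_toZFSet_iff.1 hγ
    rw [Ordinal.rank_toZFSet]
    exact hCH.mem (ZFSet.mem_sep.1 (hnC γ' hγ' t)).1
  -- bounds of conditions
  have hρ : ∀ q ∈ C, ∃ γ < (Order.succ lam).ord, (decode lam ξ Sstar B g q).Below γ :=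
    fun q hq => (decode_spec hB hq).1.exists_below hω hB
  choose! ρ hρ hρq using hρ
  let c₂ := graph C fun q => (ρ q).toZFSet
  have hc₂ : InH χ c₂ := hCH.graph hωχ fun q hq =>
    hLH.mem (Ordinal.toZFSet_mem_toZFSet_iff.2 (hρ q hq))
  let J : ZFSet.{u} → ZFSet.{u} := fun s =>
    C.sep (fun p => (uniformForcing lam ξ Sstar B g).le s p ∨
      ¬ ∃ r ∈ C, (uniformForcing lam ξ Sstar B g).le s r ∧
        (uniformForcing lam ξ Sstar B g).le p r)
  let c₃ := graph C J
  have hc₃ : InH χ c₃ := hCH.graph hωχ fun s _ => hCH.subset ZFSet.sep_subset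
  -- `K s` relates a set `I` of conditions to its members above `s`; a value of this relation at `I`
  -- inside `N` is the required element of `I`.
  let K : ZFSet.{u} → ZFSet.{u} := fun s => (ZFSet.prod C.powerset C).sep fun z =>
    ∃ I p, z = ZFSet.pair I p ∧ p ∈ I ∧ (uniformForcing lam ξ Sstar B g).le s p
  let c₄ := graph C K
  have hpow : (2 : Cardinal.{u}) ^ C.card ≤ 2 ^ Order.succ lam :=
    Cardinal.power_le_power_left two_ne_zero hCcard
  have hc₄ : InH χ c₄ := hCH.graph hωχ fun s _ =>
    (InH.prod hωχ (hω'.trans (Cardinal.cantor _).le) hχ hCpow hCH (by simpa using hpow)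
      (hCcard.trans (Cardinal.cantor _).le)).subset ZFSet.sep_subset
  -- The sequences of length less than `λ` in `λ⁺`, the domain of the supremum operation. That this
  -- set is in `H(χ)` uses `2^{λ⁺} < χ`.
  let X := (ZFSet.prod lam.ord.toZFSet L).powerset.sep
    fun f => ∃ i < lam.ord, ZFSet.IsFunc i.toZFSet L f
  let σ : ZFSet.{u} → Ordinal.{u} := fun f =>
    sSup {β | ∃ (j : ZFSet.{u}) (α : Ordinal.{u}), ZFSet.pair j α.toZFSet ∈ f ∧ β = Order.succ α}
  have hσ : ∀ (φ : Ordinal.{u} → Ordinal.{u}), ∀ i,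
      σ (graph i.toZFSet fun z => (φ z.rank).toZFSet) =
        sSup ((fun j => Order.succ (φ j)) '' Iio i) := by
    intro φ i
    refine congrArg sSup (Set.ext fun β => ?_)
    constructor
    · rintro ⟨j, α, h, rfl⟩
      obtain ⟨hj, hα⟩ := pair_mem_graph.1 h
      obtain ⟨k, hk, rfl⟩ := Ordinal.mem_toZFSet_iff.1 hj
      rw [Ordinal.rank_toZFSet] at hα
      exact ⟨k, hk, by rw [Ordinal.toZFSet_injective hα]⟩
    · rintro ⟨j, hj, rfl⟩
      exact ⟨j.toZFSet, φ j, pair_mem_graph.2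
        ⟨Ordinal.toZFSet_mem_toZFSet_iff.2 hj, by rw [Ordinal.rank_toZFSet]⟩, rfl⟩
  let c₅ := graph X fun f => (σ f).toZFSet
  have hlamcard : lam.ord.toZFSet.card ≤ Order.succ lam := by
    rw [Ordinal.card_toZFSet, Cardinal.card_ord]
    exact Order.le_succ lam
  have hLcard : L.card ≤ Order.succ lam := by
    rw [hL, Ordinal.card_toZFSet, Cardinal.card_ord]
  have hXH : InH χ X := by
    refine InH.subset ((InH.prod hωχ hω' hsχ (inH_toZFSet (by rwa [Cardinal.card_ord])) hLH
      hlamcard hLcard).powerset ?_) ZFSet.sep_subset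
    exact (Cardinal.power_le_power_left two_ne_zero (card_prod_le hω' hlamcard hLcard)).trans_lt hχ
  have hc₅ : InH χ c₅ := by
    refine hXH.graph hωχ fun f hf => hLH.mem (Ordinal.toZFSet_mem_toZFSet_iff.2 ?_)
    obtain ⟨-, i, hi, hf₁, hf₂⟩ := ZFSet.mem_sep.1 hf
    have hφ : ∀ j < i, ∃ α < (Order.succ lam).ord, ∀ y, ZFSet.pair j.toZFSet y ∈ f →
        y = α.toZFSet := by
      intro j hj
      obtain ⟨y, hy, hy'⟩ := hf₂ j.toZFSet (Ordinal.toZFSet_mem_toZFSet_iff.2 hj)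
      obtain ⟨α, hα, rfl⟩ := Ordinal.mem_toZFSet_iff.1 (ZFSet.pair_mem_prod.1 (hf₁ hy)).2
      exact ⟨α, hα, hy'⟩
    choose! φ hφ hφ' using hφ
    refine lt_of_le_of_lt (csSup_le_csSup' ?_ ?_) (sSup_succ_lt hω hi.le hφ)
    · refine bddAbove_of_forall_lt (β := (Order.succ lam).ord) ?_
      rintro _ ⟨j, hj, rfl⟩
      exact (Cardinal.isSuccLimit_ord hω').succ_lt (hφ j hj)
    · rintro _ ⟨j, α, h, rfl⟩
      obtain ⟨j, hj, rfl⟩ := Ordinal.mem_toZFSet_iff.1 (ZFSet.pair_mem_prod.1 (hf₁ h)).1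
      exact ⟨j, hj, by rw [Ordinal.toZFSet_injective (hφ' j hj _ h)]⟩
  refine ⟨tuple ![c₁, c₂, c₃, c₄, c₅], inH_tuple (hlam.aleph0_lt.trans hlχ) ?_, ?_⟩
  · intro k
    fin_cases k
    exacts [hc₁, hc₂, hc₃, hc₄, hc₅]
  intro wo N hN hcN
  have hmem := hN.tuple_mem hωχ hω hcN
  have h₁ : c₁ ∈ N := hmem 0
  have h₂ : c₂ ∈ N := hmem 1
  have h₃ : c₃ ∈ N := hmem 2
  have h₄ : c₄ ∈ N := hmem 3
  have h₅ : c₅ ∈ N := hmem 4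
  refine ⟨fun γ hγ hγN p hp => ?_, fun q hq hqN => ?_, fun s hs hsN => ?_,
    fun s hs hsN I hIN hIC hI => ?_, fun φ i hi hφ => ?_⟩
  · obtain ⟨t, ht, rfl⟩ := hn γ hγ p hp
    have hE := hN.apply_mem hωχ h₁ (Ordinal.toZFSet_mem_toZFSet_iff.2 hγ) hγN
    rw [Ordinal.rank_toZFSet] at hE
    refine hN.apply_mem hωχ hE ht ?_
    obtain ⟨⟨x, hx⟩, rfl⟩ := ZFSet.mem_range.1 ht
    obtain ⟨i, hi, rfl⟩ := Ordinal.mem_toZFSet_iff.1 hx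
    exact hN.tag_mem hlam.pos hi
  · exact ⟨ρ q, hρ q hq, hN.apply_mem hωχ h₂ hq hqN, hρq q hq⟩
  · exact hN.apply_mem (f := J) hωχ h₃ hs hsN
  · have hK : K s ∈ N := hN.apply_mem hωχ h₄ hs hsN
    obtain ⟨p, hp, hle⟩ := hI
    obtain ⟨p', hp'N, hp'⟩ := hN.elementary.exists_value hωχ hK hIN (y := p)
      (ZFSet.mem_sep.2 ⟨ZFSet.pair_mem_prod.2 ⟨ZFSet.mem_powerset.2 hIC, hIC hp⟩,
        I, p, rfl, hp, hle⟩)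
    obtain ⟨-, I', p'', h, hp'', hle'⟩ := ZFSet.mem_sep.1 hp'
    obtain ⟨rfl, rfl⟩ := ZFSet.pair_inj.1 h
    exact ⟨p', hp'', hp'N, hle'⟩
  · refine ⟨sSup_succ_lt hω hi.le fun j hj => (hφ j hj).1, ?_⟩
    let f := graph i.toZFSet fun z => (φ z.rank).toZFSet
    have hfN : f ∈ N := hN.graph_mem hi fun j hj => by
      rw [Ordinal.rank_toZFSet]
      exact (hφ j hj).2
    have hfun : ZFSet.IsFunc i.toZFSet L f := by
      refine ⟨fun z hz => ?_, fun z hz => ⟨_, pair_mem_graph.2 ⟨hz, rfl⟩,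
        fun y hy => (pair_mem_graph.1 hy).2⟩⟩
      obtain ⟨⟨t, ht⟩, rfl⟩ := ZFSet.mem_range.1 hz
      obtain ⟨j, hj, rfl⟩ := Ordinal.mem_toZFSet_iff.1 ht
      refine ZFSet.pair_mem_prod.2 ⟨ht, ?_⟩
      dsimp only
      rw [Ordinal.rank_toZFSet]
      exact Ordinal.toZFSet_mem_toZFSet_iff.2 (hφ j hj).1
    have hfX : f ∈ X := by
      refine ZFSet.mem_sep.2 ⟨ZFSet.mem_powerset.2 fun z hz => ?_, i, hi, hfun⟩
      obtain ⟨a, ha, b, hb, rfl⟩ := ZFSet.mem_prod.1 (hfun.1 hz)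
      exact ZFSet.pair_mem_prod.2 ⟨Ordinal.toZFSet_subset_toZFSet_iff.2 hi.le ha, hb⟩
    have := hN.apply_mem hωχ h₅ hfX hfN
    rwa [hσ] at this

end

/-! ### The supremum of the ordinals below `λ⁺` in a model -/

/-- A continuous increasing sequence that dominates `n`. -/
noncomputable def chain (n : Ordinal.{u} → Ordinal.{u}) (i : Ordinal.{u}) : Ordinal.{u} :=
  ⨆ j : Iio i, Order.succ (max (chain n j.1) (n j.1))
termination_by i
decreasing_by exact j.2

theorem chain_eq (n : Ordinal.{u} → Ordinal.{u}) (i : Ordinal.{u}) :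
    chain n i = sSup ((fun j => Order.succ (max (chain n j) (n j))) '' Iio i) := by
  rw [chain, sSup_image']

theorem max_lt_chain (n : Ordinal.{u} → Ordinal.{u}) {i j : Ordinal.{u}} (h : j < i) :
    max (chain n j) (n j) < chain n i := by
  conv_rhs => rw [chain]
  exact (Order.lt_succ _).trans_le
    (Ordinal.le_iSup (fun j : Iio i => Order.succ (max (chain n j.1) (n j.1))) ⟨j, h⟩)

/-- At a limit, an ordinal below the supremum is at most some `max (chain n j) (n j)`, which is
below the next term of the chain. -/
theorem exists_lt_of_lt_chain (n : Ordinal.{u} → Ordinal.{u}) {i : Ordinal.{u}}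
    (hi : Order.IsSuccLimit i) {γ : Ordinal.{u}} (h : γ < chain n i) : ∃ j < i, γ < chain n j := by
  rw [chain, Ordinal.lt_iSup_iff] at h
  obtain ⟨⟨j, hj⟩, h⟩ := h
  exact ⟨Order.succ j, hi.succ_lt hj,
    (Order.lt_succ_iff.1 h).trans_lt (max_lt_chain n (Order.lt_succ j))⟩

/-- `⟨ζ i : i < λ⟩` is an increasing continuous sequence, cofinal in the set of ordinals below
`λ⁺` that belong to `a`, and all its values belong to `a`. -/
structure IsLadder (lam : Cardinal.{u}) (a : ZFSet.{u}) (ζ : Ordinal.{u} → Ordinal.{u}) :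
    Prop where
  lt : ∀ i < lam.ord, ζ i < (Order.succ lam).ord
  mem : ∀ i < lam.ord, (ζ i).toZFSet ∈ a
  mono : ∀ i j, i < j → j < lam.ord → ζ i < ζ j
  continuous : ∀ i < lam.ord, Order.IsSuccLimit i → ∀ γ < ζ i, ∃ j < i, γ < ζ j
  cofinal : ∀ α < (Order.succ lam).ord, α.toZFSet ∈ a → ∃ i < lam.ord, α < ζ i

section
variable {lam : Cardinal.{u}} {ξ : Ordinal.{u}} {Sstar : Set Ordinal.{u}}
  {B : Ordinal.{u} → Set Ordinal.{u}} {g : Ordinal.{u} → Ordinal.{u} → Ordinal.{u}}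
  {N : ZFSet.{u}}

/-- Enumerate the ordinals below `λ⁺` in `N` in `λ` steps and dominate the enumeration by a
continuous chain. Each proper initial segment of the chain has length less than `λ`, so its supremum
stays in `N`. -/
theorem Reflects.exists_isLadder (hlam : lam.IsRegular) (hN : Reflects lam ξ Sstar B g N)
    (hcard : N.card = lam) : ∃ ζ, IsLadder lam N ζ := by
  have hlim : Order.IsSuccLimit lam.ord := Cardinal.isSuccLimit_ord hlam.aleph0_le
  let x := N.sep fun y => y ∈ (Order.succ lam).ord.toZFSet
  have hx : ∀ y ∈ x, y.rank < (Order.succ lam).ord ∧ y.rank.toZFSet ∈ N ∧ y.rank.toZFSet = y := by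
    intro y hy
    obtain ⟨h₁, h₂⟩ := ZFSet.mem_sep.1 hy
    obtain ⟨α, hα, rfl⟩ := Ordinal.mem_toZFSet_iff.1 h₂
    rw [Ordinal.rank_toZFSet]
    exact ⟨hα, h₁, rfl⟩
  have hxc : x.card ≤ lam.ord.toZFSet.card := by
    rw [Ordinal.card_toZFSet, Cardinal.card_ord, ← hcard]
    exact ZFSet.card_mono ZFSet.sep_subset
  have hne : x.Nonempty := by
    have := hN.sSup_mem id 0 hlam.ord_pos (fun j hj => by simp at hj)
    exact ⟨_, ZFSet.mem_sep.2 ⟨this.2, Ordinal.toZFSet_mem_toZFSet_iff.2 this.1⟩⟩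
  obtain ⟨m, hmx, hm⟩ := exists_enumeration hxc hne
  let n : Ordinal.{u} → Ordinal.{u} := fun j => (m j.toZFSet).rank
  have key : ∀ i < lam.ord, chain n i < (Order.succ lam).ord ∧ (chain n i).toZFSet ∈ N := by
    intro i
    induction i using WellFoundedLT.induction with
    | ind i ih =>
      intro hi
      rw [chain_eq]
      refine hN.sSup_mem (fun j => max (chain n j) (n j)) i hi fun j hj => ?_
      rcases max_choice (chain n j) (n j) with h | h <;> rw [h]
      · exact ih j hj (hj.trans hi)
      · have := hx _ (hmx j.toZFSet)
        exact ⟨this.1, this.2.1⟩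
  refine ⟨chain n, fun i hi => (key i hi).1, fun i hi => (key i hi).2, fun i j hij _ => ?_,
    fun i _ hi γ hγ => exists_lt_of_lt_chain n hi hγ, fun α hα hαN => ?_⟩
  · exact (le_max_left _ _).trans_lt (max_lt_chain n hij)
  · obtain ⟨t, ht, h⟩ := hm α.toZFSet
      (ZFSet.mem_sep.2 ⟨hαN, Ordinal.toZFSet_mem_toZFSet_iff.2 hα⟩)
    obtain ⟨j, hj, rfl⟩ := Ordinal.mem_toZFSet_iff.1 ht
    refine ⟨Order.succ j, hlim.succ_lt hj,
      lt_of_le_of_lt ?_ (max_lt_chain n (Order.lt_succ j))⟩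
    have : n j = α := by simp only [n, h, Ordinal.rank_toZFSet]
    rw [this]
    exact le_max_right _ _

theorem IsLadder.exists_sup (hlam : lam.IsRegular) {a : ZFSet.{u}} {ζ : Ordinal.{u} → Ordinal.{u}}
    (hζ : IsLadder lam a ζ) : ∃ δ < (Order.succ lam).ord, ∀ α, α < δ ↔ ∃ i < lam.ord, α < ζ i := by
  have hlim : Order.IsSuccLimit lam.ord := Cardinal.isSuccLimit_ord hlam.aleph0_le
  have hlim' : Order.IsSuccLimit (Order.succ lam).ord :=
    Cardinal.isSuccLimit_ord (hlam.aleph0_le.trans (Order.le_succ lam))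
  refine ⟨_, sSup_succ_lt hlam.aleph0_le le_rfl hζ.lt, fun α => ⟨fun h => ?_, ?_⟩⟩
  · obtain ⟨_, ⟨i, hi, rfl⟩, h'⟩ := exists_lt_of_lt_csSup
      (Set.Nonempty.image _ ⟨0, hlam.ord_pos⟩) h
    exact ⟨Order.succ i, hlim.succ_lt hi,
      (Order.lt_succ_iff.1 h').trans_lt (hζ.mono _ _ (Order.lt_succ i) (hlim.succ_lt hi))⟩
  · rintro ⟨i, hi, h⟩
    refine (h.trans (Order.lt_succ _)).trans_le (le_csSup ?_ ⟨i, hi, rfl⟩)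
    refine bddAbove_of_forall_lt (β := (Order.succ lam).ord) ?_
    rintro _ ⟨j, hj, rfl⟩
    exact hlim'.succ_lt (hζ.lt j hj)

/-- The ordinal `δ` is the supremum of the ordinals below `λ⁺` in `N`, and `ζ` is a continuous
cofinal sequence. -/
structure IsSupremum (lam : Cardinal.{u}) (N : ZFSet.{u}) (δ : Ordinal.{u})
    (ζ : Ordinal.{u} → Ordinal.{u}) : Prop where
  ladder : IsLadder lam N ζ
  lt : δ < (Order.succ lam).ord
  lt_iff : ∀ α, α < δ ↔ ∃ i < lam.ord, α < ζ i

theorem IsSupremum.ladder_lt {δ : Ordinal.{u}} {ζ : Ordinal.{u} → Ordinal.{u}}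
    (hlam : lam.IsRegular) (h : IsSupremum lam N δ ζ) {i : Ordinal.{u}} (hi : i < lam.ord) :
    ζ i < δ := by
  have hlim : Order.IsSuccLimit lam.ord := Cardinal.isSuccLimit_ord hlam.aleph0_le
  exact (h.lt_iff _).2 ⟨Order.succ i, hlim.succ_lt hi,
    h.ladder.mono _ _ (Order.lt_succ i) (hlim.succ_lt hi)⟩

/-- By regularity of `λ`, the stages of the ladder needed for fewer than `λ` points are bounded
below `λ`. -/
theorem IsSupremum.exists_bound {δ : Ordinal.{u}} {ζ : Ordinal.{u} → Ordinal.{u}}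
    (hlam : lam.IsRegular) (h : IsSupremum lam N δ ζ) {s : Set Ordinal.{u}}
    (hs : #s < lift.{u + 1} lam) (hsδ : s ⊆ Iio δ) : ∃ k < lam.ord, s ⊆ Iio (ζ k) := by
  have h' : ∀ α ∈ s, ∃ i < lam.ord, α < ζ i := fun α hα => (h.lt_iff α).1 (hsδ hα)
  choose! i hi hlt using h'
  have hk : sSup (i '' s) < lam.ord := sSup_lt_of_card_lt hlam.cof_ord
    (Cardinal.mk_image_le.trans_lt hs) (by rintro _ ⟨α, hα, rfl⟩; exact hi α hα)
  refine ⟨_, hk, fun α hα => ?_⟩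
  have hle : i α ≤ sSup (i '' s) := le_csSup (bddAbove_of_forall_lt (β := lam.ord)
    (by rintro _ ⟨α, hα, rfl⟩; exact hi α hα)) ⟨α, hα, rfl⟩
  rcases hle.eq_or_lt with h₀ | h₀
  · rw [← h₀]
    exact hlt α hα
  · exact (hlt α hα).trans (h.ladder.mono _ _ h₀ hk)

theorem IsSupremum.below {δ : Ordinal.{u}} {ζ : Ordinal.{u} → Ordinal.{u}}
    (h : IsSupremum lam N δ ζ) (hN : Reflects lam ξ Sstar B g N) {q : ZFSet.{u}}
    (hq : q ∈ conditions lam ξ Sstar B g) (hqN : q ∈ N) :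
    (decode lam ξ Sstar B g q).Below δ := by
  obtain ⟨γ, hγ, hγN, hb⟩ := hN.exists_below q hq hqN
  have hγδ : γ < δ := (h.lt_iff γ).2 (h.ladder.cofinal γ hγ hγN)
  exact ⟨hb.1.trans (Iio_subset_Iio hγδ.le), hb.2.trans (Iio_subset_Iio hγδ.le)⟩

/-- The part below `δ` is small, hence below some `ζ k ∈ N`, and `N` contains all conditions below
`ζ k`. -/
theorem IsSupremum.encode_restrict_mem {δ : Ordinal.{u}} {ζ : Ordinal.{u} → Ordinal.{u}}
    (hlam : lam.IsRegular) (hB : IsColouredLadderSystem lam ξ Sstar B g)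
    (h : IsSupremum lam N δ ζ) (hN : Reflects lam ξ Sstar B g N) {c : CondData.{u}}
    (hc : IsCond lam ξ Sstar B g c) : (c.restrict δ).encode lam ∈ N := by
  have hr := hc.restrict hB δ
  have hs : #((c.restrict δ).U ∪ (c.restrict δ).V : Set Ordinal.{u}) < lift.{u + 1} lam :=
    (Cardinal.mk_union_le _ _).trans_lt (Cardinal.add_lt_of_lt
      (IsRegular.lift.{u + 1} hlam).aleph0_le hr.U_card hr.V_card)
  obtain ⟨k, hk, hsk⟩ := h.exists_bound hlam hs
    (union_subset (fun _ hα => hα.2) fun _ hα => hα.2)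
  refine hN.mem_of_below (ζ k) (h.ladder.lt k hk) (h.ladder.mem k hk) (ZFSet.mem_sep.2
    ⟨encode_mem_conditions hB hr, (decode_encode_LE hB hr).2.below ⟨?_, ?_⟩⟩)
  · exact subset_union_left.trans hsk
  · exact subset_union_right.trans hsk

/-! ### Upper bounds at limit stages -/

/-- A ladder has points and these have colours below `ξ`. Thus `ξ = 0`, where no ordinal can be put
into `u`, leaves `S*` empty. -/
theorem IsColouredLadderSystem.colours_ne_zero (hlam : lam.IsRegular)
    (hB : IsColouredLadderSystem lam ξ Sstar B g) {β : Ordinal.{u}} (hβ : β ∈ Sstar) : ξ ≠ 0 := by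
  have hpos : 0 < β := by
    rw [← Ordinal.cof_pos, hB.cof_eq β hβ]
    exact hlam.pos
  obtain ⟨γ, hγ, -⟩ := hB.exists_gt hlam hβ hpos
  exact (pos_of_gt (hB.values β hβ γ hγ)).ne'

/-- Let `q` be the minimal bound of the chain. A new point of a club at `β < δ` is a limit of points
of `d`, so it belongs to the closed club of `d`. The only new point of the club at `δ` is `ζ i`, and
`d` is assumed to colour it correctly. New points of clubs beyond `δ` are not below `δ`, because `δ`
is in every `u`. So `q` and `d` agree and can be merged. -/
theorem exists_limit_condition (hlam : lam.IsRegular)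
    (hB : IsColouredLadderSystem lam ξ Sstar B g) {δ : Ordinal.{u}}
    {ζ : Ordinal.{u} → Ordinal.{u}} (h : IsSupremum lam N δ ζ) {i : Ordinal.{u}}
    (hi : i < lam.ord) (hlim : Order.IsSuccLimit i) {c : Ordinal.{u} → CondData.{u}}
    (hc : ∀ j < i, IsCond lam ξ Sstar B g (c j)) (hmono : ∀ j k, j < k → k < i → (c j).LE (c k))
    (hcU : ∀ j < i, ξ ≠ 0 → δ ∈ (c j).U) (hcV : ∀ j < i, δ ∈ Sstar → δ ∈ (c j).V)
    (hbound : ∀ j < i, ∃ η < i, (c j).U ∩ Iio δ ⊆ Iio (ζ η))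
    (hgrow : δ ∈ Sstar → ∀ j < i, ∃ k < i, ∃ γ ∈ (c k).E δ, ζ j < γ) :
    ∃ q : CondData.{u}, IsCond lam ξ Sstar B g q ∧ (∀ j < i, (c j).LE q) ∧
      (δ ∈ Sstar → δ ∈ q.V ∧ ζ i ∈ q.E δ) ∧
      ∀ d : CondData.{u}, IsCond lam ξ Sstar B g d → d.Below δ →
        (∀ j < i, ((c j).restrict δ).LE d) →
        (δ ∈ Sstar → d.H (ζ i) = g δ (ζ i)) →
        ∃ e : CondData.{u}, IsCond lam ξ Sstar B g e ∧ q.LE e ∧ d.LE e := by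
  obtain ⟨q, hq, hle, hqV, hqU, hqE⟩ := exists_upperBound hlam hB hi hc hmono
  have hζ : ∀ j < i, δ ∈ Sstar → ∀ ε ∈ (c j).E δ, ε < ζ i := by
    intro j hj hδ ε hε
    have hδV := hcV j hj hδ
    obtain ⟨η, hη, hsub⟩ := hbound j hj
    exact (hsub ⟨(hc j hj).E_sub_U δ hδV hε, (hc j hj).E_lt_self hB hδV ε hε⟩ : ε < ζ η).trans
      (h.ladder.mono _ _ hη hi)
  have hζ' : δ ∈ Sstar → ∀ γ < ζ i, ∃ k < i, ∃ ε ∈ (c k).E δ, γ < ε := by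
    intro hδ γ hγ
    obtain ⟨j, hj, hγj⟩ := h.ladder.continuous i hi hlim γ hγ
    obtain ⟨k, hk, ε, hε, hlt⟩ := hgrow hδ j hj
    exact ⟨k, hk, ε, hε, hγj.trans hlt⟩
  have hpos : 0 < i := hlim.bot_lt
  have hδq : δ ∈ Sstar → δ ∈ q.V := fun hδ => (hle 0 hpos).V_sub (hcV 0 hpos hδ)
  -- The clubs at `δ` stay below `ζ i` by `hbound` and reach arbitrarily high below it by `hgrow`
  -- and continuity of `ζ`, so `ζ i` is their supremum.
  have hζq : δ ∈ Sstar → ζ i ∈ q.E δ := by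
    intro hδ
    let s : Set Ordinal.{u} := {ε | ∃ k < i, ε ∈ (c k).E δ}
    have hs : IsLUB s (ζ i) := by
      constructor
      · rintro ε ⟨k, hk, hε⟩
        exact (hζ k hk hδ ε hε).le
      · intro b hb
        by_contra hlt
        obtain ⟨k, hk, ε, hε, hlt'⟩ := hζ' hδ b (not_le.1 hlt)
        exact (hb ⟨k, hk, hε⟩).not_gt hlt'
    have hne : s.Nonempty := by
      obtain ⟨k, hk, ε, hε, -⟩ := hgrow hδ 0 hpos
      exact ⟨ε, k, hk, hε⟩
    refine closure_minimal ?_ (hq.E_closed δ (hδq hδ)) (hs.mem_closure hne)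
    rintro ε ⟨k, hk, hε⟩
    exact ((hle k hk).E_ext δ (hcV k hk hδ)).1 hε
  refine ⟨q, hq, hle, fun hδ => ⟨hδq hδ, hζq hδ⟩, fun d hd hdδ hdc hdζ => ?_⟩
  have hmem : ∀ β ∈ d.V, β < δ := fun β hβ => hdδ.2 hβ
  -- the part of `q` at `β < δ` is contained in that of `d`
  have hEd : ∀ β ∈ q.V, β < δ → β ∈ d.V ∧ q.E β ⊆ d.E β := by
    intro β hβ hβδ
    obtain ⟨j, hj, hjβ⟩ := hqV β hβ
    have hβd : β ∈ d.V := (hdc j hj).V_sub ⟨hjβ, hβδ⟩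
    refine ⟨hβd, fun α hα => ?_⟩
    rcases hqE β hβ α hα with ⟨k, hk, hkβ, hkα⟩ | ⟨hub, hne, hlb⟩
    · exact ((hdc k hk).E_ext β ⟨hkβ, hβδ⟩).1 hkα
    · let s : Set Ordinal.{u} := {ε | ∃ k < i, β ∈ (c k).V ∧ ε ∈ (c k).E β}
      have hs : IsLUB s α := by
        constructor
        · rintro ε ⟨k, hk, hkβ, hε⟩
          exact (hub k hk hkβ ε hε).le
        · intro b hb
          by_contra hlt
          obtain ⟨k, hk, hkβ, ε, hε, hlt'⟩ := hlb b (not_le.1 hlt)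
          exact (hb ⟨k, hk, hkβ, hε⟩).not_gt hlt'
      have hne : s.Nonempty := by
        obtain ⟨k, hk, hkβ, ε, hε⟩ := hne
        exact ⟨ε, k, hk, hkβ, hε⟩
      refine closure_minimal ?_ (hd.E_closed β hβd) (hs.mem_closure hne)
      rintro ε ⟨k, hk, hkβ, hε⟩
      exact ((hdc k hk).E_ext β ⟨hkβ, hβδ⟩).1 hε
  suffices H : _ ∧ _ ∧ _ from
    let ⟨e, he, hqe, hde, _⟩ := hq.exists_merge hlam hB hd H.1 H.2.1 (fun _ => 0) H.2.2
    ⟨e, he, hqe, hde⟩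
  refine ⟨fun α hα hαd => ?_,
    fun β hβ hβd => ⟨(hEd β hβ (hmem β hβd)).2, fun α hα hαq γ hγ => ?_⟩, fun β hβ => ?_⟩
  · have hαδ : α < δ := hdδ.1 hαd
    rcases hqU α hα with ⟨j, hj, hjα⟩ | ⟨β, hβ, hαβ⟩
    · rw [← (hle j hj).H_eq α hjα]
      exact (hdc j hj).H_eq α ⟨hjα, hαδ⟩
    · rcases lt_trichotomy β δ with hlt | rfl | hlt
      · obtain ⟨hβd, hsub⟩ := hEd β hβ hlt
        rw [hq.H_agrees β hβ α hαβ, hd.H_agrees β hβd α (hsub hαβ)]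
      · have hδ := hq.V_mem β hβ
        rcases hqE β hβ α hαβ with ⟨k, hk, hkβ, hkα⟩ | ⟨hub, hne, hlb⟩
        · have hkU := (hc k hk).E_sub_U β hkβ hkα
          rw [← (hle k hk).H_eq α hkU]
          exact (hdc k hk).H_eq α ⟨hkU, hαδ⟩
        · have hα' : α = ζ i := by
            refine le_antisymm (le_of_not_gt fun hlt => ?_) (le_of_not_gt fun hlt => ?_)
            · obtain ⟨k, hk, -, ε, hε, hlt'⟩ := hlb _ hlt
              exact (hlt'.trans (hζ k hk hδ ε hε)).false
            · obtain ⟨k, hk, ε, hε, hlt'⟩ := hζ' hδ α hlt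
              exact (hlt'.trans (hub k hk (hcV k hk hδ) ε hε)).false
          rw [hq.H_agrees β hβ α hαβ, hα', hdζ hδ]
      · rcases hqE β hβ α hαβ with ⟨k, hk, hkβ, hkα⟩ | ⟨hub, -, -⟩
        · have hkU := (hc k hk).E_sub_U β hkβ hkα
          rw [← (hle k hk).H_eq α hkU]
          exact (hdc k hk).H_eq α ⟨hkU, hαδ⟩
        -- Since `δ ∈ u` and `δ < β`, the clause on suprema gives `δ ≤ sup e_β`, and a point added
        -- at the limit is at least that supremum.
        · exfalso
          obtain ⟨j, hj, hjβ⟩ := hqV β hβ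
          have hδU := hcU j hj (hB.colours_ne_zero hlam (hq.V_mem β hβ))
          have hle' : δ ≤ sSup ((c j).E β) := by
            rw [(hc j hj).E_sup β hjβ]
            exact le_csSup (bddAbove_of_forall_lt (β := β) fun _ h => h.2) ⟨hδU, hlt⟩
          exact ((hle'.trans (csSup_le' fun ε hε => (hub j hj hjβ ε hε).le)).trans_lt hαδ).false
  · rcases hqE β hβ γ hγ with ⟨k, hk, hkβ, hkγ⟩ | ⟨hub, hne, hlb⟩
    · refine ((hdc k hk).E_ext β ⟨hkβ, hmem β hβd⟩).2 α hα (fun hαk => hαq ?_) γ hkγ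
      exact ((hle k hk).E_ext β hkβ).1 hαk
    -- Were `α` below the limit point `γ`, it would lie below a point `ε` of an earlier club,
    -- although `d` end-extends that club and `α` is not in it.
    · refine lt_of_le_of_ne (le_of_not_gt fun hlt => ?_) fun h' => hαq (h' ▸ hγ)
      obtain ⟨k, hk, hkβ, ε, hε, hlt'⟩ := hlb α hlt
      have := ((hdc k hk).E_ext β ⟨hkβ, hmem β hβd⟩).2 α hα
        (fun hαk => hαq (((hle k hk).E_ext β hkβ).1 hαk)) ε hε
      exact (this.trans hlt').false
  · have hβS : β ∈ Sstar := hβ.elim (hq.V_mem β) (hd.V_mem β)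
    rw [← Ordinal.cof_pos, hB.cof_eq β hβS]
    exact hlam.pos

end

/-! ### The base -/

/-- Some sequence as in `IsLadder`, if there is one. -/
noncomputable def ladder (lam : Cardinal.{u}) (a : ZFSet.{u}) : Ordinal.{u} → Ordinal.{u} :=
  open Classical in if h : ∃ ζ, IsLadder lam a ζ then h.choose else fun _ => 0

theorem isLadder_ladder {lam : Cardinal.{u}} {a : ZFSet.{u}} (h : ∃ ζ, IsLadder lam a ζ) :
    IsLadder lam a (ladder lam a) := by
  rw [ladder, dif_pos h]
  exact h.choose_spec

/-- The set `{(α, γ)}`, a function with the single argument `α`. -/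
noncomputable def singleColour (α γ : Ordinal.{u}) : ZFSet.{u} :=
  {ZFSet.pair α.toZFSet γ.toZFSet}

/-- The restrictions to at most one argument, the `δ`-th value of the ladder of `a`, of functions
with values below `ξ`. -/
noncomputable def colourGuesses (lam : Cardinal.{u}) (ξ : Ordinal.{u}) (a : ZFSet.{u})
    (δ : Ordinal.{u}) : ZFSet.{u} :=
  a.sep fun x => x = ∅ ∨ ∃ γ < ξ, x = singleColour (ladder lam a δ) γ

/-- The set of triples `(p, δ, x)` such that the colouring of the condition `p` extends `x`. -/
noncomputable def colourBase (lam lamStar : Cardinal.{u}) (ξ : Ordinal.{u}) (Sstar : Set Ordinal.{u})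
    (B : Ordinal.{u} → Set Ordinal.{u}) (g : Ordinal.{u} → Ordinal.{u} → Ordinal.{u}) :
    ZFSet.{u} :=
  let L : ZFSet.{u} := (Order.succ lam).ord.toZFSet
  (ZFSet.prod (conditions lam ξ Sstar B g)
    (ZFSet.prod lam.ord.toZFSet (ZFSet.prod L L).powerset)).sep fun t =>
      ∃ p δ x, t = triple p δ x ∧ HBelow lam lamStar x ∧ x ⊆ (decode lam ξ Sstar B g p).hSet lam

theorem triple_inj {p p' x x' : ZFSet.{u}} {δ δ' : Ordinal.{u}} :
    triple p δ x = triple p' δ' x' ↔ p = p' ∧ δ = δ' ∧ x = x' := by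
  simp [triple, Ordinal.toZFSet_injective.eq_iff]

section
variable {lam lamStar χ : Cardinal.{u}} {ξ : Ordinal.{u}} {Sstar : Set Ordinal.{u}}
  {B : Ordinal.{u} → Set Ordinal.{u}} {g : Ordinal.{u} → Ordinal.{u} → Ordinal.{u}}
  {wo : HType χ → HType χ → Prop} {W : Set ZFSet.{u}} {N : ZFSet.{u}}

theorem CondData.hSet_subset (c : CondData.{u}) : c.hSet lam ⊆
    ZFSet.prod (Order.succ lam).ord.toZFSet (Order.succ lam).ord.toZFSet :=
  ZFSet.sep_subset

theorem CondData.LE.hSet_subset {c d : CondData.{u}} (h : c.LE d) : c.hSet lam ⊆ d.hSet lam := by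
  intro z hz
  obtain ⟨hz, α, hα, rfl⟩ := ZFSet.mem_sep.1 hz
  exact ZFSet.mem_sep.2 ⟨hz, α, h.U_sub hα, by rw [h.H_eq α hα]⟩

theorem triple_mem_colourBase {p x : ZFSet.{u}} {δ : Ordinal.{u}} :
    triple p δ x ∈ colourBase lam lamStar ξ Sstar B g ↔ p ∈ conditions lam ξ Sstar B g ∧
      δ < lam.ord ∧ HBelow lam lamStar x ∧ x ⊆ (decode lam ξ Sstar B g p).hSet lam := by
  rw [colourBase, ZFSet.mem_sep]
  constructor
  · rintro ⟨h, p', δ', x', he, hx, hsub⟩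
    obtain ⟨rfl, rfl, rfl⟩ := triple_inj.1 he
    simp only [triple, ZFSet.pair_mem_prod] at h
    exact ⟨h.1, Ordinal.toZFSet_mem_toZFSet_iff.1 h.2.1, hx, hsub⟩
  · rintro ⟨hp, hδ, hx, hsub⟩
    refine ⟨?_, p, δ, x, rfl, hx, hsub⟩
    simp only [triple, ZFSet.pair_mem_prod, ZFSet.mem_powerset]
    exact ⟨hp, Ordinal.toZFSet_mem_toZFSet_iff.2 hδ, hsub.trans (CondData.hSet_subset _)⟩

theorem inH_colourBase (hlam : lam.IsInaccessible) (hχ : 2 ^ Order.succ lam < χ)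
    (hB : IsColouredLadderSystem lam ξ Sstar B g) :
    InH χ (colourBase lam lamStar ξ Sstar B g) := by
  have hω' : ℵ₀ ≤ Order.succ lam := hlam.aleph0_lt.le.trans (Order.le_succ lam)
  have hsκ : Order.succ lam ≤ 2 ^ Order.succ lam := (Cardinal.cantor _).le
  have hsχ : Order.succ lam < χ := hsκ.trans_lt hχ
  have hωκ : ℵ₀ ≤ 2 ^ Order.succ lam := hω'.trans hsκ
  have hωχ : ℵ₀ ≤ χ := hω'.trans hsχ.le
  have hL : InH χ (Order.succ lam).ord.toZFSet := inH_succ_ord hsχ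
  have hLc : (Order.succ lam).ord.toZFSet.card ≤ Order.succ lam := by simp
  have hLLc := card_prod_le hω' hLc hLc
  have hpow : (2 : Cardinal.{u}) ^ (ZFSet.prod (Order.succ lam).ord.toZFSet
      (Order.succ lam).ord.toZFSet).card ≤ 2 ^ Order.succ lam :=
    Cardinal.power_le_power_left two_ne_zero hLLc
  have hLL := InH.powerset (InH.prod hωχ hω' hsχ hL hL hLc hLc) (hpow.trans_lt hχ)
  have hl : InH χ lam.ord.toZFSet :=
    inH_toZFSet (by rw [Cardinal.card_ord]; exact (Order.lt_succ lam).trans hsχ)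
  have hlc : lam.ord.toZFSet.card ≤ 2 ^ Order.succ lam := by
    rw [Ordinal.card_toZFSet, Cardinal.card_ord]
    exact (Order.le_succ lam).trans hsκ
  have hPc : ((ZFSet.prod (Order.succ lam).ord.toZFSet
      (Order.succ lam).ord.toZFSet).powerset).card ≤ 2 ^ Order.succ lam := by
    rw [ZFSet.card_powerset]
    exact hpow
  rw [colourBase]
  exact (InH.prod hωχ hωκ hχ (inH_conditions hlam hsχ hB) (InH.prod hωχ hωκ hχ hl hLL hlc hPc)
    ((card_conditions_le hlam hB).trans hsκ) (card_prod_le hωκ hlc hPc)).subset ZFSet.sep_subset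

theorem IsAdmissible.empty_mem {A : Set ZFSet.{u}} (hW : IsAdmissible lam χ wo A W)
    (hlam : lam ≠ 0) {a : ZFSet.{u}} (ha : a ∈ W) : ∅ ∈ a := by
  refine hW.closed a ha ∅ (ZFSet.empty_subset _) (by simpa using pos_iff_ne_zero.2 hlam) ∅
    ⟨ZFSet.empty_subset _, fun z hz => absurd hz (ZFSet.notMem_empty z)⟩

/-- A single pair is a function on a one-element subset of `a`, so the closure of `a` applies. -/
theorem IsAdmissible.singleColour_mem {A : Set ZFSet.{u}} (hW : IsAdmissible lam χ wo A W)
    (hlam : 1 < lam) {a : ZFSet.{u}} (ha : a ∈ W) {α γ : Ordinal.{u}} (hα : α.toZFSet ∈ a)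
    (hγ : γ.toZFSet ∈ a) : singleColour α γ ∈ a := by
  refine hW.closed a ha {α.toZFSet} ?_ (by simpa using hlam) _ ⟨?_, ?_⟩
  · intro z hz
    rw [ZFSet.mem_singleton.1 hz]
    exact hα
  · intro z hz
    rw [ZFSet.mem_singleton.1 hz]
    exact ZFSet.pair_mem_prod.2 ⟨ZFSet.mem_singleton.2 rfl, hγ⟩
  · intro z hz
    rw [ZFSet.mem_singleton.1 hz]
    refine ⟨γ.toZFSet, ZFSet.mem_singleton.2 rfl, fun y hy => ?_⟩
    exact (ZFSet.pair_inj.1 (ZFSet.mem_singleton.1 hy)).2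

theorem card_colourGuesses_lt (hlam : ℵ₀ ≤ lam) (hξ : ξ < lam.ord) (a : ZFSet.{u})
    (δ : Ordinal.{u}) : (colourGuesses lam ξ a δ).card < lam := by
  have hsub : colourGuesses lam ξ a δ ⊆ insert ∅
      (ZFSet.range fun z : ξ.toZFSet => singleColour (ladder lam a δ) z.1.rank) := by
    intro z hz
    rcases (ZFSet.mem_sep.1 hz).2 with rfl | ⟨γ, hγ, rfl⟩
    · exact ZFSet.mem_insert _ _
    · exact ZFSet.mem_insert_iff.2 (Or.inr (ZFSet.mem_range.2
        ⟨⟨γ.toZFSet, Ordinal.toZFSet_mem_toZFSet_iff.2 hγ⟩, by simp⟩))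
  refine (ZFSet.card_mono hsub).trans_lt (ZFSet.card_insert_le.trans_lt
    (Cardinal.add_lt_of_lt hlam ?_ ?_))
  · refine (card_range_le _).trans_lt ?_
    rw [Ordinal.card_toZFSet]
    exact Cardinal.lt_ord.1 hξ
  · exact Cardinal.one_lt_aleph0.trans_le hlam

theorem isBase_colourBase (hlam : lam.IsRegular) (hB : IsColouredLadderSystem lam ξ Sstar B g)
    (hW : IsAdmissible lam χ wo {x | HBelow lam lamStar x} W) :
    IsBase lam {x | HBelow lam lamStar x} W (uniformForcing lam ξ Sstar B g)
      (colourBase lam lamStar ξ Sstar B g) (colourGuesses lam ξ) where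
  subset t ht := by
    have ht' := ht
    rw [colourBase] at ht'
    obtain ⟨p, δ, x, rfl, -⟩ := (ZFSet.mem_sep.1 ht').2
    obtain ⟨hp, hδ, hx, -⟩ := triple_mem_colourBase.1 ht
    exact ⟨p, hp, δ, hδ, x, hx, rfl⟩
  mono p p' δ x h hle := by
    obtain ⟨hp, hδ, hx, hsub⟩ := triple_mem_colourBase.1 h
    have hp' := (uniformForcing_le.1 hle).2.1
    exact triple_mem_colourBase.2
      ⟨hp', hδ, hx, hsub.trans ((le_iff_decode hB hp hp').1 hle).hSet_subset⟩
  small a _ δ _ := ⟨ZFSet.sep_subset, card_colourGuesses_lt hlam.aleph0_le hB.colours a δ⟩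
  obey q hq a ha δ hδ _ := by
    -- Every condition obeys the empty guess.
    refine ⟨q, hq, (uniformForcing_isForcingNotion hlam hB).refl q hq, ∅,
      ZFSet.mem_sep.2 ⟨hW.empty_mem hlam.ne_zero ha, Or.inl rfl⟩, triple_mem_colourBase.2
        ⟨hq, hδ, .set _ (fun z hz => absurd hz (ZFSet.notMem_empty z)) ?_, ZFSet.empty_subset _⟩⟩
    simpa using hlam.pos

/-- All ordinals below `λ⁺ ≤ λ*` belong to `A`. So the guesses, which may depend only on `N ∩ A`,
can still use a ladder for `N`. -/
theorem IsLadder.of_trace (h : lam < lamStar) {ζ : Ordinal.{u} → Ordinal.{u}} :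
    IsLadder lam (trace N {x | HBelow lam lamStar x}) ζ ↔ IsLadder lam N ζ := by
  have key : ∀ α < (Order.succ lam).ord,
      (α.toZFSet ∈ trace N {x | HBelow lam lamStar x} ↔ α.toZFSet ∈ N) := by
    intro α hα
    rw [trace, ZFSet.mem_sep, and_iff_left_iff_imp]
    exact fun _ => .ord α (hα.trans_le (Cardinal.ord_le_ord.2 (Order.succ_le_of_lt h)))
  constructor
  · rintro ⟨h₁, h₂, h₃, h₄, h₅⟩
    exact ⟨h₁, fun i hi => (key _ (h₁ i hi)).1 (h₂ i hi), h₃, h₄,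
      fun α hα hαN => h₅ α hα ((key α hα).2 hαN)⟩
  · rintro ⟨h₁, h₂, h₃, h₄, h₅⟩
    exact ⟨h₁, fun i hi => (key _ (h₁ i hi)).2 (h₂ i hi), h₃, h₄,
      fun α hα hαN => h₅ α hα ((key α hα).1 hαN)⟩

/-! ### The chain condition -/

theorem uniformForcing_chainCondition (hlam : lam.IsInaccessible) (hχ : 2 ^ Order.succ lam < χ)
    (hB : IsColouredLadderSystem lam ξ Sstar B g) {A : Set ZFSet.{u}}
    (hW : IsAdmissible lam χ wo A W) :
    (uniformForcing lam ξ Sstar B g).ChainCondition (Order.succ lam) := by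
  intro X hX hanti
  by_contra! hcard
  change X ⊆ conditions lam ξ Sstar B g at hX
  have hω' : ℵ₀ ≤ Order.succ lam := hlam.aleph0_lt.le.trans (Order.le_succ lam)
  have hsχ : Order.succ lam < χ := (Cardinal.cantor _).trans hχ
  have hωχ : ℵ₀ ≤ χ := hω'.trans hsχ.le
  obtain ⟨c, hcχ, hc⟩ := exists_parameter hlam hχ hB
  -- `T` relates a condition to the members of the antichain above it; its presence in `N` allows
  -- the antichain to be reflected.
  let T : ZFSet.{u} := (ZFSet.prod (conditions lam ξ Sstar B g) X).sep fun t =>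
    ∃ s q, t = ZFSet.pair s q ∧ (uniformForcing lam ξ Sstar B g).le s q
  have hCχ := inH_conditions hlam hsχ hB
  have hCc := card_conditions_le hlam hB
  have hTχ : InH χ T := (InH.prod hωχ hω' hsχ hCχ (hCχ.subset hX) hCc
    ((ZFSet.card_mono hX).trans hCc)).subset ZFSet.sep_subset
  obtain ⟨N, hN, hxN, -⟩ := hW.stationary (tuple ![c, T])
    (inH_tuple (hω'.trans_lt hsχ) (by intro k; fin_cases k; exacts [hcχ, hTχ]))
  have hmem := hN.tuple_mem hωχ hlam.aleph0_lt.le hxN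
  have hcN : c ∈ N := hmem 0
  have hTN : T ∈ N := hmem 1
  have hR := hc wo N hN hcN
  obtain ⟨ζ, hζ⟩ := hR.exists_isLadder hlam.isRegular hN.card_eq
  obtain ⟨δ, hδ, hδ'⟩ := hζ.exists_sup hlam.isRegular
  have hδS : IsSupremum lam N δ ζ := ⟨hζ, hδ, hδ'⟩
  -- The antichain has more than `λ = |N|` members.
  obtain ⟨p, hpX, hpN⟩ : ∃ p ∈ X, p ∉ N := by
    by_contra! h
    have := (hcard.trans (ZFSet.card_mono h)).trans_eq hN.card_eq
    exact absurd this (Order.lt_succ lam).not_ge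
  have hp := hX hpX
  obtain ⟨hpc, hpe⟩ := decode_spec hB hp
  have hs := hpc.restrict hB δ
  have hsC := encode_mem_conditions hB hs
  obtain ⟨q, hqN, hq⟩ := hN.elementary.exists_value hωχ hTN
    (hδS.encode_restrict_mem hlam.isRegular hB hR hpc) (y := p)
    (ZFSet.mem_sep.2 ⟨ZFSet.pair_mem_prod.2 ⟨hsC, hpX⟩, _, _, rfl,
      (encode_le_iff hB hp hs).2 (CondData.restrict_LE _ δ)⟩)
  obtain ⟨hq₁, s', q', he, hle⟩ := ZFSet.mem_sep.1 hq
  obtain ⟨rfl, rfl⟩ := ZFSet.pair_inj.1 he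
  have hqX := (ZFSet.pair_mem_prod.1 hq₁).2
  have hqC := hX hqX
  have hqb := hδS.below hR hqC hqN
  obtain ⟨e, he, hpe, hqe, -⟩ := hpc.exists_merge_of_restrict hlam.isRegular hB
    (decode_spec hB hqC).1 hqb.1 hqb.2 ((encode_le_iff hB hqC hs).1 hle) (fun _ => 0) (by
      rintro β hβ
      have hβ' : β ∈ Sstar := hβ.elim (hpc.V_mem β) ((decode_spec hB hqC).1.V_mem β)
      rw [← Ordinal.cof_pos, hB.cof_eq β hβ']
      exact hlam.pos)
  refine hanti p hpX q hqX (fun h => hpN (h ▸ hqN)) ⟨e.encode lam, encode_mem_conditions hB he,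
    (le_encode_iff hB hp he).2 hpe, (le_encode_iff hB hqC he).2 hqe⟩

end

/-! ### Dense sets that decide membership in the generic filter -/

/-- The set of conditions that are stronger than `s` or incompatible with `s`. -/
noncomputable def Forcing.deciding (P : Forcing.{u}) (s : ZFSet.{u}) : ZFSet.{u} :=
  P.carrier.sep fun p => P.le s p ∨ ¬ ∃ r ∈ P.carrier, P.le s r ∧ P.le p r

theorem Forcing.isOpenDense_deciding {P : Forcing.{u}} (hP : P.IsForcingNotion) (s : ZFSet.{u}) :
    P.IsOpenDense (P.deciding s) := by
  refine ⟨ZFSet.sep_subset, fun p hp => ?_, fun p hp p' hp' hle => ?_⟩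
  · by_cases h : ∃ r ∈ P.carrier, P.le s r ∧ P.le p r
    · obtain ⟨r, hr, hsr, hpr⟩ := h
      exact ⟨r, ZFSet.mem_sep.2 ⟨hr, Or.inl hsr⟩, hpr⟩
    · exact ⟨p, ZFSet.mem_sep.2 ⟨hp, Or.inr h⟩, hP.refl p hp⟩
  · refine ZFSet.mem_sep.2 ⟨hp', ?_⟩
    rcases (ZFSet.mem_sep.1 hp).2 with h | h
    · exact Or.inl (hP.trans _ _ _ h hle)
    · exact Or.inr fun ⟨r, hr, hsr, hpr⟩ => h ⟨r, hr, hsr, hP.trans _ _ _ hle hpr⟩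

/-! ### Strategies from one-step extensions -/

/-- If Generic can keep a property of the initial segments of a play from each stage to the next,
then she has a strategy that keeps it. -/
theorem exists_strategy (S : Set Ordinal.{u}) (L G : (Ordinal.{u} → Move.{u}) → Ordinal.{u} → Prop)
    (hG : ∀ m m' i, (∀ j ≤ i, m j = m' j) → G m i → G m' i)
    (hstep : ∀ i ∈ S, ∀ m, (∀ j < i, L m j) → (∀ j ∈ S, j < i → G m j) →
      ∃ mv, G (Function.update m i mv) i) :
    ∃ σ : Strategy.{u}, ∀ m, ∀ i ∈ S, (∀ j < i, L m j) → (∀ j ∈ S, j ≤ i → Follows σ m j) →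
      G m i := by
  classical
  -- The position is continued by the constant `mv`; entries after stage `i` are irrelevant, since
  -- `G` at `i` depends only on the play up to `i`.
  let ext (i : Ordinal.{u}) (t : Iio i → Move.{u}) (mv : Move.{u}) (j : Ordinal.{u}) : Move.{u} :=
    if h : j < i then t ⟨j, h⟩ else mv
  refine ⟨fun i t => if h : ∃ mv, G (ext i t mv) i then h.choose else (∅, ∅), fun m i => ?_⟩
  induction i using WellFoundedLT.induction with
  | ind i ih =>
    intro hi hL hσ
    obtain ⟨mv, hmv⟩ := hstep i hi m hL fun j hj hji => ih j hji hj
      (fun k hk => hL k (hk.trans hji)) fun k hk hkj => hσ k hk (hkj.trans hji.le)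
    have hex : ∃ mv, G (ext i (fun j => m j) mv) i := by
      refine ⟨mv, hG _ _ i (fun j hj => ?_) hmv⟩
      rcases hj.eq_or_lt with rfl | hj
      · simp [ext]
      · simp [ext, hj, hj.ne]
    have hmi : m i = hex.choose := by
      exact (hσ i hi le_rfl).trans (dif_pos hex)
    refine hG _ _ i (fun j hj => ?_) hex.choose_spec
    rcases hj.eq_or_lt with rfl | hj
    · simp only [ext, lt_irrefl, dif_neg, not_false_iff, hmi]
    · simp [ext, hj]

section
variable {lam lamStar χ : Cardinal.{u}} {ξ : Ordinal.{u}} {Sstar : Set Ordinal.{u}}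
  {B : Ordinal.{u} → Set Ordinal.{u}} {g : Ordinal.{u} → Ordinal.{u} → Ordinal.{u}}
  {wo : HType χ → HType χ → Prop} {W : Set ZFSet.{u}} {N : ZFSet.{u}} {δ : Ordinal.{u}}
  {ζ : Ordinal.{u} → Ordinal.{u}}

/-! ### The conditions that Generic plays -/

/-- `δ` enters with the empty club and colour `0`, and the extension lemma restores the clauses on
suprema. Having `δ` in `u` keeps later clubs beyond `δ` from acquiring limit points below it. -/
theorem IsCond.exists_adjoin (hlam : lam.IsRegular) (hB : IsColouredLadderSystem lam ξ Sstar B g)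
    (hδ : δ < (Order.succ lam).ord) {c : CondData.{u}} (hc : IsCond lam ξ Sstar B g c)
    (hcδ : c.Below δ) :
    ∃ d, IsCond lam ξ Sstar B g d ∧ c.LE d ∧ (ξ ≠ 0 → δ ∈ d.U) ∧ (δ ∈ Sstar → δ ∈ d.V) := by
  classical
  let b : CondData.{u} := ⟨c.U ∪ {α | α = δ ∧ ξ ≠ 0}, c.V ∪ {β | β = δ ∧ δ ∈ Sstar},
    fun β => if β = δ then ∅ else c.E β, fun α => if α = δ then 0 else c.H α⟩
  have hne : ∀ β, β ∈ c.U ∨ β ∈ c.V → β ≠ δ := by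
    rintro β (h | h) rfl
    · exact lt_irrefl β (hcδ.1 h)
    · exact lt_irrefl β (hcδ.2 h)
  have hcard : ∀ (s : Set Ordinal.{u}) (φ : Prop), #s < lift.{u + 1} lam →
      #(s ∪ {α | α = δ ∧ φ} : Set Ordinal.{u}) < lift.{u + 1} lam := by
    intro s φ hs
    have hω : ℵ₀ ≤ lift.{u + 1} lam := (IsRegular.lift.{u + 1} hlam).aleph0_le
    refine (Cardinal.mk_union_le _ _).trans_lt (Cardinal.add_lt_of_lt hω hs ?_)
    refine (Cardinal.mk_le_mk_of_subset (t := {δ}) fun α hα => hα.1).trans_lt ?_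
    rw [Cardinal.mk_singleton]
    exact Cardinal.one_lt_aleph0.trans_le hω
  have hb : IsPrecond lam ξ Sstar B g b := by
    refine ⟨?_, hcard _ _ hc.U_card, ?_, hcard _ _ hc.V_card, ?_, ?_, ?_, ?_, ?_⟩
    · rintro α (h | ⟨rfl, -⟩)
      exacts [hc.U_lt α h, hδ]
    · rintro β (h | ⟨rfl, h⟩)
      exacts [hc.V_mem β h, h]
    · rintro β (h | ⟨rfl, -⟩)
      · simp only [b, if_neg (hne β (Or.inr h))]
        exact (hc.E_sub_U β h).trans subset_union_left
      · simp [b]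
    · rintro β (h | ⟨rfl, -⟩)
      · simp only [b, if_neg (hne β (Or.inr h))]
        exact hc.E_sub_B β h
      · simp [b]
    · rintro β (h | ⟨rfl, -⟩)
      · simp only [b, if_neg (hne β (Or.inr h))]
        exact hc.E_closed β h
      · simp [b]
    · rintro α (h | ⟨rfl, h⟩)
      · simp only [b, if_neg (hne α (Or.inl h))]
        exact hc.H_lt α h
      · simpa [b] using pos_iff_ne_zero.2 h
    · rintro β (h | ⟨rfl, -⟩) α hα
      · simp only [b, if_neg (hne β (Or.inr h))] at hα
        simp only [b, if_neg (hne α (Or.inl (hc.E_sub_U β h hα)))]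
        exact hc.H_agrees β h α hα
      · simp [b] at hα
  have hcb : c.LE b := by
    refine ⟨subset_union_left, fun α hα => ?_, subset_union_left, fun β hβ => ?_⟩
    · simp only [b, if_neg (hne α (Or.inl hα))]
    · simp only [b, if_neg (hne β (Or.inr hβ))]
      exact EndExtends.refl _
  obtain ⟨d, hd, hbd, -⟩ := hb.exists_extension hlam hB (fun _ => 0) fun β hβ => by
    rw [← Ordinal.cof_pos, hB.cof_eq β (hb.V_mem β hβ)]
    exact hlam.pos
  exact ⟨d, hd, hcb.trans hbd, fun h => hbd.U_sub (Or.inr ⟨rfl, h⟩),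
    fun h => hbd.V_sub (Or.inr ⟨rfl, h⟩)⟩

/-- The part of `c` below `δ` is in `N`, so by elementarity it has an extension `p ∈ J ∩ N`. This
`p` lies below `δ`, hence amalgamates with `c`. -/
theorem exists_successor_condition (hlam : lam.IsRegular)
    (hB : IsColouredLadderSystem lam ξ Sstar B g) (h : IsSupremum lam N δ ζ)
    (hN : Reflects lam ξ Sstar B g N) {c : CondData.{u}} (hc : IsCond lam ξ Sstar B g c)
    {J : ZFSet.{u}} (hJN : J ∈ N) (hJ : (uniformForcing lam ξ Sstar B g).IsOpenDense J)
    {j : Ordinal.{u}} (hj : j < lam.ord) :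
    ∃ e, IsCond lam ξ Sstar B g e ∧ c.LE e ∧
      (∃ p ∈ conditions lam ξ Sstar B g, p ∈ N ∧ p ∈ J ∧ (decode lam ξ Sstar B g p).LE e) ∧
      (δ ∈ c.V → ∃ γ ∈ e.E δ, ζ j < γ) := by
  classical
  have hr := hc.restrict hB δ
  have hs := encode_mem_conditions hB hr
  obtain ⟨p, hpJ, hpN, hsp⟩ := hN.exists_le _ hs (h.encode_restrict_mem hlam hB hN hc) J hJN hJ.1
    (hJ.2.1 _ hs)
  have hp : p ∈ conditions lam ξ Sstar B g := hJ.1 hpJ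
  have hpd := (decode_spec hB hp).1
  have hb := h.below hN hp hpN
  obtain ⟨e, he, hce, hpe, hE⟩ := hc.exists_merge_of_restrict hlam hB hpd hb.1 hb.2
    ((encode_le_iff hB hp hr).1 hsp) (fun β => if β = δ then ζ j else 0) fun β hβ => by
      split_ifs with hβδ
      · rw [hβδ]
        exact h.ladder_lt hlam hj
      · have hβ' : β ∈ Sstar := hβ.elim (hc.V_mem β) (hpd.V_mem β)
        rw [← Ordinal.cof_pos, hB.cof_eq β hβ']
        exact hlam.pos
  refine ⟨e, he, hce, ⟨p, hp, hpN, hpJ, hpe⟩, fun hδ => ?_⟩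
  obtain ⟨γ, hγ, hlt⟩ := hE δ (Or.inl hδ)
  rw [if_pos rfl] at hlt
  exact ⟨γ, hγ, hlt⟩

/-- The bound of the earlier moves determines the colour of `ζ i` and witnesses that the
corresponding guess is possible. The candidate for that guess has this colour, and exactness places
it above the parts of the moves below `δ`, so the two conditions amalgamate. -/
theorem exists_candidate_condition (hlam : lam.IsRegular)
    (hB : IsColouredLadderSystem lam ξ Sstar B g)
    (hW : IsAdmissible lam χ wo {x | HBelow lam lamStar x} W)
    (hWlam : ∀ a ∈ W, lam.ord.toZFSet ⊆ a) {a : ZFSet.{u}} (ha : a ∈ W)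
    (hζ : IsLadder lam a (ladder lam a)) (h : IsSupremum lam N δ (ladder lam a))
    (hN : Reflects lam ξ Sstar B g N) {D : Filter Ordinal.{u}} {S : Set Ordinal.{u}}
    {F : Ordinal.{u} → Ordinal.{u} → Ordinal.{u}} {f I : Ordinal.{u} → ZFSet.{u}}
    {q : Ordinal.{u} → ZFSet.{u} → ZFSet.{u}}
    (hq : IsFuzzyCandidate D lam (uniformForcing lam ξ Sstar B g)
      (colourBase lam lamStar ξ Sstar B g) (possible (uniformForcing lam ξ Sstar B g)
      (colourBase lam lamStar ξ Sstar B g) (colourGuesses lam ξ) a f F) N f S F I q)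
    {i : Ordinal.{u}} (hiS : i ∈ S) (hi : i < lam.ord) (hlim : Order.IsSuccLimit i)
    {r : Ordinal.{u} → ZFSet.{u}} (hr : (uniformForcing lam ξ Sstar B g).Increasing i r)
    (hrU : ∀ j < i, ξ ≠ 0 → δ ∈ (decode lam ξ Sstar B g (r j)).U)
    (hrV : ∀ j < i, δ ∈ Sstar → δ ∈ (decode lam ξ Sstar B g (r j)).V)
    (hgrow : δ ∈ Sstar → ∀ j < i,
      ∃ γ ∈ (decode lam ξ Sstar B g (r (Order.succ j))).E δ, ladder lam a j < γ)
    (hbound : ∀ j < i, ∃ η < i,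
      (decode lam ξ Sstar B g (r (Order.succ j))).U ∩ Iio δ ⊆ Iio (ladder lam a η))
    (hdecide : ∀ j < i, ∃ η < i, I η = (uniformForcing lam ξ Sstar B g).deciding
      (((decode lam ξ Sstar B g (r (Order.succ j))).restrict δ).encode lam))
    (hinc : (uniformForcing lam ξ Sstar B g).Increasing i fun α => f (F i α))
    (hexact : Exact I i fun α => f (F i α))
    (hle : ∀ α < i, ∃ j < i, (uniformForcing lam ξ Sstar B g).le (f (F i α)) (r j)) :
    ∃ e ∈ conditions lam ξ Sstar B g, (∀ j < i, (uniformForcing lam ξ Sstar B g).le (r j) e) ∧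
      ∃ x ∈ possible (uniformForcing lam ξ Sstar B g) (colourBase lam lamStar ξ Sstar B g)
        (colourGuesses lam ξ) a f F i, (uniformForcing lam ξ Sstar B g).le (q i x) e := by
  have hP := uniformForcing_isForcingNotion hlam hB
  have hrC : ∀ j < i, r j ∈ conditions lam ξ Sstar B g := hr.1
  have hlam1 : 1 < lam := Cardinal.one_lt_aleph0.trans_le hlam.aleph0_le
  have hle' : ∀ j k, j ≤ k → k < i → (uniformForcing lam ξ Sstar B g).le (r j) (r k) := by
    intro j k hjk hk
    rcases hjk.eq_or_lt with rfl | hjk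
    · exact hP.refl _ (hr.1 _ hk)
    · exact hr.2 j k hjk hk
  obtain ⟨qs, hqs, hrqs, hqsV, hmerge⟩ := exists_limit_condition hlam hB h hi hlim
    (c := fun j => decode lam ξ Sstar B g (r j)) (fun j hj => (decode_spec hB (hrC j hj)).1)
    (hr.decode_LE hB) hrU hrV (fun j hj => by
      obtain ⟨η, hη, hsub⟩ := hbound j hj
      exact ⟨η, hη, (inter_subset_inter_left _
        (hr.decode_LE hB j _ (Order.lt_succ j) (hlim.succ_lt hj)).U_sub).trans hsub⟩)
    (fun hδ j hj => ⟨_, hlim.succ_lt hj, hgrow hδ j hj⟩)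
  have hqsC := encode_mem_conditions hB hqs
  have hrqs' : ∀ j < i, (uniformForcing lam ξ Sstar B g).le (r j) (qs.encode lam) :=
    fun j hj => (le_encode_iff hB (hrC j hj) hqs).2 (hrqs j hj)
  -- The true colour of `ζ i` is the guess if there is a ladder at `δ`; otherwise there is no
  -- constraint and the empty guess serves.
  obtain ⟨x, hxY, hxqs, hxg⟩ : ∃ x ∈ colourGuesses lam ξ a i,
      x ⊆ (decode lam ξ Sstar B g (qs.encode lam)).hSet lam ∧ (δ ∈ Sstar →
        ZFSet.pair (ladder lam a i).toZFSet (g δ (ladder lam a i)).toZFSet ∈ x) := by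
    by_cases hδ : δ ∈ Sstar
    · obtain ⟨hV, hE⟩ := hqsV hδ
      have hg := hB.values δ hδ _ (hqs.E_sub_B δ hV hE)
      refine ⟨singleColour (ladder lam a i) (g δ (ladder lam a i)), ZFSet.mem_sep.2
        ⟨hW.singleColour_mem hlam1 ha (hζ.mem i hi) (hWlam a ha
          (Ordinal.toZFSet_mem_toZFSet_iff.2 (hg.trans hB.colours))), Or.inr ⟨_, hg, rfl⟩⟩,
        fun z hz => ?_, fun _ => ZFSet.mem_singleton.2 rfl⟩
      rw [ZFSet.mem_singleton.1 hz]
      exact (decode_encode_LE hB hqs).1.hSet_subset ((toZFSet_pair_mem_hSet hB hqs.toIsPrecond).2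
        ⟨hqs.E_sub_U δ hV hE, hqs.H_agrees δ hV _ hE⟩)
    · exact ⟨∅, ZFSet.mem_sep.2 ⟨hW.empty_mem hlam.ne_zero ha, Or.inl rfl⟩,
        ZFSet.empty_subset _, fun h => absurd h hδ⟩
  have hxX : x ∈ possible (uniformForcing lam ξ Sstar B g) (colourBase lam lamStar ξ Sstar B g)
      (colourGuesses lam ξ) a f F i := by
    refine ⟨hxY, fun _ => ⟨_, hqsC, fun α hα => ?_, triple_mem_colourBase.2
      ⟨hqsC, hi, hW.subset a ha x (ZFSet.mem_sep.1 hxY).1, hxqs⟩⟩⟩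
    obtain ⟨j, hj, hjle⟩ := hle α hα
    exact hP.trans _ _ _ hjle (hrqs' j hj)
  obtain ⟨hqN, hqC⟩ := hq.mem i hiS hlim x hxX
  change q i x ∈ conditions lam ξ Sstar B g at hqC
  obtain ⟨hqle, hqR⟩ := hq.obeys i hiS hlim x hxX hinc hexact
  have hxq := (triple_mem_colourBase.1 hqR).2.2.2
  obtain ⟨hd, hde⟩ := decode_spec hB hqC
  suffices hrq : ∀ j < i, ((decode lam ξ Sstar B g (r j)).restrict δ).LE
      (decode lam ξ Sstar B g (q i x)) by
    obtain ⟨e, he, hqse, hde⟩ := hmerge _ hd (h.below hN hqC hqN) hrq fun hδ =>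
      ((toZFSet_pair_mem_hSet hB hd.toIsPrecond).1 (hxq (hxg hδ))).2
    exact ⟨_, encode_mem_conditions hB he, fun j hj => (le_encode_iff hB (hrC j hj) he).2
      ((hrqs j hj).trans hqse), x, hxX, (le_encode_iff hB hqC he).2 hde⟩
  intro j hj
  have hj' := hlim.succ_lt hj
  have hcj := (decode_spec hB (hrC _ hj')).1
  have hsj := hcj.restrict hB δ
  obtain ⟨η, hη, hIη⟩ := hdecide j hj
  obtain ⟨α, hα, hαI⟩ := hexact η hη
  rw [hIη] at hαI
  have hLE : ((decode lam ξ Sstar B g (r j)).restrict δ).LE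
      ((decode lam ξ Sstar B g (r (Order.succ j))).restrict δ) := by
    have := hr.decode_LE hB j _ (Order.lt_succ j) hj'
    exact ⟨inter_subset_inter_left _ this.U_sub, fun γ hγ => this.H_eq γ hγ.1,
      inter_subset_inter_left _ this.V_sub, fun β hβ => this.E_ext β hβ.1⟩
  refine hLE.trans ((encode_le_iff hB hqC hsj).1 ?_)
  -- The guessed sequence decides the part of `r (j + 1)` below `δ`. It cannot decide it negatively:
  -- a later move is above both that part and the deciding condition.
  rcases (ZFSet.mem_sep.1 hαI).2 with hs | hs
  · exact hP.trans _ _ _ hs (hqle α hα)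
  · obtain ⟨k, hk, hkle⟩ := hle α hα
    refine absurd ⟨r (max (Order.succ j) k), hr.1 _ (max_lt hj' hk), ?_,
      hP.trans _ _ _ hkle (hle' _ _ (le_max_right _ _) (max_lt hj' hk))⟩ hs
    exact hP.trans _ _ _ ((encode_le_iff hB (hrC _ hj') hsj).2 (CondData.restrict_LE _ δ))
      (hle' _ _ (le_max_left _ _) (max_lt hj' hk))

end

section
variable {lam lamStar χ : Cardinal.{u}} {ξ : Ordinal.{u}} {Sstar : Set Ordinal.{u}}
  {B : Ordinal.{u} → Set Ordinal.{u}} {g : Ordinal.{u} → Ordinal.{u} → Ordinal.{u}}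
  {wo : HType χ → HType χ → Prop} {W : Set ZFSet.{u}} {N : ZFSet.{u}} {δ : Ordinal.{u}}
  {ζ : Ordinal.{u} → Ordinal.{u}} {D : Filter Ordinal.{u}}

/-! ### The strategy of Generic -/

/-- The move `mv` at stage `j + 1` meets the `j`-th dense set inside `N`, pushes the club at `δ`
beyond `ζ j`, and the stages it admits have seen everything about its restriction to `δ`. -/
structure AdvancesAt (lam : Cardinal.{u}) (ξ : Ordinal.{u}) (Sstar : Set Ordinal.{u})
    (B : Ordinal.{u} → Set Ordinal.{u}) (g : Ordinal.{u} → Ordinal.{u} → Ordinal.{u})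
    (N : ZFSet.{u}) (δ : Ordinal.{u}) (ζ : Ordinal.{u} → Ordinal.{u})
    (I : Ordinal.{u} → ZFSet.{u}) (mv : Move.{u}) (j : Ordinal.{u}) : Prop where
  dense : ∃ p ∈ conditions lam ξ Sstar B g, p ∈ N ∧ p ∈ I j ∧
    (uniformForcing lam ξ Sstar B g).le p mv.1
  grow : δ ∈ Sstar → ∃ γ ∈ (decode lam ξ Sstar B g mv.1).E δ, ζ j < γ
  bound : ∀ k ∈ mv.2, ∃ η < k, (decode lam ξ Sstar B g mv.1).U ∩ Iio δ ⊆ Iio (ζ η)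
  decide : ∀ k ∈ mv.2, ∃ η < k, I η = (uniformForcing lam ξ Sstar B g).deciding
    (((decode lam ξ Sstar B g mv.1).restrict δ).encode lam)

/-- A condition above `c` with a set from `D` that make a move as in `AdvancesAt`. -/
theorem exists_advancesAt (hlam : lam.IsRegular)
    (hB : IsColouredLadderSystem lam ξ Sstar B g) (h : IsSupremum lam N δ ζ)
    (hN : Reflects lam ξ Sstar B g N) (hD : IsNormalFilter lam D) {I : Ordinal.{u} → ZFSet.{u}}
    (hI : (uniformForcing lam ξ Sstar B g).Lists lam N I) {s : ZFSet.{u}}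
    (hs : s ∈ conditions lam ξ Sstar B g)
    (hδ : δ ∈ Sstar → δ ∈ (decode lam ξ Sstar B g s).V) {j : Ordinal.{u}} (hj : j < lam.ord) :
    ∃ mv : Move.{u}, mv.1 ∈ conditions lam ξ Sstar B g ∧ mv.2 ∈ D ∧
      (uniformForcing lam ξ Sstar B g).le s mv.1 ∧ AdvancesAt lam ξ Sstar B g N δ ζ I mv j := by
  obtain ⟨hJN, hJ⟩ := (hI (I j)).2 ⟨j, hj, rfl⟩
  obtain ⟨e, he, hse, ⟨p, hp, hpN, hpI, hpe⟩, hgrow⟩ :=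
    exists_successor_condition hlam hB h hN (decode_spec hB hs).1 hJN hJ hj
  have heC := encode_mem_conditions hB he
  have hd := (decode_spec hB heC).1
  have hr := hd.restrict hB δ
  obtain ⟨η₁, hη₁, hη₁'⟩ := h.exists_bound hlam hr.U_card fun _ hα => hα.2
  obtain ⟨η₂, hη₂, hη₂'⟩ := (hI _).1 ⟨hN.decides_mem _ (encode_mem_conditions hB hr)
    (h.encode_restrict_mem hlam hB hN hd),
    Forcing.isOpenDense_deciding (uniformForcing_isForcingNotion hlam hB) _⟩
  -- `η₁` bounds the part of `u` below `δ` along `ζ`, and `η₂` is an index of the dense set deciding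
  -- that part; stages beyond both have seen the two.
  refine ⟨(e.encode lam, Ioi (max η₁ η₂)), heC, hD.endSegment _ (max_lt hη₁ hη₂),
    (le_encode_iff hB hs he).2 hse, ⟨p, hp, hpN, hpI, (le_encode_iff hB hp he).2 hpe⟩,
    fun hδS => ?_, fun k hk => ⟨η₁, (le_max_left _ _).trans_lt hk, hη₁'⟩,
    fun k hk => ⟨η₂, (le_max_right _ _).trans_lt hk, hη₂'⟩⟩
  obtain ⟨γ, hγ, hlt⟩ := hgrow (hδ hδS)
  exact ⟨γ, ((decode_encode_LE hB he).1.E_ext δ (hse.V_sub (hδ hδS))).1 hγ, hlt⟩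

/-- The clause of the winning criterion that concerns the stage `i`. -/
def WinsAt (P : Forcing.{u}) (X : Ordinal.{u} → Set ZFSet.{u}) (h : Ordinal.{u} → ZFSet.{u})
    (F : Ordinal.{u} → Ordinal.{u} → Ordinal.{u}) (I : Ordinal.{u} → ZFSet.{u})
    (q : Ordinal.{u} → ZFSet.{u} → ZFSet.{u}) (m : Ordinal.{u} → Move.{u}) (i : Ordinal.{u}) :
    Prop :=
  Order.IsSuccLimit i → (∀ j < i, i ∈ (m j).2) → P.Increasing i (fun α => h (F i α)) →
    Exact I i (fun α => h (F i α)) → (∀ α < i, ∃ j < i, P.le (h (F i α)) (m j).1) →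
    ∃ x ∈ X i, P.le (q i x) (m i).1

theorem Legal.congr {P : Forcing.{u}} {r : ZFSet.{u}} {m m' : Ordinal.{u} → Move.{u}}
    {i : Ordinal.{u}} (h : ∀ j ≤ i, m j = m' j) (hm : Legal D P r m i) : Legal D P r m' i := by
  obtain ⟨h₁, h₂, h₃, h₄⟩ := hm
  rw [h i le_rfl] at h₁ h₂ h₃ h₄
  exact ⟨h₁, h₂, h₃, fun j hj => h j hj.le ▸ h₄ j hj⟩

theorem WinsAt.congr {P : Forcing.{u}} {X : Ordinal.{u} → Set ZFSet.{u}}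
    {h : Ordinal.{u} → ZFSet.{u}} {F : Ordinal.{u} → Ordinal.{u} → Ordinal.{u}}
    {I : Ordinal.{u} → ZFSet.{u}} {q : Ordinal.{u} → ZFSet.{u} → ZFSet.{u}}
    {m m' : Ordinal.{u} → Move.{u}} {i : Ordinal.{u}} (hm : ∀ j ≤ i, m j = m' j)
    (hw : WinsAt P X h F I q m i) : WinsAt P X h F I q m' i := by
  intro h₁ h₂ h₃ h₄ h₅
  rw [← hm i le_rfl]
  refine hw h₁ (fun j hj => hm j hj.le ▸ h₂ j hj) h₃ h₄ fun α hα => ?_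
  obtain ⟨j, hj, hle⟩ := h₅ α hα
  exact ⟨j, hj, hm j hj.le ▸ hle⟩

/-- All successor stages belong to Generic, so she meets each listed dense set and prepares every
limit. Conditions above `r` retain `δ`, whoever plays them. -/
theorem isFuzzyGeneric_of_mem (hlam : lam.IsRegular)
    (hB : IsColouredLadderSystem lam ξ Sstar B g)
    (hW : IsAdmissible lam χ wo {x | HBelow lam lamStar x} W)
    (hWlam : ∀ a ∈ W, lam.ord.toZFSet ⊆ a) {a : ZFSet.{u}} (ha : a ∈ W)
    (hζ : IsLadder lam a (ladder lam a)) (h : IsSupremum lam N δ (ladder lam a))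
    (hN : Reflects lam ξ Sstar B g N) (hD : IsNormalFilter lam D) {S : Set Ordinal.{u}}
    {F : Ordinal.{u} → Ordinal.{u} → Ordinal.{u}} (hS : IsPreDiamond lam D S F)
    {f I : Ordinal.{u} → ZFSet.{u}} (hI : (uniformForcing lam ξ Sstar B g).Lists lam N I)
    {q : Ordinal.{u} → ZFSet.{u} → ZFSet.{u}}
    (hq : IsFuzzyCandidate D lam (uniformForcing lam ξ Sstar B g)
      (colourBase lam lamStar ξ Sstar B g) (possible (uniformForcing lam ξ Sstar B g)
      (colourBase lam lamStar ξ Sstar B g) (colourGuesses lam ξ) a f F) N f S F I q)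
    {r : ZFSet.{u}} (hr : r ∈ conditions lam ξ Sstar B g)
    (hrU : ξ ≠ 0 → δ ∈ (decode lam ξ Sstar B g r).U)
    (hrV : δ ∈ Sstar → δ ∈ (decode lam ξ Sstar B g r).V) :
    IsFuzzyGeneric D lam (uniformForcing lam ξ Sstar B g) (possible
      (uniformForcing lam ξ Sstar B g) (colourBase lam lamStar ξ Sstar B g)
      (colourGuesses lam ξ) a f F) N f S F I q r := by
  have hsucc : Order.IsSuccLimit lam.ord := Cardinal.isSuccLimit_ord hlam.aleph0_le
  have hP := uniformForcing_isForcingNotion hlam hB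
  set P := uniformForcing lam ξ Sstar B g with hPdef
  set X := possible P (colourBase lam lamStar ξ Sstar B g) (colourGuesses lam ξ) a f F with hX
  have hle : ∀ s, P.le r s → s ∈ conditions lam ξ Sstar B g ∧
      (ξ ≠ 0 → δ ∈ (decode lam ξ Sstar B g s).U) ∧
      (δ ∈ Sstar → δ ∈ (decode lam ξ Sstar B g s).V) := by
    intro s hs
    have hsC := (uniformForcing_le.1 hs).2.1
    have := (le_iff_decode hB hr hsC).1 hs
    exact ⟨hsC, fun h => this.U_sub (hrU h), fun h => this.V_sub (hrV h)⟩
  obtain ⟨σ, hσ⟩ := exists_strategy S (Legal D P r)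
    (fun m i => Legal D P r m i ∧
      (∀ j, i = Order.succ j → AdvancesAt lam ξ Sstar B g N δ (ladder lam a) I (m i) j) ∧
      WinsAt P X f F I q m i)
    (fun m m' i hm hG => ⟨hG.1.congr hm, hm i le_rfl ▸ hG.2.1, hG.2.2.congr hm⟩) (by
      intro i hi m hL hG
      have hilam := hS.subset i hi
      rcases Ordinal.zero_or_succ_or_isSuccLimit i with rfl | ⟨j, rfl⟩ | hlim
      · exact absurd hi hS.zero_notMem
      · have hj : j < Order.succ j := Order.lt_succ j
        have hLj := hL j hj
        obtain ⟨hsC, -, hsV⟩ := hle _ hLj.2.2.1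
        obtain ⟨mv, hmvC, hmvD, hmv, hadv⟩ := exists_advancesAt hlam hB h hN hD hI hsC hsV
          (hj.trans hilam)
        refine ⟨mv, ⟨?_, ?_, ?_, fun k hk => ?_⟩, fun k hk => ?_, fun h' => ?_⟩
        · rwa [Function.update_self]
        · rwa [Function.update_self]
        · rw [Function.update_self]
          exact hP.trans _ _ _ hLj.2.2.1 hmv
        · rw [Function.update_self, Function.update_of_ne hk.ne]
          rcases (Order.lt_succ_iff.1 hk).eq_or_lt with rfl | hkj
          · exact hmv
          · exact hP.trans _ _ _ (hLj.2.2.2 k hkj) hmv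
        · rw [Function.update_self, ← Order.succ_injective hk]
          exact hadv
        · exact absurd h' (Order.not_isSuccLimit_succ j)
      · have hinc : P.Increasing i fun j => (m j).1 :=
          ⟨fun j hj => (hL j hj).1, fun j k hjk hk => (hL k hk).2.2.2 j hjk⟩
        suffices H : ∃ e ∈ P.carrier, (∀ j < i, P.le (m j).1 e) ∧
            ((∀ j < i, i ∈ (m j).2) → P.Increasing i (fun α => f (F i α)) →
              Exact I i (fun α => f (F i α)) →
              (∀ α < i, ∃ j < i, P.le (f (F i α)) (m j).1) → ∃ x ∈ X i, P.le (q i x) e) by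
          obtain ⟨e, heC, hme, hwin⟩ := H
          have hupd : ∀ j < i, Function.update m i (e, univ) j = m j := fun j hj =>
            Function.update_of_ne hj.ne _ _
          refine ⟨(e, univ), ⟨?_, ?_, ?_, fun j hj => ?_⟩, fun j hj => ?_, ?_⟩
          · rwa [Function.update_self]
          · rw [Function.update_self]
            exact Filter.univ_mem
          · rw [Function.update_self]
            exact hP.trans _ _ _ (hL 0 hlim.bot_lt).2.2.1 (hme 0 hlim.bot_lt)
          · rw [Function.update_self, hupd j hj]
            exact hme j hj
          · exact absurd (hj ▸ hlim) (Order.not_isSuccLimit_succ j)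
          · intro _ h₁ h₂ h₃ h₄
            rw [Function.update_self]
            refine hwin (fun j hj => hupd j hj ▸ h₁ j hj) h₂ h₃ fun α hα => ?_
            obtain ⟨j, hj, hjle⟩ := h₄ α hα
            exact ⟨j, hj, hupd j hj ▸ hjle⟩
        -- If a premise of the winning clause fails at this limit, any upper bound is a good move,
        -- and completeness gives one.
        by_cases hprem : (∀ j < i, i ∈ (m j).2) ∧ P.Increasing i (fun α => f (F i α)) ∧
            Exact I i (fun α => f (F i α)) ∧ ∀ α < i, ∃ j < i, P.le (f (F i α)) (m j).1
        · obtain ⟨h₁, h₂, h₃, h₄⟩ := hprem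
          have hadv : ∀ j < i, AdvancesAt lam ξ Sstar B g N δ (ladder lam a) I
              (m (Order.succ j)) j := fun j hj =>
            (hG _ (hS.succ_mem j (hj.trans hilam)) (hlim.succ_lt hj)).2.1 j rfl
          obtain ⟨e, he, hme, hx⟩ := exists_candidate_condition hlam hB hW hWlam ha hζ h hN hq hi
            hilam hlim hinc (fun j hj => (hle _ (hL j hj).2.2.1).2.1)
            (fun j hj => (hle _ (hL j hj).2.2.1).2.2) (fun hδ j hj => (hadv j hj).grow hδ)
            (fun j hj => (hadv j hj).bound i (h₁ _ (hlim.succ_lt hj)))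
            (fun j hj => (hadv j hj).decide i (h₁ _ (hlim.succ_lt hj))) h₂ h₃ h₄
          exact ⟨e, he, hme, fun _ _ _ _ => hx⟩
        · obtain ⟨e, he, hme⟩ := uniformForcing_isComplete hlam hB i hilam _ hinc
          exact ⟨e, he, hme, fun h₁ h₂ h₃ h₄ => absurd ⟨h₁, h₂, h₃, h₄⟩ hprem⟩)
  refine ⟨σ, fun m => ⟨fun i hi hL hf => (hσ m i hi hL hf).1, fun hL hf => ?_⟩⟩
  have hG := fun i hi => hσ m i hi (fun j hj => hL j (hj.trans (hS.subset i hi)))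
    fun j hj _ => hf j hj
  refine ⟨fun α hα => ⟨_, hsucc.succ_lt hα, ((hG _ (hS.succ_mem α hα)).2.1 α rfl).dense⟩,
    fun i hi => (hG i hi).2.2⟩

theorem uniformForcing_fuzzyProperOver (hlam : lam.IsInaccessible) (hlt : lam < lamStar)
    (hχ : 2 ^ Order.succ lam < χ)
    (hB : IsColouredLadderSystem lam ξ Sstar B g)
    (hW : IsAdmissible lam χ wo {x | HBelow lam lamStar x} W)
    (hWlam : ∀ a ∈ W, lam.ord.toZFSet ⊆ a) (hD : IsNormalFilter lam D) :
    FuzzyProperOver lam χ wo {x | HBelow lam lamStar x} W (uniformForcing lam ξ Sstar B g) D := by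
  have hreg := hlam.isRegular
  obtain ⟨c, hcχ, hc⟩ := exists_parameter hlam hχ hB
  refine ⟨colourBase lam lamStar ξ Sstar B g, colourGuesses lam ξ, c, isBase_colourBase hreg hB hW,
    inH_colourBase hlam hχ hB, hcχ, ?_⟩
  intro N p h S F I q hN _ _ hcN _ ha hp hpN _ _ hF hI hq
  change p ∈ conditions lam ξ Sstar B g at hp
  have hR := hc wo N hN hcN
  obtain ⟨ζ, hζ⟩ := hR.exists_isLadder hreg hN.card_eq
  -- The ladder is chosen from the trace, as in the definition of the guesses, and only then read as
  -- a ladder for `N`.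
  have hl := isLadder_ladder ⟨ζ, (IsLadder.of_trace hlt).2 hζ⟩
  have hlN := (IsLadder.of_trace hlt).1 hl
  obtain ⟨δ, hδ, hδ'⟩ := hlN.exists_sup hreg
  have hsup : IsSupremum lam N δ _ := ⟨hlN, hδ, hδ'⟩
  obtain ⟨d, hd, hpd, hdU, hdV⟩ := (decode_spec hB hp).1.exists_adjoin hreg hB hδ
    (hsup.below hR hp hpN)
  have hdd := (decode_encode_LE hB hd).1
  exact ⟨d.encode lam, encode_mem_conditions hB hd, (le_encode_iff hB hp hd).2 hpd,
    isFuzzyGeneric_of_mem hreg hB hW hWlam ha hl hsup hR hD hF.1 hI hq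
      (encode_mem_conditions hB hd) (fun h => hdd.U_sub (hdU h)) fun h => hdd.V_sub (hdV h)⟩

end

end Fuzzy

theorem mainTheorem4 (lam lamStar χ : Cardinal.{u})
    (hlam : lam.IsInaccessible)
    (hlamStar : lamStar.IsRegular) (hlt : lam < lamStar)
    (hχ : χ.IsRegular) (hlarge : 2 ^ lamStar < χ)
    (wo : Fuzzy.HType χ → Fuzzy.HType χ → Prop) (hwo : IsWellOrder (Fuzzy.HType χ) wo)
    (W : Set ZFSet.{u})
    (hW : Fuzzy.IsAdmissible lam χ wo {x | Fuzzy.HBelow lam lamStar x} W)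
    (hWlam : ∀ a ∈ W, lam.ord.toZFSet ⊆ a)
    (ξ : Ordinal.{u}) (Sstar : Set Ordinal.{u}) (B : Ordinal.{u} → Set Ordinal.{u})
    (g : Ordinal.{u} → Ordinal.{u} → Ordinal.{u})
    (hB : Fuzzy.IsColouredLadderSystem lam ξ Sstar B g) :
    Fuzzy.FuzzyProper lam χ wo {x | Fuzzy.HBelow lam lamStar x} W
        (Fuzzy.uniformForcing lam ξ Sstar B g) ∧
      (Fuzzy.uniformForcing lam ξ Sstar B g).ChainCondition (Order.succ lam) := by
  have hpow : 2 ^ Order.succ lam < χ :=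
    (Cardinal.power_le_power_left two_ne_zero (Order.succ_le_of_lt hlt)).trans_lt hlarge
  exact ⟨⟨Fuzzy.uniformForcing_isForcingNotion hlam.isRegular hB,
    Fuzzy.inH_code hlam ((Cardinal.cantor _).trans hpow) hB,
    Fuzzy.uniformForcing_isComplete hlam.isRegular hB, fun D hD _ =>
      Fuzzy.uniformForcing_fuzzyProperOver hlam hlt hpow hB hW hWlam hD⟩,
    Fuzzy.uniformForcing_chainCondition hlam hpow hB hW⟩
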